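/- Let $\Omega\subseteq\mathbb R^n$ be open, let $\mathcal D(\Omega)$ be the space of (real- or complex-valued) test functions on $\Omega$ with its usual topology and $\mathcal D'(\Omega)$ its dual, and put $I=(0,1]$. Let $\hat{\mathcal E}(\Omega)=C^\infty(\mathcal D(\Omega)\times\Omega)$ be the space of scalar functions on $\mathcal D(\Omega)\times\Omega$ that are smooth in the sense of convenient calculus, i.e. that map smooth curves to smooth curves. For $u\in\mathcal D'(\Omega)$ and $f\in C^\infty(\Omega)$ put $(\iota u)(\varphi,x)=\langle u,\varphi\rangle$ and $(\sigma f)(\varphi,x)=f(x)$; a smooth function $f$ is also regarded as the distribution $\varphi\mapsto\int_\Omega f\varphi$. A smoothing kernel of order $q\in\mathbb N_0$ on $\Omega$ is a smooth map $I\times\Omega\to\mathcal D(\Omega)$, $(\varepsilon,x)\mapsto\tilde\phi_{\varepsilon,x}$, such that for every compact $K\subset\Omega$: (1) there are $\varepsilon_0,C>0$ with $\operatorname{supp}\tilde\phi_{\varepsilon,x}\subseteq B_{C\varepsilon}(x)$ for all $x\in K$ and $\varepsilon<\varepsilon_0$; (2) for all multi-indices $\alpha,\beta$, $\big((\partial_x+\partial_y)^\alpha\partial_y^\beta\tilde\phi\big)_{\varepsilon,x}(y)=O(\varepsilon^{-n-|\beta|})$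 as $\varepsilon\to0$, uniformly for $x\in K$, $y\in\Omega$; (3) for all $\alpha$ and all $f\in C^\infty(\Omega)$, $\int_\Omega f(y)(\partial_x^\alpha\tilde\phi)_{\varepsilon,x}(y)\,dy=(\partial^\alpha f)(x)+O(\varepsilon^{q+1})$ as $\varepsilon\to0$, uniformly for $x\in K$. $R\in\hat{\mathcal E}(\Omega)$ is moderate, $R\in\hat{\mathcal E}_m(\Omega)$, if for all compact $K\subset\Omega$ and all $\alpha$ there are $q,N\in\mathbb N_0$ such that $\sup_{x\in K}|\partial_x^\alpha(R(\tilde\phi_{\varepsilon,x},x))|=O(\varepsilon^{-N})$ for every smoothing kernel $\tilde\phi$ of order $q$. It is negligible, $R\in\hat{\mathcal N}(\Omega)$, if for all compact $K\subset\Omega$, all $\alpha$ and all $m\in\mathbb N_0$ there is $q\in\mathbb N_0$ such that $\sup_{x\in K}|\partial_x^\alpha(R(\tilde\phi_{\varepsilon,x},x))|=O(\varepsilon^m)$ for every smoothing kernel $\tilde\phi$ of order $q$. Theorem. (i) $\iota(\mathcal D'(\Omega))\subseteq\hat{\mathcal E}_m(\Omega)$; (ii) $\sigma(C^\infty(\Omega))\subseteq\hat{\mathcal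 E}_m(\Omega)$; (iii) $(\iota-\sigma)(C^\infty(\Omega))\subseteq\hat{\mathcal N}(\Omega)$; (iv) $\iota(\mathcal D'(\Omega))\cap\hat{\mathcal N}(\Omega)=\{0\}$; in particular, if $u,v\in\mathcal D'(\Omega)$ and $\iota u-\iota v\in\hat{\mathcal N}(\Omega)$, then $u=v$. -/

import Mathlib

open Set Filter Topology MeasureTheory TopologicalSpace
open scoped Distributions ContDiff

noncomputable section

namespace Colombeau

/-! ### Smooth curves and smooth maps -/

/-- A curve `c : ℝ → W` in a topological vector space is smooth if its derivatives
`d 0 = c, d 1 = c', d 2 = c'', …` of all orders exist, as limits of difference quotients in `W`. -/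
def IsSmoothCurve {W : Type*} [AddCommGroup W] [Module ℝ W] [TopologicalSpace W]
    (c : ℝ → W) : Prop :=
  ∃ d : ℕ → ℝ → W, d 0 = c ∧
    ∀ (k : ℕ) (t : ℝ),
      Tendsto (fun h : ℝ => h⁻¹ • (d k (t + h) - d k t)) (𝓝[≠] 0) (𝓝 (d (k + 1) t))

/-- A map `f`, defined on a subset `S` of a (finite-dimensional) space `V`, with values in a
locally convex space `W`, is `C^∞` on `S` if its iterated directional derivatives of all orders
exist on `S`, as limits in `W` of difference quotients taken inside `S`, and are continuous on `S`.
Here `d [v₁, …, v_k]` is the derivative of `f` in the directions `v_k, …, v₁`. This is used for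
`S = (0,1] × Ω` only; at the boundary points, those with `ε = 1`, the quotients are one-sided. For
maps from such a finite-dimensional domain into a complete space such as the space of test
functions this is the same as smoothness in the sense of convenient calculus. -/
def SmoothMapOn {V W : Type*} [AddCommGroup V] [Module ℝ V] [TopologicalSpace V]
    [AddCommGroup W] [Module ℝ W] [TopologicalSpace W] (f : V → W) (S : Set V) : Prop :=
  ∃ d : List V → V → W, EqOn (d []) f S ∧ (∀ l, ContinuousOn (d l) S) ∧
    ∀ (l : List V) (v : V), ∀ p ∈ S,
      Tendsto (fun h : ℝ => h⁻¹ • (d l (p + h • v) - d l p))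
        (𝓝[{h : ℝ | h ≠ 0 ∧ p + h • v ∈ S}] 0) (𝓝 (d (v :: l) p))

/-! ### Multi-index notation -/

/-- `D^α = D_1^{α_1} ⋯ D_n^{α_n}` for operators `D_1, …, D_n` on a set `X`. -/
def multiPow {n : ℕ} {X : Type*} (D : Fin n → X → X) (α : Fin n → ℕ) (g : X) : X :=
  (List.finRange n).foldr (fun i h => (D i)^[α i] h) g

/-- The length `|α|` of a multi-index. -/
def mdeg {n : ℕ} (α : Fin n → ℕ) : ℕ := ∑ i, α i

variable {n : ℕ} {𝕜 : Type*} [RCLike 𝕜]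

/-- The `i`-th partial derivative of a function on `ℝⁿ`. -/
def pderiv (i : Fin n) (g : EuclideanSpace ℝ (Fin n) → 𝕜) : EuclideanSpace ℝ (Fin n) → 𝕜 :=
  fun x => lineDeriv ℝ g x (EuclideanSpace.single i 1)

/-- `∂_{x_i}` acting on functions `Φ(x, y)`. -/
def pderivX (i : Fin n) (Φ : EuclideanSpace ℝ (Fin n) → EuclideanSpace ℝ (Fin n) → 𝕜) :
    EuclideanSpace ℝ (Fin n) → EuclideanSpace ℝ (Fin n) → 𝕜 :=
  fun x y => pderiv i (fun x' => Φ x' y) x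

/-- `∂_{y_i}` acting on functions `Φ(x, y)`. -/
def pderivY (i : Fin n) (Φ : EuclideanSpace ℝ (Fin n) → EuclideanSpace ℝ (Fin n) → 𝕜) :
    EuclideanSpace ℝ (Fin n) → EuclideanSpace ℝ (Fin n) → 𝕜 :=
  fun x y => pderiv i (fun y' => Φ x y') y

/-- `∂_{x_i + y_i} = ∂_{x_i} + ∂_{y_i}` acting on functions `Φ(x, y)`. -/
def pderivXY (i : Fin n) (Φ : EuclideanSpace ℝ (Fin n) → EuclideanSpace ℝ (Fin n) → 𝕜) :
    EuclideanSpace ℝ (Fin n) → EuclideanSpace ℝ (Fin n) → 𝕜 :=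
  fun x y => pderivX i Φ x y + pderivY i Φ x y

/-! ### Smooth functions on an open set -/

/-- The extension by zero of a function on the open set `Ω` to `ℝⁿ`; it serves to take derivatives
at the points of `Ω`. -/
def zeroExt (Ω : Opens (EuclideanSpace ℝ (Fin n))) (g : Ω → 𝕜) : EuclideanSpace ℝ (Fin n) → 𝕜 :=
  Function.extend Subtype.val g 0

/-- `C^∞(Ω)`. -/
def smoothFunctions (Ω : Opens (EuclideanSpace ℝ (Fin n))) (𝕜 : Type*) [RCLike 𝕜] :
    Set (Ω → 𝕜) :=
  {f | ContDiffOn ℝ ∞ (zeroExt Ω f) (Ω : Set (EuclideanSpace ℝ (Fin n)))}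

/-! ### The basic space and the embeddings -/

/-- The basic space `C^∞(𝓓(Ω) × Ω)`, in the sense of convenient calculus: the functions which map
smooth curves in `𝓓(Ω) × Ω` to smooth curves in the scalar field. -/
def basicSpace (Ω : Opens (EuclideanSpace ℝ (Fin n))) (𝕜 : Type*) [RCLike 𝕜] :
    Set (𝓓(Ω, 𝕜) × Ω → 𝕜) :=
  {R | ∀ (c : ℝ → 𝓓(Ω, 𝕜)) (γ : ℝ → Ω), IsSmoothCurve c →
    IsSmoothCurve (fun t => (γ t : EuclideanSpace ℝ (Fin n))) →
    IsSmoothCurve (fun t => R (c t, γ t))}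

/-- The embedding `(ι u)(φ, x) = ⟨u, φ⟩` of distributions. -/
def iota {Ω : Opens (EuclideanSpace ℝ (Fin n))} (u : 𝓓(Ω, 𝕜) →L[𝕜] 𝕜) : 𝓓(Ω, 𝕜) × Ω → 𝕜 :=
  fun p => u p.1

/-- The embedding `(σ f)(φ, x) = f(x)` of smooth functions. -/
def sigma {Ω : Opens (EuclideanSpace ℝ (Fin n))} (f : Ω → 𝕜) : 𝓓(Ω, 𝕜) × Ω → 𝕜 :=
  fun p => f p.2

/-- The regular distribution `φ ↦ ∫ φ(y) f(y) dy` of a (locally integrable) function `f` on `Ω`. -/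
def regularDistribution {Ω : Opens (EuclideanSpace ℝ (Fin n))} (f : Ω → 𝕜) :
    𝓓(Ω, 𝕜) →L[𝕜] 𝕜 :=
  TestFunction.integralAgainstBilinCLM (ContinuousLinearMap.mul 𝕜 𝕜) volume (zeroExt Ω f)

/-! ### Smoothing kernels -/

/-- `φ` is a smoothing kernel of order `q` on `Ω`. Only the values `φ ε x` with `ε ∈ (0,1]` and
`x ∈ Ω` matter. -/
structure IsSmoothingKernel (q : ℕ) {Ω : Opens (EuclideanSpace ℝ (Fin n))}
    (φ : ℝ → EuclideanSpace ℝ (Fin n) → 𝓓(Ω, 𝕜)) : Prop where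
  /-- `φ ∈ C^∞((0,1] × Ω, 𝓓(Ω))`. -/
  smooth : SmoothMapOn (fun p : ℝ × EuclideanSpace ℝ (Fin n) => φ p.1 p.2)
    (Ioc (0 : ℝ) 1 ×ˢ (Ω : Set (EuclideanSpace ℝ (Fin n))))
  /-- The supports shrink to the base point like `ε`, locally uniformly. -/
  supp : ∀ K : Set (EuclideanSpace ℝ (Fin n)), IsCompact K → K ⊆ Ω →
    ∃ ε₀ > 0, ∃ C > 0, ∀ x ∈ K, ∀ ε ∈ Ioc (0 : ℝ) 1, ε < ε₀ →
      tsupport (φ ε x) ⊆ Metric.ball x (C * ε)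
  /-- `(∂_{x+y}^α ∂_y^β φ)_{ε,x}(y) = O(ε^{-n-|β|})`, uniformly for `x ∈ K` and `y ∈ Ω`. -/
  growth : ∀ K : Set (EuclideanSpace ℝ (Fin n)), IsCompact K → K ⊆ Ω → ∀ α β : Fin n → ℕ,
    ∃ ε₀ > 0, ∃ C > 0, ∀ ε ∈ Ioc (0 : ℝ) 1, ε ≤ ε₀ → ∀ x ∈ K, ∀ y ∈ Ω,
      ‖multiPow pderivXY α (multiPow pderivY β fun x' y' => φ ε x' y') x y‖
        ≤ C * (ε ^ (n + mdeg β))⁻¹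
  /-- `∫ f(y) (∂_x^α φ)_{ε,x}(y) dy = (∂^α f)(x) + O(ε^{q+1})`, uniformly for `x ∈ K`. -/
  moment : ∀ K : Set (EuclideanSpace ℝ (Fin n)), IsCompact K → K ⊆ Ω → ∀ α : Fin n → ℕ,
    ∀ f ∈ smoothFunctions Ω 𝕜,
    ∃ ε₀ > 0, ∃ C > 0, ∀ ε ∈ Ioc (0 : ℝ) 1, ε ≤ ε₀ → ∀ x ∈ K,
      ‖(∫ y in (Ω : Set (EuclideanSpace ℝ (Fin n))),
          zeroExt Ω f y * multiPow pderivX α (fun x' y' => φ ε x' y') x y)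
        - multiPow pderiv α (zeroExt Ω f) x‖ ≤ C * ε ^ (q + 1)

/-! ### Moderate and negligible functions -/

/-- The function `∂_x^α (R(φ_{ε,x}, x))`, for `x ∈ Ω`. -/
def testDeriv {Ω : Opens (EuclideanSpace ℝ (Fin n))} (R : 𝓓(Ω, 𝕜) × Ω → 𝕜)
    (φ : ℝ → EuclideanSpace ℝ (Fin n) → 𝓓(Ω, 𝕜)) (α : Fin n → ℕ) (ε : ℝ) :
    EuclideanSpace ℝ (Fin n) → 𝕜 :=
  multiPow pderiv α (zeroExt Ω fun x => R (φ ε x, x))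

/-- The set of moderate elements of the basic space. -/
def moderate (Ω : Opens (EuclideanSpace ℝ (Fin n))) (𝕜 : Type*) [RCLike 𝕜] :
    Set (𝓓(Ω, 𝕜) × Ω → 𝕜) :=
  {R | R ∈ basicSpace Ω 𝕜 ∧
    ∀ K : Set (EuclideanSpace ℝ (Fin n)), IsCompact K → K ⊆ Ω → ∀ α : Fin n → ℕ,
      ∃ q N : ℕ, ∀ φ : ℝ → EuclideanSpace ℝ (Fin n) → 𝓓(Ω, 𝕜), IsSmoothingKernel q φ →
        ∃ ε₀ > 0, ∃ C > 0, ∀ ε ∈ Ioc (0 : ℝ) 1, ε ≤ ε₀ → ∀ x ∈ K,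
          ‖testDeriv R φ α ε x‖ ≤ C * (ε ^ N)⁻¹}

/-- The set of negligible elements of the basic space. -/
def negligible (Ω : Opens (EuclideanSpace ℝ (Fin n))) (𝕜 : Type*) [RCLike 𝕜] :
    Set (𝓓(Ω, 𝕜) × Ω → 𝕜) :=
  {R | R ∈ basicSpace Ω 𝕜 ∧
    ∀ K : Set (EuclideanSpace ℝ (Fin n)), IsCompact K → K ⊆ Ω → ∀ (α : Fin n → ℕ) (m : ℕ),
      ∃ q : ℕ, ∀ φ : ℝ → EuclideanSpace ℝ (Fin n) → 𝓓(Ω, 𝕜), IsSmoothingKernel q φ →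
        ∃ ε₀ > 0, ∃ C > 0, ∀ ε ∈ Ioc (0 : ℝ) 1, ε ≤ ε₀ → ∀ x ∈ K,
          ‖testDeriv R φ α ε x‖ ≤ C * ε ^ m}

end Colombeau

end

/-! Statements (i)–(iii) read the defining conditions of a smoothing kernel through the continuity
of a distribution. A kernel is smooth with values in `𝓓(Ω)`, so a distribution `u` commutes with the
derivatives in `x`: `∂_x^α ⟨u, φ_{ε,x}⟩ = ⟨u, ∂_x^α φ_{ε,x}⟩`.

For (i), `u` restricted to test functions supported in a fixed compact set is bounded by finitely
many derivatives (`exists_bound_of_eq_zero`). The support condition provides the compact set. The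
growth condition controls words in `∂_x + ∂_y` and `∂_y`; writing `∂_x = (∂_x + ∂_y) - ∂_y`, every
derivative in `x` costs at most one more power of `ε⁻¹` (`isBigOInv_wordDeriv_of_multiIndex`). For
(ii), the derivatives of `f` do not depend on `ε` and are bounded on compact sets. For (iii), the
function to be estimated is literally the left-hand side of the moment condition, so order `q = m`
is enough.

For (iv), let `ι u` be negligible and `χ` a test function. Then `⟨u, φ_{ε,x}⟩ = O(ε)` uniformly on
the support of `χ`, for one kernel of a suitable order. Hence `⟨u, ∫ χ(x) φ_{ε,x} dx⟩ = ∫ χ(x) ⟨u,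
φ_{ε,x}⟩ dx` tends to `0`, whereas `∫ χ(x) φ_{ε,x} dx` tends to `χ` in `𝓓(Ω)`; so `⟨u, χ⟩ = 0`. The
interchange of `u` and the integral is `apply_toTest_integral`, the limit is
`IsProfile.tendsto_average`.

This needs a kernel of every order on an arbitrary open set (`exists_isSmoothingKernel`). Take a
smooth radius `r` with `closedBall x (2 r(x)) ⊆ Ω`, a bump `Φ(x, ·)` of integral one supported in
the ball of radius `r(x)`, and the kernel `ε⁻ⁿ Φ(x, (y - x)/ε)`. Its pairing with `f` is `P(ε, x) =
∫ f(x + ε z) Φ(x, z) dz`, smooth across `ε = 0`, with `P(0, x) = f(x)`. Dilating `Φ` by `s` replaces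
`P(ε, x)` by `P(s ε, x)`, so a combination of dilations with Vandermonde coefficients cancels the
Taylor terms of orders `1, …, q` in `ε`, which is the moment condition of order `q`. -/

noncomputable section

namespace Colombeau

/-! ### Iterated directional derivatives along words of vectors -/

section WordDeriv

variable {V V' W : Type*} [NormedAddCommGroup V] [NormedSpace ℝ V] [NormedAddCommGroup V']
  [NormedSpace ℝ V'] [NormedAddCommGroup W] [NormedSpace ℝ W]

/-- The iterated directional derivative `∂_{v₁} ⋯ ∂_{v_k} F` for `l = [v₁, …, v_k]`. -/
def wordDeriv (l : List V) (F : V → W) : V → W :=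
  l.foldr (fun v g p => fderiv ℝ g p v) F

@[simp] theorem wordDeriv_nil (F : V → W) : wordDeriv [] F = F := rfl

theorem wordDeriv_cons (v : V) (l : List V) (F : V → W) :
    wordDeriv (v :: l) F = fun p => fderiv ℝ (wordDeriv l F) p v := rfl

theorem wordDeriv_append (l l' : List V) (F : V → W) :
    wordDeriv (l ++ l') F = wordDeriv l (wordDeriv l' F) := by
  simp [wordDeriv, List.foldr_append]

theorem ContDiffOn.wordDeriv {U : Set V} {F : V → W} (hF : ContDiffOn ℝ ∞ F U) (hU : IsOpen U)
    (l : List V) : ContDiffOn ℝ ∞ (wordDeriv l F) U := by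
  induction l with
  | nil => exact hF
  | cons v l ih => exact (ih.fderiv_of_isOpen hU (by simp)).clm_apply contDiffOn_const

theorem wordDeriv_differentiableAt {U : Set V} {F : V → W} (hF : ContDiffOn ℝ ∞ F U)
    (hU : IsOpen U) (l : List V) {p : V} (hp : p ∈ U) :
    DifferentiableAt ℝ (wordDeriv l F) p :=
  ((ContDiffOn.wordDeriv hF hU l).contDiffAt (hU.mem_nhds hp)).differentiableAt (by simp)

theorem wordDeriv_congr {U : Set V} {F G : V → W} (hU : IsOpen U) (h : EqOn F G U) (l : List V) :
    EqOn (wordDeriv l F) (wordDeriv l G) U := by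
  induction l with
  | nil => exact h
  | cons v l ih =>
    intro p hp
    simp only [wordDeriv_cons]
    rw [(ih.eventuallyEq_of_mem (hU.mem_nhds hp)).fderiv_eq]

theorem wordDeriv_zero (l : List V) : wordDeriv l (0 : V → W) = 0 := by
  induction l with
  | nil => rfl
  | cons v l ih => ext p; simp [wordDeriv_cons, ih]

theorem wordDeriv_swap {U : Set V} {F : V → W} (hF : ContDiffOn ℝ ∞ F U) (hU : IsOpen U)
    (v w : V) : EqOn (wordDeriv [v, w] F) (wordDeriv [w, v] F) U := by
  intro p hp
  have h := hF.contDiffAt (hU.mem_nhds hp)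
  have hd : DifferentiableAt ℝ (fderiv ℝ F) p :=
    (h.fderiv_right (m := ∞) (by simp)).differentiableAt (by simp)
  have key : ∀ a b : V, wordDeriv [a, b] F p = fderiv ℝ (fderiv ℝ F) p a b := fun a b => by
    simp only [wordDeriv_cons, wordDeriv_nil]
    rw [fderiv_clm_apply hd (differentiableAt_const b)]
    simp
  rw [key, key]
  exact (h.isSymmSndFDerivAt (by
    simpa using WithTop.coe_le_coe.2 (le_top : (2 : ℕ∞) ≤ ⊤))).eq v w

theorem wordDeriv_perm {U : Set V} {F : V → W} (hF : ContDiffOn ℝ ∞ F U) (hU : IsOpen U)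
    {l l' : List V} (h : l.Perm l') : EqOn (wordDeriv l F) (wordDeriv l' F) U := by
  induction h with
  | nil => exact fun _ _ => rfl
  | cons v _ ih => exact wordDeriv_congr hU ih [v]
  | swap v w l => exact wordDeriv_swap (ContDiffOn.wordDeriv hF hU l) hU w v
  | trans _ _ ih₁ ih₂ => exact ih₁.trans ih₂

theorem wordDeriv_comp_affine {U : Set V} {F : V → W} (hF : ContDiffOn ℝ ∞ F U) (hU : IsOpen U)
    (A : V' →L[ℝ] V) (c : V) (l : List V') {p : V'} (hp : A p + c ∈ U) :
    wordDeriv l (fun q => F (A q + c)) p = wordDeriv (l.map A) F (A p + c) := by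
  induction l generalizing p with
  | nil => rfl
  | cons v l ih =>
    have hopen : IsOpen {q | A q + c ∈ U} := hU.preimage (by fun_prop)
    have hev : wordDeriv l (fun q => F (A q + c)) =ᶠ[𝓝 p]
        fun q => wordDeriv (l.map A) F (A q + c) := by
      filter_upwards [hopen.mem_nhds hp] with q hq using ih hq
    simp only [wordDeriv_cons, List.map_cons]
    rw [hev.fderiv_eq]
    have h1 := (wordDeriv_differentiableAt hF hU (l.map A) hp).hasFDerivAt
    have h2 : HasFDerivAt (fun q => A q + c) A p := A.hasFDerivAt.add_const c
    exact congrArg (fun L : V' →L[ℝ] W => L v) (h1.comp p h2).fderiv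

theorem wordDeriv_sub {U : Set V} {F G : V → W} (hF : ContDiffOn ℝ ∞ F U)
    (hG : ContDiffOn ℝ ∞ G U) (hU : IsOpen U) (l : List V) :
    EqOn (wordDeriv l (fun p => F p - G p)) (fun p => wordDeriv l F p - wordDeriv l G p) U := by
  induction l with
  | nil => exact fun _ _ => rfl
  | cons v l ih =>
    intro p hp
    simp only [wordDeriv_cons]
    rw [(ih.eventuallyEq_of_mem (hU.mem_nhds hp)).fderiv_eq, fderiv_fun_sub
      (wordDeriv_differentiableAt hF hU l hp) (wordDeriv_differentiableAt hG hU l hp)]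
    rfl

theorem wordDeriv_const_smul {R : Type*} [NormedField R] [NormedSpace R W] [SMulCommClass ℝ R W]
    [ContinuousConstSMul R W] {U : Set V} {F : V → W}
    (hF : ContDiffOn ℝ ∞ F U) (hU : IsOpen U) (a : R) (l : List V) :
    EqOn (wordDeriv l (fun p => a • F p)) (fun p => a • wordDeriv l F p) U := by
  induction l with
  | nil => exact fun _ _ => rfl
  | cons v l ih =>
    intro p hp
    simp only [wordDeriv_cons]
    rw [(ih.eventuallyEq_of_mem (hU.mem_nhds hp)).fderiv_eq,
      fderiv_fun_const_smul (wordDeriv_differentiableAt hF hU l hp) a]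
    rfl

theorem wordDeriv_sum {ι : Type*} (s : Finset ι) {U : Set V} {F : ι → V → W}
    (hF : ∀ j, ContDiffOn ℝ ∞ (F j) U) (hU : IsOpen U) (l : List V) :
    EqOn (wordDeriv l (fun p => ∑ j ∈ s, F j p)) (fun p => ∑ j ∈ s, wordDeriv l (F j) p) U := by
  induction l with
  | nil => exact fun _ _ => rfl
  | cons v l ih =>
    intro p hp
    simp only [wordDeriv_cons]
    rw [(ih.eventuallyEq_of_mem (hU.mem_nhds hp)).fderiv_eq, fderiv_fun_sum
      fun j _ => wordDeriv_differentiableAt (hF j) hU l hp]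
    simp

theorem iteratedFDeriv_apply_eq_wordDeriv {U : Set V} {F : V → W} (hF : ContDiffOn ℝ ∞ F U)
    (hU : IsOpen U) {k : ℕ} (s : Fin k → V) {p : V} (hp : p ∈ U) :
    iteratedFDeriv ℝ k F p s = wordDeriv (List.ofFn s) F p := by
  induction k generalizing p with
  | zero => simp
  | succ k ih =>
    have hd : DifferentiableAt ℝ (iteratedFDeriv ℝ k F) p :=
      (hF.contDiffAt (hU.mem_nhds hp)).differentiableAt_iteratedFDeriv
        (by exact_mod_cast WithTop.coe_lt_coe.2 (ENat.natCast_lt_top k))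
    rw [hd.iteratedFDeriv_succ_apply_left', List.ofFn_succ, wordDeriv_cons]
    have hev : (fun y => iteratedFDeriv ℝ k F y (Fin.tail s)) =ᶠ[𝓝 p]
        wordDeriv (List.ofFn fun i => s i.succ) F := by
      filter_upwards [hU.mem_nhds hp] with q hq using ih _ hq
    rw [hev.fderiv_eq]

end WordDeriv

variable {n : ℕ}

/-- The `i`-th vector of the standard basis of `ℝⁿ`. -/
abbrev stdVec (i : Fin n) : EuclideanSpace ℝ (Fin n) := EuclideanSpace.single i 1

/-- Expand each argument in the standard basis: there are `n ^ k` terms, and every coordinate is at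
most the norm of its vector. -/
theorem norm_multilinear_le_of_stdVec {W : Type*} [NormedAddCommGroup W] [NormedSpace ℝ W] {k : ℕ}
    (m : ContinuousMultilinearMap ℝ (fun _ : Fin k => EuclideanSpace ℝ (Fin n)) W) {M : ℝ}
    (hM : 0 ≤ M) (h : ∀ s : Fin k → Fin n, ‖m fun i => stdVec (s i)‖ ≤ M) :
    ‖m‖ ≤ (n : ℝ) ^ k * M := by
  refine m.opNorm_le_bound (by positivity) fun v => ?_
  have hv : v = fun i => ∑ j, v i j • stdVec j := by
    funext i
    simpa using ((EuclideanSpace.basisFun (Fin n) ℝ).sum_repr (v i)).symm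
  have e : m v = ∑ s : Fin k → Fin n, (∏ i, v i (s i)) • m fun i => stdVec (s i) := by
    conv_lhs => rw [hv]
    rw [m.map_sum]
    exact Finset.sum_congr rfl fun s _ => m.map_smul_univ (fun i => v i (s i)) _
  rw [e]
  calc ‖∑ s : Fin k → Fin n, (∏ i, v i (s i)) • m fun i => stdVec (s i)‖
      ≤ ∑ s : Fin k → Fin n, (∏ i, ‖v i‖) * M := by
        refine norm_sum_le_of_le _ fun s _ => ?_
        rw [norm_smul, norm_prod]
        refine mul_le_mul (Finset.prod_le_prod (fun _ _ => norm_nonneg _) fun i _ => ?_) (h s)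
          (norm_nonneg _) (Finset.prod_nonneg fun _ _ => norm_nonneg _)
        exact PiLp.norm_apply_le (v i) (s i)
    _ = (n : ℝ) ^ k * M * ∏ i, ‖v i‖ := by
        simp [Finset.sum_const]
        ring

/-! ### Smooth families of test functions -/

section TestFamilies

variable {n : ℕ} {𝕜 : Type*} [RCLike 𝕜]

open Classical in
/-- The test function on `Ω` with underlying function `g`; it is `0` if `g` is not one. -/
def toTest (Ω : Opens (EuclideanSpace ℝ (Fin n))) (g : EuclideanSpace ℝ (Fin n) → 𝕜) : 𝓓(Ω, 𝕜) :=
  if h : ContDiff ℝ ∞ g ∧ HasCompactSupport g ∧ tsupport g ⊆ Ω then ⟨g, h.1, h.2.1, h.2.2⟩ else 0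

open Classical in
/-- The element of `𝓓_K` with underlying function `g`; it is `0` if `g` is not one. -/
def toSupported (K : Compacts (EuclideanSpace ℝ (Fin n))) (g : EuclideanSpace ℝ (Fin n) → 𝕜) :
    𝓓_{K}(EuclideanSpace ℝ (Fin n), 𝕜) :=
  if h : ContDiff ℝ ∞ g ∧ EqOn g 0 (K : Set (EuclideanSpace ℝ (Fin n)))ᶜ then ⟨g, h.1, h.2⟩ else 0

variable {Ω : Opens (EuclideanSpace ℝ (Fin n))} {K : Compacts (EuclideanSpace ℝ (Fin n))}
  {g : EuclideanSpace ℝ (Fin n) → 𝕜}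

theorem coe_toSupported (hg : ContDiff ℝ ∞ g)
    (h0 : EqOn g 0 (K : Set (EuclideanSpace ℝ (Fin n)))ᶜ) : ⇑(toSupported K g) = g := by
  rw [toSupported, dif_pos ⟨hg, h0⟩]; rfl

theorem toTest_eq_ofSupportedIn (hK : (K : Set (EuclideanSpace ℝ (Fin n))) ⊆ Ω)
    (hg : ContDiff ℝ ∞ g) (h0 : EqOn g 0 (K : Set (EuclideanSpace ℝ (Fin n)))ᶜ) :
    toTest Ω g = TestFunction.ofSupportedIn hK (toSupported K g) := by
  have hs : tsupport g ⊆ K := closure_minimal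
    (Function.support_subset_iff'.2 h0) K.isCompact.isClosed
  ext y
  change toTest Ω g y = toSupported K g y
  rw [coe_toSupported hg h0, toTest, dif_pos ⟨hg, HasCompactSupport.intro K.isCompact h0, hs.trans hK⟩]
  rfl

theorem coe_toTest (hK : (K : Set (EuclideanSpace ℝ (Fin n))) ⊆ Ω) (hg : ContDiff ℝ ∞ g)
    (h0 : EqOn g 0 (K : Set (EuclideanSpace ℝ (Fin n)))ᶜ) : ⇑(toTest Ω g) = g := by
  rw [toTest_eq_ofSupportedIn hK hg h0]
  exact coe_toSupported hg h0

theorem toTest_coe (ψ : 𝓓(Ω, 𝕜)) : toTest Ω ⇑ψ = ψ := by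
  rw [toTest, dif_pos ⟨ψ.contDiff, ψ.hasCompactSupport, ψ.tsupport_subset⟩]; rfl

theorem tendstoUniformly_of_eq {ι X : Type*} {l : Filter ι} {f f' : ι → X → 𝕜} {a a' : X → 𝕜}
    (h : TendstoUniformly f a l) (hf : ∀ᶠ i in l, f i = f' i) (ha : a = a') :
    TendstoUniformly f' a' l := by
  subst ha
  intro u hu
  filter_upwards [h u hu, hf] with i hi he x
  exact he ▸ hi x

theorem tendsto_toSupported {ι : Type*} {l : Filter ι} {f : ι → EuclideanSpace ℝ (Fin n) → 𝕜}
    (hf : ∀ᶠ i in l, ContDiff ℝ ∞ (f i) ∧ EqOn (f i) 0 (K : Set (EuclideanSpace ℝ (Fin n)))ᶜ)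
    (hg : ContDiff ℝ ∞ g) (h0 : EqOn g 0 (K : Set (EuclideanSpace ℝ (Fin n)))ᶜ)
    (h : ∀ w : List (Fin n), TendstoUniformly (fun i => wordDeriv (w.map stdVec) (f i))
      (wordDeriv (w.map stdVec) g) l) :
    Tendsto (fun i => toSupported K (f i)) l (𝓝 (toSupported K g)) := by
  -- The topology of `𝓓_K` is initial for the maps to the iterated derivatives of each order `k`,
  -- with uniform convergence. Order `k` is controlled by the finitely many words of length `k` in
  -- the basis vectors.
  rw [show 𝓝 (toSupported K g) = ⨅ k, comap (ContDiffMapSupportedIn.structureMapLM ℝ ⊤ k)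
    (𝓝 (ContDiffMapSupportedIn.structureMapLM ℝ ⊤ k (toSupported K g))) by
      simp_rw [← nhds_induced]; exact nhds_iInf]
  rw [tendsto_iInf]
  intro k
  rw [tendsto_comap_iff, BoundedContinuousFunction.tendsto_iff_tendstoUniformly,
    Metric.tendstoUniformly_iff]
  intro ε hε
  have hn : (0 : ℝ) < (n : ℝ) ^ k + 1 := by positivity
  have hδ : 0 < ε / (2 * ((n : ℝ) ^ k + 1)) := by positivity
  have hall : ∀ᶠ i in l, ∀ s : Fin k → Fin n, ∀ y,
      dist (wordDeriv ((List.ofFn s).map stdVec) g y)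
        (wordDeriv ((List.ofFn s).map stdVec) (f i) y) < ε / (2 * ((n : ℝ) ^ k + 1)) :=
    eventually_all.2 fun s => Metric.tendstoUniformly_iff.1 (h (List.ofFn s)) _ hδ
  filter_upwards [hf, hall] with i hi hall y
  simp only [Function.comp_apply, ContDiffMapSupportedIn.structureMapLM_top_apply]
  rw [coe_toSupported hg h0, coe_toSupported hi.1 hi.2, dist_eq_norm]
  refine lt_of_le_of_lt (norm_multilinear_le_of_stdVec _ hδ.le fun s => ?_) ?_
  · have := (hall s y).le
    rw [dist_eq_norm, List.map_ofFn] at this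
    rw [sub_apply, iteratedFDeriv_apply_eq_wordDeriv hg.contDiffOn isOpen_univ _ (mem_univ y),
      iteratedFDeriv_apply_eq_wordDeriv hi.1.contDiffOn isOpen_univ _ (mem_univ y)]
    exact this
  · rw [mul_div_assoc', div_lt_iff₀ (by positivity)]
    nlinarith

/-! ### Test functions depending smoothly on a parameter -/

variable {V : Type*} [NormedAddCommGroup V] [NormedSpace ℝ V] {U : Set V}

/-- A smooth function on `U × ℝⁿ`, regarded as a family of test functions on `Ω` indexed by `U`
whose supports are locally contained in a fixed compact subset of `Ω`. -/
structure IsTestFamily (Ω : Opens (EuclideanSpace ℝ (Fin n))) (U : Set V)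
    (F : V × EuclideanSpace ℝ (Fin n) → 𝕜) : Prop where
  isOpen : IsOpen U
  smooth : ContDiffOn ℝ ∞ F (U ×ˢ univ)
  supp : ∀ p ∈ U, ∃ K : Compacts (EuclideanSpace ℝ (Fin n)),
    (K : Set (EuclideanSpace ℝ (Fin n))) ⊆ Ω ∧ ∀ᶠ q in 𝓝 p, ∀ y ∉ K, F (q, y) = 0

namespace IsTestFamily

variable {F : V × EuclideanSpace ℝ (Fin n) → 𝕜}

theorem isOpen_prod (hF : IsTestFamily Ω U F) :
    IsOpen (U ×ˢ (univ : Set (EuclideanSpace ℝ (Fin n)))) := hF.isOpen.prod isOpen_univ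

theorem eventually_wordDeriv_eq_zero {p : V}
    (h : ∀ᶠ q in 𝓝 p, ∀ y ∉ K, F (q, y) = 0) (l : List (V × EuclideanSpace ℝ (Fin n))) :
    ∀ᶠ q in 𝓝 p, ∀ y ∉ K, wordDeriv l F (q, y) = 0 := by
  obtain ⟨O, hO, hopen, hp⟩ := eventually_nhds_iff.1 h
  have hop : IsOpen (O ×ˢ (K : Set (EuclideanSpace ℝ (Fin n)))ᶜ) :=
    hopen.prod K.isCompact.isClosed.isOpen_compl
  have hz : EqOn F 0 (O ×ˢ (K : Set (EuclideanSpace ℝ (Fin n)))ᶜ) := fun q hq =>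
    hO q.1 hq.1 q.2 hq.2
  filter_upwards [hopen.mem_nhds hp] with q hq y hy
  have hm : (q, y) ∈ O ×ˢ (K : Set (EuclideanSpace ℝ (Fin n)))ᶜ := ⟨hq, hy⟩
  rw [wordDeriv_congr hop hz l hm, wordDeriv_zero]; rfl

theorem wordDeriv (hF : IsTestFamily Ω U F) (l : List (V × EuclideanSpace ℝ (Fin n))) :
    IsTestFamily Ω U (wordDeriv l F) where
  isOpen := hF.isOpen
  smooth := ContDiffOn.wordDeriv hF.smooth hF.isOpen_prod l
  supp p hp := (hF.supp p hp).imp fun _ hK => ⟨hK.1, eventually_wordDeriv_eq_zero hK.2 l⟩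

theorem contDiff_slice (hF : IsTestFamily Ω U F) {p : V} (hp : p ∈ U) :
    ContDiff ℝ ∞ fun y => F (p, y) := by
  rw [← contDiffOn_univ]
  exact hF.smooth.comp (by fun_prop) fun y _ => ⟨hp, mem_univ y⟩

theorem wordDeriv_slice (hF : IsTestFamily Ω U F) {p : V} (hp : p ∈ U)
    (l : List (EuclideanSpace ℝ (Fin n))) (y : EuclideanSpace ℝ (Fin n)) :
    Colombeau.wordDeriv l (fun y => F (p, y)) y =
      Colombeau.wordDeriv (l.map fun v => ((0 : V), v)) F (p, y) := by
  have := wordDeriv_comp_affine hF.smooth hF.isOpen_prod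
    (ContinuousLinearMap.inr ℝ V (EuclideanSpace ℝ (Fin n))) (p, 0) l (p := y) (by simpa using hp)
  have hA : ⇑(ContinuousLinearMap.inr ℝ V (EuclideanSpace ℝ (Fin n))) = fun v => ((0 : V), v) := rfl
  simpa [hA] using this

theorem coe_toTest (hF : IsTestFamily Ω U F) {p : V} (hp : p ∈ U) :
    ⇑(toTest Ω fun y => F (p, y)) = fun y => F (p, y) := by
  obtain ⟨K, hK, h⟩ := hF.supp p hp
  exact Colombeau.coe_toTest hK (hF.contDiff_slice hp) fun y hy => h.self_of_nhds y hy

/-- On the common compact support, uniformity follows from joint continuity and compactness; off it,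
all functions vanish. -/
theorem tendstoUniformly (hF : IsTestFamily Ω U F) {p : V} (hp : p ∈ U) :
    TendstoUniformly (fun q y => F (q, y)) (fun y => F (p, y)) (𝓝 p) := by
  obtain ⟨K, hK, h⟩ := hF.supp p hp
  intro u hu
  obtain ⟨v, hv, hvu⟩ := K.isCompact.mem_uniformity_of_prod (f := fun q y => F (q, y)) (s := U)
    (hF.smooth.continuousOn.mono (prod_mono subset_rfl (subset_univ _))) hp
    (UniformSpace.symm hu)
  rw [hF.isOpen.nhdsWithin_eq hp] at hv
  filter_upwards [hv, h] with q hq hq0 y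
  by_cases hy : y ∈ K
  · exact hvu q hq y hy
  · rw [hq0 y hy, h.self_of_nhds y hy]
    exact refl_mem_uniformity hu

theorem tendsto_toSupported (hF : IsTestFamily Ω U F) {p : V} (hp : p ∈ U)
    (h : ∀ᶠ q in 𝓝 p, ∀ y ∉ K, F (q, y) = 0) :
    Tendsto (fun q => toSupported K fun y => F (q, y)) (𝓝 p)
      (𝓝 (toSupported K fun y => F (p, y))) := by
  refine Colombeau.tendsto_toSupported ?_ (hF.contDiff_slice hp)
    (fun y hy => h.self_of_nhds y hy) fun w => ?_
  · filter_upwards [hF.isOpen.mem_nhds hp, h] with q hq hq0 using ⟨hF.contDiff_slice hq, hq0⟩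
  · refine tendstoUniformly_of_eq
      ((hF.wordDeriv ((w.map stdVec).map fun v => ((0 : V), v))).tendstoUniformly hp) ?_
      (funext fun y => (hF.wordDeriv_slice hp _ y).symm)
    filter_upwards [hF.isOpen.mem_nhds hp] with q hq
    exact funext fun y => (hF.wordDeriv_slice hq _ y).symm

/-- Near `p` the family takes values in one `𝓓_K`, whose inclusion into `𝓓(Ω)` is continuous. -/
theorem continuousAt_toTest (hF : IsTestFamily Ω U F) {p : V} (hp : p ∈ U) :
    ContinuousAt (fun q => toTest Ω fun y => F (q, y)) p := by
  obtain ⟨K, hK, h⟩ := hF.supp p hp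
  have h1 := ((TestFunction.continuous_ofSupportedIn hK).tendsto _).comp
    (hF.tendsto_toSupported hp h)
  rw [ContinuousAt, toTest_eq_ofSupportedIn hK (hF.contDiff_slice hp)
    fun y hy => h.self_of_nhds y hy]
  refine h1.congr' ?_
  filter_upwards [hF.isOpen.mem_nhds hp, h] with q hq hq0
  exact (toTest_eq_ofSupportedIn hK (hF.contDiff_slice hq) hq0).symm

theorem tendsto_add_smul (p v : V) : Tendsto (fun t : ℝ => p + t • v) (𝓝 0) (𝓝 p) := by
  have : Continuous fun t : ℝ => p + t • v := by fun_prop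
  simpa using this.tendsto 0

/-- Mean value inequality for `t ↦ F(p + t v, y) - t ∂_v F(p, y)`: its derivative is small for small
`t`, uniformly in `y`, because `∂_v F` is again a test family. -/
theorem tendstoUniformly_quotient (hF : IsTestFamily Ω U F) {p : V} (hp : p ∈ U) (v : V) :
    TendstoUniformly (fun (h : ℝ) y => h⁻¹ • (F (p + h • v, y) - F (p, y)))
      (fun y => Colombeau.wordDeriv [(v, 0)] F (p, y)) (𝓝[≠] 0) := by
  rw [Metric.tendstoUniformly_iff]
  intro ε hε
  have h1 := (tendsto_add_smul p v).eventually
    (Metric.tendstoUniformly_iff.1 ((hF.wordDeriv [(v, 0)]).tendstoUniformly hp) (ε / 2)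
      (half_pos hε))
  have h2 := (tendsto_add_smul p v).eventually (hF.isOpen.mem_nhds hp)
  obtain ⟨δ, hδ, hball⟩ := Metric.eventually_nhds_iff_ball.1 (h1.and h2)
  rw [eventually_nhdsWithin_iff]
  filter_upwards [Metric.ball_mem_nhds (0 : ℝ) hδ] with h hh hne y
  have hder : ∀ t ∈ Metric.ball (0 : ℝ) δ, HasDerivWithinAt
      (fun t : ℝ => F (p + t • v, y) - t • Colombeau.wordDeriv [(v, 0)] F (p, y))
      (Colombeau.wordDeriv [(v, 0)] F (p + t • v, y) -
        Colombeau.wordDeriv [(v, 0)] F (p, y)) (Metric.ball 0 δ) t := by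
    intro t ht
    have hd := (wordDeriv_differentiableAt hF.smooth hF.isOpen_prod []
      (p := (p + t • v, y)) ⟨(hball t ht).2, mem_univ _⟩).hasFDerivAt
    have hl : HasDerivAt (fun t : ℝ => (p + t • v, y)) (v, 0) t := by
      refine HasDerivAt.prodMk ?_ (hasDerivAt_const t y)
      simpa using ((hasDerivAt_id t).smul_const v).const_add p
    have h3 := (hd.comp_hasDerivAt t hl).sub
      ((hasDerivAt_id t).smul_const (Colombeau.wordDeriv [(v, 0)] F (p, y)))
    simp only [one_smul] at h3
    exact h3.hasDerivWithinAt
  have hb : ∀ t ∈ Metric.ball (0 : ℝ) δ, ‖Colombeau.wordDeriv [(v, 0)] F (p + t • v, y) -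
      Colombeau.wordDeriv [(v, 0)] F (p, y)‖ ≤ ε / 2 := fun t ht => by
    have := (hball t ht).1 y
    rw [dist_comm, dist_eq_norm] at this
    exact this.le
  have hm := (convex_ball (0 : ℝ) δ).norm_image_sub_le_of_norm_hasDerivWithin_le hder hb
    (Metric.mem_ball_self hδ) hh
  simp only [zero_smul, add_zero, sub_zero] at hm
  have hne' : (h : ℝ) ≠ 0 := hne
  rw [dist_comm, dist_eq_norm]
  have e : h⁻¹ • (F (p + h • v, y) - F (p, y)) - Colombeau.wordDeriv [(v, 0)] F (p, y) =
      h⁻¹ • (F (p + h • v, y) - h • Colombeau.wordDeriv [(v, 0)] F (p, y) - F (p, y)) := by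
    rw [sub_right_comm, smul_sub _ (_ - _), inv_smul_smul₀ hne']
  rw [e, norm_smul, norm_inv]
  have hpos : 0 < ‖h‖ := norm_pos_iff.2 hne'
  calc ‖h‖⁻¹ * _ ≤ ‖h‖⁻¹ * (ε / 2 * ‖h‖) := by gcongr
    _ = ε / 2 := by field_simp
    _ < ε := half_lt_self hε

/-- A derivative in `y` of a difference quotient is the difference quotient of that derivative, to
which the uniform limit applies; symmetry of mixed derivatives identifies the limit. -/
theorem tendsto_quotient (hF : IsTestFamily Ω U F) {p : V} (hp : p ∈ U) (v : V) :
    Tendsto (fun h : ℝ => h⁻¹ • ((toTest Ω fun y => F (p + h • v, y)) - toTest Ω fun y => F (p, y)))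
      (𝓝[≠] 0) (𝓝 (toTest Ω fun y => Colombeau.wordDeriv [(v, 0)] F (p, y))) := by
  obtain ⟨K, hK, h⟩ := hF.supp p hp
  have hw := hF.wordDeriv [(v, 0)]
  have hw0 := eventually_wordDeriv_eq_zero h [(v, 0)]
  have hnear : ∀ᶠ t : ℝ in 𝓝[≠] 0, p + t • v ∈ U ∧ ∀ y ∉ K, F (p + t • v, y) = 0 :=
    ((tendsto_add_smul p v).mono_left nhdsWithin_le_nhds).eventually
      ((show ∀ᶠ q in 𝓝 p, q ∈ U from hF.isOpen.mem_nhds hp).and h)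
  have hsm : ∀ t : ℝ, p + t • v ∈ U →
      ContDiff ℝ ∞ fun y => t⁻¹ • (F (p + t • v, y) - F (p, y)) := fun t ht =>
    ((hF.contDiff_slice ht).sub (hF.contDiff_slice hp)).const_smul t⁻¹
  have hz : ∀ t : ℝ, (∀ y ∉ K, F (p + t • v, y) = 0) →
      EqOn (fun y => t⁻¹ • (F (p + t • v, y) - F (p, y))) 0
        (K : Set (EuclideanSpace ℝ (Fin n)))ᶜ := fun t ht y hy => by
    simp [ht y hy, h.self_of_nhds y hy]
  have key : Tendsto (fun t : ℝ => toSupported K fun y => t⁻¹ • (F (p + t • v, y) - F (p, y)))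
      (𝓝[≠] 0) (𝓝 (toSupported K fun y => Colombeau.wordDeriv [(v, 0)] F (p, y))) := by
    refine Colombeau.tendsto_toSupported ?_ (hw.contDiff_slice hp)
      (fun y hy => hw0.self_of_nhds y hy) fun w => ?_
    · filter_upwards [hnear] with t ht using ⟨hsm t ht.1, hz t ht.2⟩
    · have hA := (hF.wordDeriv ((w.map stdVec).map fun v => ((0 : V), v))).tendstoUniformly_quotient
        hp v
      refine tendstoUniformly_of_eq hA ?_ (funext fun y => ?_)
      · filter_upwards [hnear] with t ht
        funext y
        rw [wordDeriv_const_smul ((hF.contDiff_slice ht.1).sub (hF.contDiff_slice hp)).contDiffOn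
          isOpen_univ t⁻¹ _ (mem_univ y)]
        beta_reduce
        rw [wordDeriv_sub (hF.contDiff_slice ht.1).contDiffOn (hF.contDiff_slice hp).contDiffOn
          isOpen_univ _ (mem_univ y)]
        beta_reduce
        rw [hF.wordDeriv_slice ht.1, hF.wordDeriv_slice hp]
      · rw [hw.wordDeriv_slice hp, ← wordDeriv_append, ← wordDeriv_append]
        exact wordDeriv_perm hF.smooth hF.isOpen_prod List.perm_append_comm ⟨hp, mem_univ y⟩
  rw [toTest_eq_ofSupportedIn hK (hw.contDiff_slice hp) fun y hy => hw0.self_of_nhds y hy]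
  refine (((TestFunction.continuous_ofSupportedIn hK).tendsto _).comp key).congr' ?_
  filter_upwards [hnear] with t ht
  ext y
  simp only [Function.comp_apply]
  rw [← toTest_eq_ofSupportedIn hK (hsm t ht.1) (hz t ht.2),
    Colombeau.coe_toTest hK (hsm t ht.1) (hz t ht.2), FunLike.coe_smul, FunLike.coe_sub,
    hF.coe_toTest ht.1, hF.coe_toTest hp]
  rfl

theorem smoothMapOn (hF : IsTestFamily Ω U F) {S : Set V} (hS : S ⊆ U) :
    SmoothMapOn (fun p => toTest Ω fun y => F (p, y)) S := by
  refine ⟨fun l p => toTest Ω fun y => Colombeau.wordDeriv (l.map fun v => (v, 0)) F (p, y),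
    fun _ _ => rfl, fun l p hp => ?_, fun l v p hp => ?_⟩
  · exact ((hF.wordDeriv _).continuousAt_toTest (hS hp)).continuousWithinAt
  · exact ((hF.wordDeriv (l.map fun v => (v, 0))).tendsto_quotient (hS hp) v).mono_left
      (nhdsWithin_mono _ fun h hh => hh.1)

end IsTestFamily

end TestFamilies

/-! ### Smoothness from continuous partial derivatives -/

section Partial

variable {ι V W : Type*} [NormedAddCommGroup V] [NormedSpace ℝ V]
  [NormedAddCommGroup W] [NormedSpace ℝ W]

theorem hasDerivAt_add_smul {f : V → W} {f' : W} {q v : V} {t : ℝ}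
    (h : HasLineDerivAt ℝ f f' (q + t • v) v) : HasDerivAt (fun s : ℝ => f (q + s • v)) f' t := by
  have h1 : HasDerivAt (fun s : ℝ => f (q + t • v + s • v)) f' (t - t) := by
    rw [sub_self]; exact h
  refine (h1.comp_sub_const t t).congr_of_eventuallyEq (Eventually.of_forall fun s => ?_)
  simp only [sub_smul]
  congr 1
  abel

/-- Move along one direction at a time and apply the mean value inequality to each move. The base
point `q` varies near `p` because each later move starts where the previous one ended. -/
theorem exists_norm_increment_le [DecidableEq ι] {b : ι → V} {f : V → W} {g : ι → V → W}
    {U : Set V} (hU : IsOpen U) (hg : ∀ i, ContinuousOn (g i) U)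
    (hf : ∀ i, ∀ q ∈ U, HasLineDerivAt ℝ f (g i q) q (b i)) {p : V} (hp : p ∈ U)
    {ε : ℝ} (hε : 0 < ε) (s : Finset ι) :
    ∃ δ > 0, ∀ q ∈ Metric.ball p δ, ∀ h : ι → ℝ, (∀ i, |h i| < δ) →
      ‖f (q + ∑ i ∈ s, h i • b i) - f q - ∑ i ∈ s, h i • g i p‖ ≤ ε * ∑ i ∈ s, |h i| := by
  induction s using Finset.induction_on with
  | empty => exact ⟨1, one_pos, fun q _ h _ => by simp⟩
  | insert a s ha ih =>
    obtain ⟨δ₁, hδ₁, h1⟩ := ih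
    have hc : ∀ᶠ q in 𝓝 p, q ∈ U ∧ dist (g a q) (g a p) < ε :=
      (show ∀ᶠ q in 𝓝 p, q ∈ U from hU.mem_nhds hp).and
        (Metric.tendsto_nhds.1 ((hg a).continuousAt (hU.mem_nhds hp)) ε hε)
    obtain ⟨δ₂, hδ₂, h2⟩ := Metric.eventually_nhds_iff_ball.1 hc
    have hb : 0 < 1 + ‖b a‖ := by positivity
    have hm : 0 < min δ₁ δ₂ := lt_min hδ₁ hδ₂
    -- With this radius a move by `t • b a`, `|t| < δ`, from a point of `ball p δ` stays in the ball
    -- of radius `min δ₁ δ₂`.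
    refine ⟨min δ₁ δ₂ / (1 + ‖b a‖), by positivity, fun q hq h hh => ?_⟩
    set δ := min δ₁ δ₂ / (1 + ‖b a‖) with hδ
    have hδm : δ * (1 + ‖b a‖) = min δ₁ δ₂ := by rw [hδ]; field_simp
    have hδpos : 0 < δ := by positivity
    have hδle : δ ≤ δ₁ := by
      have : δ * 1 ≤ δ * (1 + ‖b a‖) := by gcongr; simp
      linarith [min_le_left δ₁ δ₂]
    have hball : ∀ t : ℝ, |t| < δ → q + t • b a ∈ Metric.ball p (min δ₁ δ₂) := fun t ht => by
      rw [Metric.mem_ball, dist_eq_norm] at hq ⊢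
      calc ‖q + t • b a - p‖ = ‖(q - p) + t • b a‖ := by congr 1; abel
        _ ≤ ‖q - p‖ + |t| * ‖b a‖ := (norm_add_le _ _).trans_eq (by rw [norm_smul]; rfl)
        _ < δ + δ * ‖b a‖ := add_lt_add_of_lt_of_le hq (by gcongr)
        _ = min δ₁ δ₂ := by rw [← hδm]; ring
    have hder : ∀ t ∈ Metric.ball (0 : ℝ) δ, HasDerivWithinAt
        (fun t : ℝ => f (q + t • b a) - t • g a p) (g a (q + t • b a) - g a p)
        (Metric.ball 0 δ) t := fun t ht => by
      have ht' : |t| < δ := by simpa using ht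
      have hmem := (h2 _ (Metric.ball_subset_ball (min_le_right _ _) (hball t ht'))).1
      have h3 := (hasDerivAt_add_smul (hf a _ hmem)).sub ((hasDerivAt_id t).smul_const (g a p))
      simp only [one_smul] at h3
      exact h3.hasDerivWithinAt
    have hbd : ∀ t ∈ Metric.ball (0 : ℝ) δ, ‖g a (q + t • b a) - g a p‖ ≤ ε := fun t ht => by
      have ht' : |t| < δ := by simpa using ht
      have := (h2 _ (Metric.ball_subset_ball (min_le_right _ _) (hball t ht'))).2
      rw [dist_eq_norm] at this
      exact this.le
    have hmv := (convex_ball (0 : ℝ) δ).norm_image_sub_le_of_norm_hasDerivWithin_le hder hbd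
      (Metric.mem_ball_self hδpos) (show h a ∈ Metric.ball (0 : ℝ) δ by simpa using hh a)
    simp only [zero_smul, add_zero, sub_zero, Real.norm_eq_abs] at hmv
    have hs := h1 (q + h a • b a) (Metric.ball_subset_ball (min_le_left _ _) (hball _ (hh a))) h
      fun i => (hh i).trans_le hδle
    rw [Finset.sum_insert ha, Finset.sum_insert ha, Finset.sum_insert ha, ← add_assoc]
    have e : f (q + h a • b a + ∑ i ∈ s, h i • b i) - f q -
        (h a • g a p + ∑ i ∈ s, h i • g i p) =
        (f (q + h a • b a) - h a • g a p - f q) +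
        (f (q + h a • b a + ∑ i ∈ s, h i • b i) - f (q + h a • b a) -
          ∑ i ∈ s, h i • g i p) := by abel
    rw [e, mul_add]
    exact (norm_add_le _ _).trans (add_le_add hmv hs)

theorem hasFDerivAt_of_continuousOn_partial [Fintype ι] [FiniteDimensional ℝ V] (b : Module.Basis ι ℝ V)
    {f : V → W} {g : ι → V → W} {U : Set V} (hU : IsOpen U) (hg : ∀ i, ContinuousOn (g i) U)
    (hf : ∀ i, ∀ q ∈ U, HasLineDerivAt ℝ f (g i q) q (b i)) {p : V} (hp : p ∈ U) :
    HasFDerivAt f (∑ i, ((b.coord i).toContinuousLinearMap).smulRight (g i p)) p := by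
  classical
  rw [hasFDerivAt_iff_isLittleO_nhds_zero, Asymptotics.isLittleO_iff]
  intro ε hε
  set C : ℝ := 1 + ∑ i, ‖(b.coord i).toContinuousLinearMap‖ with hC
  have hCpos : 0 < C := by positivity
  obtain ⟨δ, hδ, h⟩ := exists_norm_increment_le hU hg hf hp (div_pos hε hCpos) Finset.univ
  have hle : ∀ v i, |b.repr v i| ≤ ‖(b.coord i).toContinuousLinearMap‖ * ‖v‖ := fun v i =>
    (b.coord i).toContinuousLinearMap.le_opNorm v
  have hev : ∀ᶠ v in 𝓝 (0 : V), ∀ i, |b.repr v i| < δ := by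
    refine eventually_all.2 fun i => ?_
    have : Continuous fun v => |b.repr v i| :=
      (b.coord i).toContinuousLinearMap.continuous.abs
    have h0 := this.tendsto 0
    simp only [map_zero, Finsupp.coe_zero, Pi.zero_apply, abs_zero] at h0
    exact h0.eventually_lt_const hδ
  filter_upwards [hev] with v hv
  have := h p (Metric.mem_ball_self hδ) (fun i => b.repr v i) hv
  rw [b.sum_repr] at this
  have e : (∑ i, ((b.coord i).toContinuousLinearMap).smulRight (g i p)) v =
      ∑ i, b.repr v i • g i p := by simp
  rw [e]
  refine this.trans ?_
  have hsum : ∑ i, |b.repr v i| ≤ C * ‖v‖ := by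
    calc ∑ i, |b.repr v i| ≤ ∑ i, ‖(b.coord i).toContinuousLinearMap‖ * ‖v‖ :=
          Finset.sum_le_sum fun i _ => hle v i
      _ ≤ C * ‖v‖ := by rw [← Finset.sum_mul]; gcongr; simp [hC]
  calc ε / C * ∑ i, |b.repr v i| ≤ ε / C * (C * ‖v‖) := by gcongr
    _ = ε * ‖v‖ := by field_simp

/-- A family of continuous functions which is closed under partial derivatives consists of
smooth functions. -/
theorem contDiffOn_of_partial [Fintype ι] [FiniteDimensional ℝ V] (b : Module.Basis ι ℝ V)
    {g : List ι → V → W} {U : Set V} (hU : IsOpen U) (hg : ∀ l, ContinuousOn (g l) U)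
    (hf : ∀ i l, ∀ q ∈ U, HasLineDerivAt ℝ (g l) (g (i :: l) q) q (b i)) (l : List ι) :
    ContDiffOn ℝ ∞ (g l) U := by
  have hd : ∀ l, ∀ p ∈ U, HasFDerivAt (g l)
      (∑ i, ((b.coord i).toContinuousLinearMap).smulRight (g (i :: l) p)) p := fun l p hp =>
    hasFDerivAt_of_continuousOn_partial b hU (fun i => hg (i :: l)) (fun i => hf i l) hp
  rw [contDiffOn_infty]
  intro k
  induction k generalizing l with
  | zero => exact contDiffOn_zero.2 (hg l)
  | succ k ih =>
    rw [Nat.cast_succ, contDiffOn_succ_iff_fderiv_of_isOpen hU]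
    refine ⟨fun p hp => (hd l p hp).differentiableAt.differentiableWithinAt,
      fun h => absurd h (by simp), ?_⟩
    refine ContDiffOn.congr ?_ fun p hp => (hd l p hp).fderiv
    refine ContDiffOn.sum fun i _ => ?_
    exact contDiffOn_const.smulRight (ih (i :: l))

theorem wordDeriv_of_partial [Fintype ι] [FiniteDimensional ℝ V] (b : Module.Basis ι ℝ V)
    {g : List ι → V → W} {U : Set V} (hU : IsOpen U) (hg : ∀ l, ContinuousOn (g l) U)
    (hf : ∀ i l, ∀ q ∈ U, HasLineDerivAt ℝ (g l) (g (i :: l) q) q (b i)) (w l : List ι) :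
    EqOn (wordDeriv (w.map b) (g l)) (g (w ++ l)) U := by
  induction w with
  | nil => exact fun _ _ => rfl
  | cons i w ih =>
    intro p hp
    rw [List.map_cons, wordDeriv_cons]
    beta_reduce
    rw [(ih.eventuallyEq_of_mem (hU.mem_nhds hp)).fderiv_eq, List.cons_append, ← (hf i (w ++ l) p hp).lineDeriv]
    exact (((contDiffOn_of_partial b hU hg hf (w ++ l)).contDiffAt
      (hU.mem_nhds hp)).differentiableAt (by simp)).lineDeriv_eq_fderiv.symm

end Partial

/-! ### Multi-indices and words -/

section MultiWord

variable {n : ℕ}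

/-- The word in which the letter `i` occurs `α i` times, in increasing order. -/
def multiWord (α : Fin n → ℕ) : List (Fin n) :=
  (List.finRange n).flatMap fun i => List.replicate (α i) i

theorem multiPow_eqOn {X V W : Type*} (D : Fin n → X → X) (T : X → V → W)
    (G : List (Fin n) → V → W) {U : Set V}
    (h : ∀ i l g, EqOn (T g) (G l) U → EqOn (T (D i g)) (G (i :: l)) U) (α : Fin n → ℕ)
    {l : List (Fin n)} {g : X} (hg : EqOn (T g) (G l) U) :
    EqOn (T (multiPow D α g)) (G (multiWord α ++ l)) U := by
  unfold multiPow multiWord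
  induction List.finRange n with
  | nil => exact hg
  | cons i L ih =>
    have hit : ∀ k : ℕ, EqOn (T ((D i)^[k] (L.foldr (fun i h => (D i)^[α i] h) g)))
        (G (List.replicate k i ++ (L.flatMap (fun i => List.replicate (α i) i) ++ l))) U := by
      intro k
      induction k with
      | zero => exact ih
      | succ k ihk =>
        rw [Function.iterate_succ_apply']
        exact h i _ _ ihk
    simpa [List.append_assoc] using hit (α i)

/-- Together with `wordDeriv_perm` this reduces arbitrary words to multi-indices, the form in which
the growth condition is given. -/
theorem perm_multiWord (l : List (Fin n)) : l.Perm (multiWord fun i => l.count i) := by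
  rw [List.perm_iff_count]
  intro a
  rw [multiWord, List.count_flatMap, List.sum_map_eq_nsmul_single a]
  · simp [List.count_eq_one_of_mem (List.nodup_finRange n) (List.mem_finRange a)]
  · intro b hb _
    simp [List.count_replicate, hb]

theorem length_multiWord (α : Fin n → ℕ) : (multiWord α).length = mdeg α := by
  simp [multiWord, mdeg, List.length_flatMap, ← List.sum_ofFn, List.ofFn_eq_map]

end MultiWord

/-! ### Smooth maps from `Ω` to the space of test functions -/

section DerivFamily

variable {n : ℕ} {𝕜 : Type*} [RCLike 𝕜] {Ω : Opens (EuclideanSpace ℝ (Fin n))}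

/-- Evaluation at `y` as a continuous linear functional on test functions. -/
def evalCLM (Ω : Opens (EuclideanSpace ℝ (Fin n))) (𝕜 : Type*) [RCLike 𝕜]
    (y : EuclideanSpace ℝ (Fin n)) : 𝓓(Ω, 𝕜) →L[ℝ] 𝕜 where
  toFun ψ := ψ y
  map_add' _ _ := rfl
  map_smul' _ _ := rfl
  cont := continuous_eval_const y

/-- Iterated directional differentiation of test functions. -/
def testWord (m : List (EuclideanSpace ℝ (Fin n))) : 𝓓(Ω, 𝕜) →L[ℝ] 𝓓(Ω, 𝕜) :=
  m.foldr (fun v T => (TestFunction.lineDerivCLM ℝ v).comp T) (ContinuousLinearMap.id ℝ _)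

theorem coe_testWord (m : List (EuclideanSpace ℝ (Fin n))) (ψ : 𝓓(Ω, 𝕜)) :
    ⇑(testWord m ψ) = wordDeriv m ⇑ψ := by
  induction m with
  | nil => rfl
  | cons v m ih =>
    funext y
    change (TestFunction.lineDerivCLM ℝ v (testWord m ψ) : 𝓓(Ω, 𝕜)) y = _
    rw [TestFunction.lineDerivCLM_apply_of_le (by simp),
      ((testWord m ψ).contDiff.differentiable (by simp) y).lineDeriv_eq_fderiv, ih]
    rfl

/-- The family `D` consists of iterated directional derivatives of the map `D []` from `Ω` to the
space of test functions. -/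
structure IsDerivFamily (D : List (EuclideanSpace ℝ (Fin n)) → EuclideanSpace ℝ (Fin n) → 𝓓(Ω, 𝕜)) :
    Prop where
  continuousOn : ∀ l, ContinuousOn (D l) Ω
  tendsto : ∀ l v, ∀ x ∈ Ω, Tendsto (fun t : ℝ => t⁻¹ • (D l (x + t • v) - D l x)) (𝓝[≠] 0)
    (𝓝 (D (v :: l) x))

theorem eventually_add_smul_mem {x : EuclideanSpace ℝ (Fin n)} (hx : x ∈ Ω)
    (v : EuclideanSpace ℝ (Fin n)) : ∀ᶠ t : ℝ in 𝓝 0, x + t • v ∈ Ω :=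
  (IsTestFamily.tendsto_add_smul x v).eventually (Ω.isOpen.mem_nhds hx)

theorem SmoothMapOn.exists_isDerivFamily {φ : ℝ → EuclideanSpace ℝ (Fin n) → 𝓓(Ω, 𝕜)}
    (h : SmoothMapOn (fun p : ℝ × EuclideanSpace ℝ (Fin n) => φ p.1 p.2)
      (Ioc (0 : ℝ) 1 ×ˢ (Ω : Set (EuclideanSpace ℝ (Fin n))))) {ε : ℝ} (hε : ε ∈ Ioc (0 : ℝ) 1) :
    ∃ D : List (EuclideanSpace ℝ (Fin n)) → EuclideanSpace ℝ (Fin n) → 𝓓(Ω, 𝕜),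
      IsDerivFamily D ∧ EqOn (D []) (φ ε) Ω := by
  obtain ⟨d, hd0, hdc, hdt⟩ := h
  refine ⟨fun l x => d (l.map fun v => ((0 : ℝ), v)) (ε, x), ⟨fun l => ?_, fun l v x hx => ?_⟩,
    fun x hx => hd0 ⟨hε, hx⟩⟩
  · exact (hdc _).comp (by fun_prop) fun x hx => ⟨hε, hx⟩
  · have := hdt (l.map fun v => ((0 : ℝ), v)) (0, v) (ε, x) ⟨hε, hx⟩
    simp only [Prod.smul_mk, smul_zero, Prod.mk_add_mk, add_zero] at this
    -- `ε` is fixed and `Ω` is open, so all small `t ≠ 0` are admissible increments; the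
    -- one-sidedness at `ε = 1` plays no role.
    refine this.mono_left ?_
    rw [nhdsWithin, nhdsWithin]
    refine le_inf inf_le_left (le_principal_iff.2 ?_)
    have h1 : ∀ᶠ t : ℝ in 𝓝[≠] 0, t ≠ 0 ∧ (ε, x + t • v) ∈
        Ioc (0 : ℝ) 1 ×ˢ (Ω : Set (EuclideanSpace ℝ (Fin n))) := by
      filter_upwards [self_mem_nhdsWithin,
        (eventually_add_smul_mem hx v).filter_mono nhdsWithin_le_nhds] with t h0 h1
      exact ⟨h0, hε, h1⟩
    exact h1

/-- The directions of the partial derivatives on `ℝⁿ × ℝⁿ`. -/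
def prodBasis (n : ℕ) : Module.Basis (Fin n ⊕ Fin n) ℝ
    (EuclideanSpace ℝ (Fin n) × EuclideanSpace ℝ (Fin n)) :=
  (EuclideanSpace.basisFun (Fin n) ℝ).toBasis.prod (EuclideanSpace.basisFun (Fin n) ℝ).toBasis

@[simp] theorem prodBasis_inl (i : Fin n) : prodBasis n (Sum.inl i) = (stdVec i, 0) := by
  ext : 1 <;> simp [prodBasis]

@[simp] theorem prodBasis_inr (i : Fin n) : prodBasis n (Sum.inr i) = (0, stdVec i) := by
  ext : 1 <;> simp [prodBasis]

namespace IsDerivFamily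

variable {D : List (EuclideanSpace ℝ (Fin n)) → EuclideanSpace ℝ (Fin n) → 𝓓(Ω, 𝕜)}

theorem hasLineDerivAt (hD : IsDerivFamily D) (T : 𝓓(Ω, 𝕜) →L[ℝ] 𝕜)
    (l : List (EuclideanSpace ℝ (Fin n))) (v : EuclideanSpace ℝ (Fin n))
    {x : EuclideanSpace ℝ (Fin n)} (hx : x ∈ Ω) :
    HasLineDerivAt ℝ (fun x => T (D l x)) (T (D (v :: l) x)) x v := by
  rw [HasLineDerivAt, hasDerivAt_iff_tendsto_slope_zero]
  refine ((T.continuous.tendsto _).comp (hD.tendsto l v x hx)).congr fun t => ?_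
  simp only [Function.comp_apply, map_smul, map_sub, zero_add, zero_smul, add_zero]

/-- Derivatives in `x` do not enlarge the support in `y`, provided the support is controlled on a
whole neighbourhood of `x`. -/
theorem apply_eq_zero (hD : IsDerivFamily D) {O : Set (EuclideanSpace ℝ (Fin n))} (hO : IsOpen O)
    (hOΩ : O ⊆ Ω) {y : EuclideanSpace ℝ (Fin n)} (h : ∀ x ∈ O, D [] x y = 0)
    (l : List (EuclideanSpace ℝ (Fin n))) : ∀ x ∈ O, D l x y = 0 := by
  induction l with
  | nil => exact h
  | cons v l ih =>
    intro x hx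
    have h1 := hD.hasLineDerivAt (evalCLM Ω 𝕜 y) l v (hOΩ hx)
    have h2 : (fun t : ℝ => evalCLM Ω 𝕜 y (D l (x + t • v))) =ᶠ[𝓝 0] fun _ => 0 := by
      filter_upwards [(IsTestFamily.tendsto_add_smul x v).eventually (hO.mem_nhds hx)] with t ht
      exact ih _ ht
    exact HasDerivAt.unique h1 ((hasDerivAt_const (0 : ℝ) (0 : 𝕜)).congr_of_eventuallyEq h2)

/-- The mixed partial derivatives of the function `(x, y) ↦ D [] x y`. -/
def mixed (D : List (EuclideanSpace ℝ (Fin n)) → EuclideanSpace ℝ (Fin n) → 𝓓(Ω, 𝕜))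
    (w : List (Fin n ⊕ Fin n)) (p : EuclideanSpace ℝ (Fin n) × EuclideanSpace ℝ (Fin n)) : 𝕜 :=
  testWord (w.filterMap (Sum.elim (fun _ => none) fun j => some (stdVec j)))
    (D (w.filterMap (Sum.elim (fun i => some (stdVec i)) fun _ => none)) p.1) p.2

theorem continuousOn_mixed (hD : IsDerivFamily D) (w : List (Fin n ⊕ Fin n)) :
    ContinuousOn (mixed D w)
      ((Ω : Set (EuclideanSpace ℝ (Fin n))) ×ˢ (univ : Set (EuclideanSpace ℝ (Fin n)))) := by
  have h1 : ContinuousOn (fun p : EuclideanSpace ℝ (Fin n) × EuclideanSpace ℝ (Fin n) =>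
      (testWord (w.filterMap (Sum.elim (fun _ => none) fun j => some (stdVec j)))
        (D (w.filterMap (Sum.elim (fun i => some (stdVec i)) fun _ => none)) p.1), p.2))
      ((Ω : Set (EuclideanSpace ℝ (Fin n))) ×ˢ (univ : Set (EuclideanSpace ℝ (Fin n)))) :=
    ((ContinuousLinearMap.continuous _).comp_continuousOn
      ((hD.continuousOn _).comp continuousOn_fst fun p hp => hp.1)).prodMk continuousOn_snd
  -- Evaluation `(ψ, y) ↦ ψ y` is jointly continuous on `𝓓(Ω) × ℝⁿ`.
  exact (ContinuousEval.continuous_eval (F := 𝓓(Ω, 𝕜))).comp_continuousOn h1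

theorem hasLineDerivAt_mixed (hD : IsDerivFamily D) (i : Fin n ⊕ Fin n)
    (w : List (Fin n ⊕ Fin n)) {p : EuclideanSpace ℝ (Fin n) × EuclideanSpace ℝ (Fin n)}
    (hp : p.1 ∈ Ω) :
    HasLineDerivAt ℝ (mixed D w) (mixed D (i :: w) p) p (prodBasis n i) := by
  cases i with
  | inl i =>
    have := hD.hasLineDerivAt ((evalCLM Ω 𝕜 p.2).comp
      (testWord (w.filterMap (Sum.elim (fun _ => none) fun j => some (stdVec j)))))
      (w.filterMap (Sum.elim (fun i => some (stdVec i)) fun _ => none)) (stdVec i) hp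
    rw [HasLineDerivAt] at this ⊢
    simp only [prodBasis_inl, mixed, Prod.fst_add, Prod.snd_add, Prod.smul_mk, smul_zero, add_zero]
    exact this
  | inr j =>
    have h1 : ∀ ψ : 𝓓(Ω, 𝕜), HasLineDerivAt ℝ ψ
        ((TestFunction.lineDerivCLM ℝ (stdVec j) ψ : 𝓓(Ω, 𝕜)) p.2) p.2 (stdVec j) := fun ψ => by
      rw [TestFunction.lineDerivCLM_apply_of_le (by simp)]
      exact (ψ.contDiff.differentiable (by simp) p.2).lineDifferentiableAt.hasLineDerivAt
    have := h1 (testWord (w.filterMap (Sum.elim (fun _ => none) fun j => some (stdVec j)))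
      (D (w.filterMap (Sum.elim (fun i => some (stdVec i)) fun _ => none)) p.1))
    rw [HasLineDerivAt] at this ⊢
    simp only [prodBasis_inr, mixed, Prod.fst_add, Prod.snd_add, Prod.smul_mk, smul_zero, add_zero]
    exact this

theorem isOpen_prod_univ (Ω : Opens (EuclideanSpace ℝ (Fin n))) :
    IsOpen ((Ω : Set (EuclideanSpace ℝ (Fin n))) ×ˢ (univ : Set (EuclideanSpace ℝ (Fin n)))) :=
  Ω.isOpen.prod isOpen_univ

/-- The mixed partials are jointly continuous and closed under further partial derivatives; hence a
smooth map into `𝓓(Ω)` is a jointly smooth function of `(x, y)`. -/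
theorem contDiffOn (hD : IsDerivFamily D) :
    ContDiffOn ℝ ∞ (fun p : EuclideanSpace ℝ (Fin n) × EuclideanSpace ℝ (Fin n) => D [] p.1 p.2)
      ((Ω : Set (EuclideanSpace ℝ (Fin n))) ×ˢ (univ : Set (EuclideanSpace ℝ (Fin n)))) :=
  contDiffOn_of_partial (g := mixed D) (prodBasis n) (isOpen_prod_univ Ω) hD.continuousOn_mixed
    (fun i l _ hq => hD.hasLineDerivAt_mixed i l hq.1) []

theorem wordDeriv_eq (hD : IsDerivFamily D) (m l : List (Fin n)) {x : EuclideanSpace ℝ (Fin n)}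
    (hx : x ∈ Ω) (y : EuclideanSpace ℝ (Fin n)) :
    wordDeriv ((m.map Sum.inr ++ l.map Sum.inl).map (prodBasis n))
      (fun p : EuclideanSpace ℝ (Fin n) × EuclideanSpace ℝ (Fin n) => D [] p.1 p.2) (x, y) =
    wordDeriv (m.map stdVec) (D (l.map stdVec) x) y := by
  have h := wordDeriv_of_partial (g := mixed D) (prodBasis n) (isOpen_prod_univ Ω)
    hD.continuousOn_mixed (fun i l _ hq => hD.hasLineDerivAt_mixed i l hq.1)
    (m.map Sum.inr ++ l.map Sum.inl) [] (x := (x, y)) ⟨hx, mem_univ y⟩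
  refine h.trans ?_
  rw [← coe_testWord]
  simp [mixed, List.filterMap_append, List.filterMap_map, Function.comp_def,
    List.filterMap_eq_map']

end IsDerivFamily

end DerivFamily

/-! ### Multi-index derivatives as word derivatives -/

section MultiPow

variable {n : ℕ} {𝕜 : Type*} [RCLike 𝕜] {Ω : Opens (EuclideanSpace ℝ (Fin n))}

theorem zeroExt_apply (g : Ω → 𝕜) {x : EuclideanSpace ℝ (Fin n)} (hx : x ∈ Ω) :
    zeroExt Ω g x = g ⟨x, hx⟩ :=
  Subtype.val_injective.extend_apply g 0 ⟨x, hx⟩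

theorem pderiv_eqOn {g G G' : EuclideanSpace ℝ (Fin n) → 𝕜} {i : Fin n}
    (hg : EqOn g G Ω) (hG : ∀ x ∈ Ω, HasLineDerivAt ℝ G (G' x) x (stdVec i)) :
    EqOn (pderiv i g) G' Ω := fun x hx => by
  rw [pderiv, (hg.eventuallyEq_of_mem (Ω.isOpen.mem_nhds hx)).lineDeriv_eq]
  exact (hG x hx).lineDeriv

theorem hasLineDerivAt_wordDeriv {V : Type*} [NormedAddCommGroup V] [NormedSpace ℝ V] {U : Set V}
    {F : V → 𝕜} (hF : ContDiffOn ℝ ∞ F U) (hU : IsOpen U) (v : V) (l : List V) {p : V}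
    (hp : p ∈ U) : HasLineDerivAt ℝ (wordDeriv l F) (wordDeriv (v :: l) F p) p v :=
  (wordDeriv_differentiableAt hF hU l hp).hasFDerivAt.hasLineDerivAt v

theorem multiPow_pderiv_eqOn {g F : EuclideanSpace ℝ (Fin n) → 𝕜} (hF : ContDiffOn ℝ ∞ F Ω)
    (hg : EqOn g F Ω) (α : Fin n → ℕ) :
    EqOn (multiPow pderiv α g) (wordDeriv ((multiWord α).map stdVec) F) Ω := by
  simpa using multiPow_eqOn pderiv id (fun l => wordDeriv (l.map stdVec) F)
    (fun i l g hg => pderiv_eqOn hg fun x hx => hasLineDerivAt_wordDeriv hF Ω.isOpen _ _ hx)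
    α (l := []) hg

/-- A continuous linear `u` carries the difference quotients converging in `𝓓(Ω)` to converging
scalar ones. The term `F` is included so that `ι f - σ f` is covered directly. -/
theorem multiPow_pderiv_eqOn_sub {D : List (EuclideanSpace ℝ (Fin n)) →
      EuclideanSpace ℝ (Fin n) → 𝓓(Ω, 𝕜)} (hD : IsDerivFamily D) (u : 𝓓(Ω, 𝕜) →L[𝕜] 𝕜)
    {g F : EuclideanSpace ℝ (Fin n) → 𝕜} (hF : ContDiffOn ℝ ∞ F Ω)
    (hg : EqOn g (fun x => u (D [] x) - F x) Ω) (α : Fin n → ℕ) :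
    EqOn (multiPow pderiv α g) (fun x => u (D ((multiWord α).map stdVec) x) -
      wordDeriv ((multiWord α).map stdVec) F x) Ω := by
  simpa using multiPow_eqOn pderiv id
    (fun l x => u (D (l.map stdVec) x) - wordDeriv (l.map stdVec) F x)
    (fun i l g hg => pderiv_eqOn hg fun x hx =>
      (hD.hasLineDerivAt (u.restrictScalars ℝ) (l.map stdVec) (stdVec i) hx).sub
        (hasLineDerivAt_wordDeriv hF Ω.isOpen (stdVec i) (l.map stdVec) hx)) α (l := []) hg

theorem multiPow_pderiv_eqOn_apply {D : List (EuclideanSpace ℝ (Fin n)) →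
      EuclideanSpace ℝ (Fin n) → 𝓓(Ω, 𝕜)} (hD : IsDerivFamily D) (u : 𝓓(Ω, 𝕜) →L[𝕜] 𝕜)
    {g : EuclideanSpace ℝ (Fin n) → 𝕜} (hg : EqOn g (fun x => u (D [] x)) Ω) (α : Fin n → ℕ) :
    EqOn (multiPow pderiv α g) (fun x => u (D ((multiWord α).map stdVec) x)) Ω := by
  have h0 : EqOn g (fun x => u (D [] x) - (0 : EuclideanSpace ℝ (Fin n) → 𝕜) x) Ω := by
    simpa using hg
  simpa [wordDeriv_zero] using multiPow_pderiv_eqOn_sub hD u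
    (show ContDiffOn ℝ ∞ (0 : EuclideanSpace ℝ (Fin n) → 𝕜) Ω from contDiffOn_const) h0 α

variable {Φ : EuclideanSpace ℝ (Fin n) → EuclideanSpace ℝ (Fin n) → 𝕜}
  {F : EuclideanSpace ℝ (Fin n) × EuclideanSpace ℝ (Fin n) → 𝕜}

theorem multiPow_pderivX_eqOn {l : List (EuclideanSpace ℝ (Fin n) × EuclideanSpace ℝ (Fin n))}
    (hF : ContDiffOn ℝ ∞ F ((Ω : Set (EuclideanSpace ℝ (Fin n))) ×ˢ univ))
    (hΦ : EqOn (fun p => Φ p.1 p.2) (wordDeriv l F)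
      ((Ω : Set (EuclideanSpace ℝ (Fin n))) ×ˢ univ)) (α : Fin n → ℕ) :
    EqOn (fun p => multiPow pderivX α Φ p.1 p.2)
      (wordDeriv ((multiWord α).map (fun i => (stdVec i, 0)) ++ l) F)
      ((Ω : Set (EuclideanSpace ℝ (Fin n))) ×ˢ univ) := by
  have hU := IsDerivFamily.isOpen_prod_univ Ω
  have := multiPow_eqOn pderivX (fun g p => g p.1 p.2)
    (fun k => wordDeriv (k.map (fun i => ((stdVec i, 0) : EuclideanSpace ℝ (Fin n) ×
      EuclideanSpace ℝ (Fin n))) ++ l) F) (U := (Ω : Set (EuclideanSpace ℝ (Fin n))) ×ˢ univ)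
    (fun i k g hg p hp => ?_) α (l := []) hΦ
  · simpa using this
  · have h1 := hasLineDerivAt_wordDeriv hF hU (stdVec i, 0) (k.map (fun i => ((stdVec i, 0) :
      EuclideanSpace ℝ (Fin n) × EuclideanSpace ℝ (Fin n))) ++ l) hp
    rw [List.map_cons, List.cons_append,
      ← (h1.congr_of_eventuallyEq (hg.eventuallyEq_of_mem (hU.mem_nhds hp))).lineDeriv]
    simp [pderivX, pderiv, lineDeriv]

theorem multiPow_pderivY_eqOn {l : List (EuclideanSpace ℝ (Fin n) × EuclideanSpace ℝ (Fin n))}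
    (hF : ContDiffOn ℝ ∞ F ((Ω : Set (EuclideanSpace ℝ (Fin n))) ×ˢ univ))
    (hΦ : EqOn (fun p => Φ p.1 p.2) (wordDeriv l F)
      ((Ω : Set (EuclideanSpace ℝ (Fin n))) ×ˢ univ)) (α : Fin n → ℕ) :
    EqOn (fun p => multiPow pderivY α Φ p.1 p.2)
      (wordDeriv ((multiWord α).map (fun i => (0, stdVec i)) ++ l) F)
      ((Ω : Set (EuclideanSpace ℝ (Fin n))) ×ˢ univ) := by
  have hU := IsDerivFamily.isOpen_prod_univ Ω
  have := multiPow_eqOn pderivY (fun g p => g p.1 p.2)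
    (fun k => wordDeriv (k.map (fun i => ((0, stdVec i) : EuclideanSpace ℝ (Fin n) ×
      EuclideanSpace ℝ (Fin n))) ++ l) F) (U := (Ω : Set (EuclideanSpace ℝ (Fin n))) ×ˢ univ)
    (fun i k g hg p hp => ?_) α (l := []) hΦ
  · simpa using this
  · have h1 := hasLineDerivAt_wordDeriv hF hU (0, stdVec i) (k.map (fun i => ((0, stdVec i) :
      EuclideanSpace ℝ (Fin n) × EuclideanSpace ℝ (Fin n))) ++ l) hp
    rw [List.map_cons, List.cons_append,
      ← (h1.congr_of_eventuallyEq (hg.eventuallyEq_of_mem (hU.mem_nhds hp))).lineDeriv]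
    simp [pderivY, pderiv, lineDeriv]

theorem multiPow_pderivXY_eqOn {l : List (EuclideanSpace ℝ (Fin n) × EuclideanSpace ℝ (Fin n))}
    (hF : ContDiffOn ℝ ∞ F ((Ω : Set (EuclideanSpace ℝ (Fin n))) ×ˢ univ))
    (hΦ : EqOn (fun p => Φ p.1 p.2) (wordDeriv l F)
      ((Ω : Set (EuclideanSpace ℝ (Fin n))) ×ˢ univ)) (α : Fin n → ℕ) :
    EqOn (fun p => multiPow pderivXY α Φ p.1 p.2)
      (wordDeriv ((multiWord α).map (fun i => (stdVec i, stdVec i)) ++ l) F)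
      ((Ω : Set (EuclideanSpace ℝ (Fin n))) ×ˢ univ) := by
  have hU := IsDerivFamily.isOpen_prod_univ Ω
  have := multiPow_eqOn pderivXY (fun g p => g p.1 p.2)
    (fun k => wordDeriv (k.map (fun i => ((stdVec i, stdVec i) : EuclideanSpace ℝ (Fin n) ×
      EuclideanSpace ℝ (Fin n))) ++ l) F) (U := (Ω : Set (EuclideanSpace ℝ (Fin n))) ×ˢ univ)
    (fun i k g hg p hp => ?_) α (l := []) hΦ
  · simpa using this
  · set w := k.map (fun i => ((stdVec i, stdVec i) :
      EuclideanSpace ℝ (Fin n) × EuclideanSpace ℝ (Fin n))) ++ l with hw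
    have hev := hg.eventuallyEq_of_mem (hU.mem_nhds hp)
    have h1 := (hasLineDerivAt_wordDeriv hF hU (stdVec i, 0) w hp).congr_of_eventuallyEq hev
    have h2 := (hasLineDerivAt_wordDeriv hF hU (0, stdVec i) w hp).congr_of_eventuallyEq hev
    have e : wordDeriv ((stdVec i, stdVec i) :: w) F p =
        wordDeriv ((stdVec i, 0) :: w) F p + wordDeriv ((0, stdVec i) :: w) F p := by
      simp only [wordDeriv_cons]
      rw [← map_add]
      simp
    rw [List.map_cons, List.cons_append, ← hw, e, ← h1.lineDeriv, ← h2.lineDeriv]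
    simp [pderivXY, pderivX, pderivY, pderiv, lineDeriv]

end MultiPow

/-! ### Moderate growth of all derivatives of a smoothing kernel -/

section Growth

variable {n : ℕ} {𝕜 : Type*} [RCLike 𝕜] {Ω : Opens (EuclideanSpace ℝ (Fin n))}

/-- `f_ε = O(ε^{-a})` uniformly on `S`. -/
def IsBigOInv {X : Type*} (S : Set X) (a : ℕ) (f : ℝ → X → 𝕜) : Prop :=
  ∃ ε₀ > 0, ∃ C > 0, ∀ ε ∈ Ioc (0 : ℝ) 1, ε ≤ ε₀ → ∀ x ∈ S, ‖f ε x‖ ≤ C * (ε ^ a)⁻¹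

namespace IsBigOInv

variable {X : Type*} {S : Set X} {a b : ℕ} {f g : ℝ → X → 𝕜}

theorem congr (hf : IsBigOInv S a f) (h : ∀ ε ∈ Ioc (0 : ℝ) 1, EqOn (f ε) (g ε) S) :
    IsBigOInv S a g := by
  obtain ⟨ε₀, hε₀, C, hC, H⟩ := hf
  exact ⟨ε₀, hε₀, C, hC, fun ε hε hle x hx => h ε hε hx ▸ H ε hε hle x hx⟩

theorem mono (hf : IsBigOInv S a f) (hab : a ≤ b) : IsBigOInv S b f := by
  obtain ⟨ε₀, hε₀, C, hC, H⟩ := hf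
  refine ⟨ε₀, hε₀, C, hC, fun ε hε hle x hx => (H ε hε hle x hx).trans ?_⟩
  have : 0 < ε := hε.1
  gcongr ?_ * ?_
  exact inv_anti₀ (by positivity) (pow_le_pow_of_le_one hε.1.le hε.2 hab)

theorem sub (hf : IsBigOInv S a f) (hg : IsBigOInv S a g) :
    IsBigOInv S a fun ε x => f ε x - g ε x := by
  obtain ⟨ε₀, hε₀, C, hC, H⟩ := hf
  obtain ⟨ε₁, hε₁, C', hC', H'⟩ := hg
  refine ⟨min ε₀ ε₁, lt_min hε₀ hε₁, C + C', by positivity, fun ε hε hle x hx => ?_⟩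
  rw [add_mul]
  exact (norm_sub_le _ _).trans (add_le_add (H ε hε (hle.trans (min_le_left _ _)) x hx)
    (H' ε hε (hle.trans (min_le_right _ _)) x hx))

theorem exists_uniform {ι : Type*} {s : Set ι} (hs : s.Finite) {f : ι → ℝ → X → 𝕜}
    (h : ∀ i ∈ s, IsBigOInv S a (f i)) :
    ∃ ε₀ > 0, ∃ C > 0, ∀ ε ∈ Ioc (0 : ℝ) 1, ε ≤ ε₀ → ∀ i ∈ s, ∀ x ∈ S,
      ‖f i ε x‖ ≤ C * (ε ^ a)⁻¹ := by
  induction s, hs using Set.Finite.induction_on with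
  | empty => exact ⟨1, one_pos, 1, one_pos, by simp⟩
  | @insert i s _ _ ih =>
    obtain ⟨ε₀, hε₀, C, hC, H⟩ := ih fun j hj => h j (mem_insert_of_mem _ hj)
    obtain ⟨ε₁, hε₁, C', hC', H'⟩ := h i (mem_insert _ _)
    refine ⟨min ε₀ ε₁, lt_min hε₀ hε₁, C + C', by positivity, fun ε hε hle j hj x hx => ?_⟩
    have hpos : 0 < (ε ^ a)⁻¹ := inv_pos.2 (pow_pos hε.1 _)
    rcases hj with rfl | hj
    · refine (H' ε hε (hle.trans (min_le_right _ _)) x hx).trans ?_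
      gcongr
      linarith
    · refine (H ε hε (hle.trans (min_le_left _ _)) j hj x hx).trans ?_
      gcongr
      linarith

end IsBigOInv

section

variable {F : ℝ → EuclideanSpace ℝ (Fin n) × EuclideanSpace ℝ (Fin n) → 𝕜}
  {U S : Set (EuclideanSpace ℝ (Fin n) × EuclideanSpace ℝ (Fin n))}

/-- Induction on the number of pure `x`-derivatives, by `∂_x = (∂_x + ∂_y) - ∂_y`: the first term
keeps the exponent, the second raises it by one. -/
theorem isBigOInv_wordDeriv_of_multiIndex (hU : IsOpen U) (hS : S ⊆ U)
    (hF : ∀ ε ∈ Ioc (0 : ℝ) 1, ContDiffOn ℝ ∞ (F ε) U)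
    (h : ∀ α β : Fin n → ℕ, IsBigOInv S (n + mdeg β) fun ε =>
      wordDeriv ((multiWord α).map (fun i => (stdVec i, stdVec i)) ++
        (multiWord β).map (fun i => (0, stdVec i))) (F ε)) (a b c : List (Fin n)) :
    IsBigOInv S (n + c.length + a.length) fun ε =>
      wordDeriv (a.map (fun i => (stdVec i, 0)) ++ (b.map (fun i => (stdVec i, stdVec i)) ++
        c.map (fun i => (0, stdVec i)))) (F ε) := by
  induction a generalizing b c with
  | nil =>
    have := (h (fun i => b.count i) (fun i => c.count i)).mono
      (b := n + c.length + ([] : List (Fin n)).length) (by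
        rw [← length_multiWord, ← (perm_multiWord c).length_eq]; simp)
    refine this.congr fun ε hε => (wordDeriv_perm (hF ε hε) hU ?_).mono hS
    exact ((perm_multiWord b).symm.map _).append ((perm_multiWord c).symm.map _)
  | cons i a ih =>
    have h1 := (ih (i :: b) c).mono (b := n + c.length + (i :: a).length) (by simp)
    have h2 := (ih b (i :: c)).mono (b := n + c.length + (i :: a).length) (by simp; omega)
    refine (h1.sub h2).congr fun ε hε p hp => ?_
    set r := a.map (fun i => ((stdVec i, 0) : EuclideanSpace ℝ (Fin n) ×
      EuclideanSpace ℝ (Fin n))) ++ (b.map (fun i => (stdVec i, stdVec i)) ++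
        c.map (fun i => (0, stdVec i))) with hr
    have e1 := wordDeriv_perm (hF ε hε) hU (l := a.map (fun i => (stdVec i, 0)) ++
      ((i :: b).map (fun i => (stdVec i, stdVec i)) ++ c.map (fun i => (0, stdVec i))))
      (l' := (stdVec i, stdVec i) :: r) (by
        rw [List.map_cons, List.cons_append]; exact List.perm_middle) (hS hp)
    have e2 := wordDeriv_perm (hF ε hε) hU (l := a.map (fun i => (stdVec i, 0)) ++
      (b.map (fun i => (stdVec i, stdVec i)) ++ (i :: c).map (fun i => (0, stdVec i))))
      (l' := (0, stdVec i) :: r) (by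
        rw [List.map_cons, hr, ← List.append_assoc, ← List.append_assoc]
        exact List.perm_middle) (hS hp)
    beta_reduce
    rw [e1, e2, List.map_cons, List.cons_append, ← hr]
    simp only [wordDeriv_cons]
    rw [← map_sub]
    simp

end

/-- Continuity of `u` on `𝓓_K` is a bound by finitely many seminorms. `N` is the largest order that
occurs, and `(n + 1) ^ N` pays for passing from basis directions to the norms of the multilinear
derivatives. -/
theorem exists_bound_of_eq_zero (u : 𝓓(Ω, 𝕜) →L[𝕜] 𝕜) {K : Compacts (EuclideanSpace ℝ (Fin n))}
    (hK : (K : Set (EuclideanSpace ℝ (Fin n))) ⊆ Ω) :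
    ∃ (N : ℕ) (C : ℝ), 0 ≤ C ∧ ∀ ψ : 𝓓(Ω, 𝕜), (∀ y ∉ K, ψ y = 0) → ∀ M : ℝ, 0 ≤ M →
      (∀ m : List (Fin n), m.length ≤ N → ∀ y ∈ K, ‖wordDeriv (m.map stdVec) ψ y‖ ≤ M) →
      ‖u ψ‖ ≤ C * M := by
  obtain ⟨s, C, -, h⟩ := Seminorm.bound_of_continuous
    (ContDiffMapSupportedIn.withSeminorms 𝕜 (EuclideanSpace ℝ (Fin n)) 𝕜 ⊤ K)
    ((normSeminorm 𝕜 𝕜).comp (u.comp (TestFunction.ofSupportedInCLM 𝕜 hK)).toLinearMap)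
    (continuous_norm.comp (u.comp (TestFunction.ofSupportedInCLM 𝕜 hK)).continuous)
  refine ⟨s.sup id, C * (n + 1) ^ s.sup id, by positivity, fun ψ hψ M hM hb => ?_⟩
  have h0 : EqOn ψ 0 (K : Set (EuclideanSpace ℝ (Fin n)))ᶜ := hψ
  have e : ψ = TestFunction.ofSupportedIn hK (toSupported K ψ) := by
    rw [← toTest_eq_ofSupportedIn hK ψ.contDiff h0, toTest_coe]
  have hle : ‖u ψ‖ ≤ C * (s.sup (ContDiffMapSupportedIn.seminorm 𝕜 (EuclideanSpace ℝ (Fin n)) 𝕜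
      ⊤ K)) (toSupported K ψ) := by
    conv_lhs => rw [e]
    exact h (toSupported K ψ)
  refine hle.trans ?_
  rw [mul_assoc]
  refine mul_le_mul_of_nonneg_left (Seminorm.finset_sup_apply_le (by positivity) fun i hi => ?_)
    C.coe_nonneg
  have hiN : i ≤ s.sup id := Finset.le_sup (f := id) hi
  rw [ContDiffMapSupportedIn.seminorm_top_le_iff 𝕜 (by positivity)]
  intro y hy
  rw [coe_toSupported ψ.contDiff h0]
  refine (norm_multilinear_le_of_stdVec _ hM fun t => ?_).trans ?_
  · rw [iteratedFDeriv_apply_eq_wordDeriv ψ.contDiff.contDiffOn isOpen_univ _ (mem_univ y)]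
    have := hb (List.ofFn t) (by simpa using hiN) y hy
    rwa [List.map_ofFn] at this
  · gcongr
    calc (n : ℝ) ^ i ≤ (n + 1 : ℝ) ^ i := by gcongr; linarith
      _ ≤ (n + 1 : ℝ) ^ s.sup id := pow_le_pow_right₀ (by simp) hiN

end Growth

/-! ### The basic space -/

section BasicSpace

variable {n : ℕ} {𝕜 : Type*} [RCLike 𝕜] {Ω : Opens (EuclideanSpace ℝ (Fin n))}

theorem isSmoothCurve_iff_contDiff {W : Type*} [NormedAddCommGroup W] [NormedSpace ℝ W]
    {c : ℝ → W} : IsSmoothCurve c ↔ ContDiff ℝ ∞ c := by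
  constructor
  · rintro ⟨d, rfl, hd⟩
    have hder : ∀ k t, HasDerivAt (d k) (d (k + 1) t) t := fun k t =>
      hasDerivAt_iff_tendsto_slope_zero.2 (hd k t)
    have : ∀ j k : ℕ, ContDiff ℝ j (d k) := by
      intro j
      induction j with
      | zero =>
        intro k
        rw [Nat.cast_zero, contDiff_zero]
        exact continuous_iff_continuousAt.2 fun t => (hder k t).continuousAt
      | succ j ih =>
        intro k
        rw [Nat.cast_succ, contDiff_succ_iff_deriv]
        refine ⟨fun t => (hder k t).differentiableAt, fun h => absurd h (by simp), ?_⟩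
        rw [show deriv (d k) = d (k + 1) from funext fun t => (hder k t).deriv]
        exact ih (k + 1)
    exact contDiff_infty.2 fun j => this j 0
  · intro hc
    refine ⟨fun k => iteratedDeriv k c, iteratedDeriv_zero, fun k t => ?_⟩
    have hd : DifferentiableAt ℝ (iteratedDeriv k c) t :=
      (hc.differentiable_iteratedDeriv k
        (by exact_mod_cast WithTop.coe_lt_coe.2 (ENat.natCast_lt_top k))) t
    have := hd.hasDerivAt
    rw [← iteratedDeriv_succ] at this
    exact hasDerivAt_iff_tendsto_slope_zero.1 this

theorem iota_mem_basicSpace (u : 𝓓(Ω, 𝕜) →L[𝕜] 𝕜) : iota u ∈ basicSpace Ω 𝕜 := by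
  rintro c γ ⟨d, rfl, hd⟩ -
  refine ⟨fun k t => u (d k t), rfl, fun k t => ?_⟩
  refine (((u.restrictScalars ℝ).continuous.tendsto _).comp (hd k t)).congr fun h => ?_
  rw [Function.comp_apply, map_smul, map_sub]
  rfl

theorem sigma_mem_basicSpace {f : Ω → 𝕜} (hf : f ∈ smoothFunctions Ω 𝕜) :
    sigma f ∈ basicSpace Ω 𝕜 := by
  intro c γ _ hγ
  rw [isSmoothCurve_iff_contDiff] at hγ ⊢
  have : (fun t => sigma f (c t, γ t)) = fun t => zeroExt Ω f (γ t) :=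
    funext fun t => (zeroExt_apply f (γ t).2).symm
  rw [this, ← contDiffOn_univ]
  exact ContDiffOn.comp hf hγ.contDiffOn fun t _ => (γ t).2

theorem sub_mem_basicSpace {R R' : 𝓓(Ω, 𝕜) × Ω → 𝕜} (hR : R ∈ basicSpace Ω 𝕜)
    (hR' : R' ∈ basicSpace Ω 𝕜) : R - R' ∈ basicSpace Ω 𝕜 := by
  intro c γ hc hγ
  have h1 := hR c γ hc hγ
  have h2 := hR' c γ hc hγ
  rw [isSmoothCurve_iff_contDiff] at h1 h2 ⊢
  exact h1.sub h2

end BasicSpace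

/-! ### The embeddings are moderate, and agree on smooth functions modulo negligible elements -/

section Embeddings

variable {n : ℕ} {𝕜 : Type*} [RCLike 𝕜] {Ω : Opens (EuclideanSpace ℝ (Fin n))} {q : ℕ}
  {φ : ℝ → EuclideanSpace ℝ (Fin n) → 𝓓(Ω, 𝕜)}

theorem SmoothMapOn.contDiffOn_apply
    (h : SmoothMapOn (fun p : ℝ × EuclideanSpace ℝ (Fin n) => φ p.1 p.2)
      (Ioc (0 : ℝ) 1 ×ˢ (Ω : Set (EuclideanSpace ℝ (Fin n))))) {ε : ℝ} (hε : ε ∈ Ioc (0 : ℝ) 1) :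
    ContDiffOn ℝ ∞ (fun p : EuclideanSpace ℝ (Fin n) × EuclideanSpace ℝ (Fin n) => φ ε p.1 p.2)
      ((Ω : Set (EuclideanSpace ℝ (Fin n))) ×ˢ univ) := by
  obtain ⟨D, hD, h0⟩ := h.exists_isDerivFamily hε
  exact hD.contDiffOn.congr fun p hp => by rw [h0 hp.1]

theorem IsSmoothingKernel.isBigOInv_wordDeriv (hφ : IsSmoothingKernel q φ)
    {K : Set (EuclideanSpace ℝ (Fin n))} (hK : IsCompact K) (hKΩ : K ⊆ Ω) (a c : List (Fin n)) :
    IsBigOInv (K ×ˢ (Ω : Set (EuclideanSpace ℝ (Fin n)))) (n + c.length + a.length) fun ε =>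
      wordDeriv ((c.map Sum.inr ++ a.map Sum.inl).map (prodBasis n))
        (fun p : EuclideanSpace ℝ (Fin n) × EuclideanSpace ℝ (Fin n) => φ ε p.1 p.2) := by
  have hU := IsDerivFamily.isOpen_prod_univ Ω
  have hS : K ×ˢ (Ω : Set (EuclideanSpace ℝ (Fin n))) ⊆
    (Ω : Set (EuclideanSpace ℝ (Fin n))) ×ˢ univ := prod_mono hKΩ (subset_univ _)
  have hF := fun ε (hε : ε ∈ Ioc (0 : ℝ) 1) => SmoothMapOn.contDiffOn_apply hφ.smooth hε
  refine (isBigOInv_wordDeriv_of_multiIndex hU hS hF (fun α β => ?_) a [] c).congr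
    fun ε hε => (wordDeriv_perm (hF ε hε) hU ?_).mono hS
  · obtain ⟨ε₀, hε₀, C, hC, H⟩ := hφ.growth K hK hKΩ α β
    refine ⟨ε₀, hε₀, C, hC, fun ε hε hle p hp => ?_⟩
    have h1 := multiPow_pderivY_eqOn (Φ := fun x y => φ ε x y) (l := []) (hF ε hε)
      (fun _ _ => rfl) β
    have h2 := multiPow_pderivXY_eqOn (hF ε hε) h1 α (hS hp)
    rw [List.append_nil] at h2
    beta_reduce at h2 ⊢
    rw [← h2]
    exact H ε hε hle p.1 hp.1 p.2 hp.2
  · rw [List.map_nil, List.nil_append, List.map_append, List.map_map, List.map_map]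
    refine List.perm_append_comm.trans (List.Perm.of_eq ?_)
    congr 1 <;> exact List.map_congr_left fun i _ => by simp

theorem IsSmoothingKernel.exists_eq_zero (hφ : IsSmoothingKernel q φ)
    {K L : Set (EuclideanSpace ℝ (Fin n))} (hK : IsCompact K) (hKΩ : K ⊆ Ω)
    (hKL : K ⊆ interior L) :
    ∃ ε₀ > 0, ∀ ε ∈ Ioc (0 : ℝ) 1, ε ≤ ε₀ → ∀ x ∈ K, ∀ y ∉ L, φ ε x y = 0 := by
  obtain ⟨ε₀, hε₀, C, hC, H⟩ := hφ.supp K hK hKΩ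
  obtain ⟨ρ, hρ, hsub⟩ := hK.exists_cthickening_subset_open isOpen_interior hKL
  -- Half of `ε₀`, since the support condition asks for `ε < ε₀`; and `C ε ≤ ρ` keeps the ball
  -- inside the thickening of `K`.
  refine ⟨min (ε₀ / 2) (ρ / C), by positivity, fun ε hε hle x hx y hy => ?_⟩
  have h1 := H x hx ε hε (by linarith [hle.trans (min_le_left _ _)])
  by_contra hne
  have h2 := h1 (subset_tsupport _ hne)
  refine hy (interior_subset (hsub ?_))
  refine Metric.mem_cthickening_of_dist_le y x ρ K hx (h2.le.trans ?_)
  have := hle.trans (min_le_right _ _)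
  rwa [le_div_iff₀ hC, mul_comm] at this

theorem iota_mem_moderate (u : 𝓓(Ω, 𝕜) →L[𝕜] 𝕜) : iota u ∈ moderate Ω 𝕜 := by
  refine ⟨iota_mem_basicSpace u, fun K hK hKΩ α => ?_⟩
  -- Two compact sets are needed: supports are controlled by `K₂` for base points in `K₁`, a
  -- neighbourhood of `K`, so that the `x`-derivatives at points of `K` vanish off `K₂` too.
  obtain ⟨K₁, hK₁, hKK₁, hK₁Ω⟩ := exists_compact_between hK Ω.isOpen hKΩ
  obtain ⟨K₂, hK₂, hK₁K₂, hK₂Ω⟩ := exists_compact_between hK₁ Ω.isOpen hK₁Ω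
  obtain ⟨N, C, hC, hu⟩ := exists_bound_of_eq_zero u (K := ⟨K₂, hK₂⟩) hK₂Ω
  -- Order `0` suffices because the moment condition is not used. The exponent accounts for at most
  -- `N` derivatives in `y` and `|α|` in `x`.
  refine ⟨0, n + N + (multiWord α).length, fun φ hφ => ?_⟩
  obtain ⟨ε₁, hε₁, hz⟩ := hφ.exists_eq_zero hK₁ hK₁Ω hK₁K₂
  obtain ⟨ε₂, hε₂, C', hC', hb⟩ := IsBigOInv.exists_uniform (List.finite_length_le (Fin n) N)
    fun c hc => (hφ.isBigOInv_wordDeriv hK hKΩ (multiWord α) c).mono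
      (b := n + N + (multiWord α).length) (by have : c.length ≤ N := hc; omega)
  refine ⟨min ε₁ ε₂, lt_min hε₁ hε₂, C * C' + 1, by positivity, fun ε hε hle x hx => ?_⟩
  obtain ⟨D, hD, h0⟩ := SmoothMapOn.exists_isDerivFamily hφ.smooth hε
  have hxΩ : x ∈ Ω := hKΩ hx
  have hpos : 0 < (ε ^ (n + N + (multiWord α).length))⁻¹ := inv_pos.2 (pow_pos hε.1 _)
  have e : testDeriv (iota u) φ α ε x = u (D ((multiWord α).map stdVec) x) :=
    multiPow_pderiv_eqOn_apply hD u (fun z hz => by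
      beta_reduce; rw [zeroExt_apply _ hz, h0 hz]; rfl) α hxΩ
  rw [e]
  refine (hu _ ?_ (C' * (ε ^ (n + N + (multiWord α).length))⁻¹) (by positivity) ?_).trans ?_
  · intro y hy
    refine hD.apply_eq_zero isOpen_interior (interior_subset.trans hK₁Ω) (fun z hzi => ?_) _ x
      (hKK₁ hx)
    rw [h0 (hK₁Ω (interior_subset hzi))]
    exact hz ε hε (hle.trans (min_le_left _ _)) z (interior_subset hzi) y hy
  · intro m hm y hy
    rw [← hD.wordDeriv_eq m _ hxΩ, wordDeriv_congr (IsDerivFamily.isOpen_prod_univ Ω)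
      (G := fun p : EuclideanSpace ℝ (Fin n) × EuclideanSpace ℝ (Fin n) => φ ε p.1 p.2)
      (fun p hp => by beta_reduce; rw [h0 hp.1]) _ ⟨hxΩ, mem_univ y⟩]
    exact hb ε hε (hle.trans (min_le_right _ _)) m hm (x, y) ⟨hx, hK₂Ω hy⟩
  · rw [← mul_assoc, add_mul]
    linarith

theorem sigma_mem_moderate {f : Ω → 𝕜} (hf : f ∈ smoothFunctions Ω 𝕜) :
    sigma f ∈ moderate Ω 𝕜 := by
  refine ⟨sigma_mem_basicSpace hf, fun K hK hKΩ α => ⟨0, 0, fun φ _ => ?_⟩⟩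
  have hc : ContinuousOn (wordDeriv ((multiWord α).map stdVec) (zeroExt Ω f)) K :=
    (ContDiffOn.wordDeriv hf Ω.isOpen _).continuousOn.mono hKΩ
  obtain ⟨C, hC⟩ := hK.exists_bound_of_continuousOn hc
  refine ⟨1, one_pos, |C| + 1, by positivity, fun ε _ _ x hx => ?_⟩
  have e : testDeriv (sigma f) φ α ε x = wordDeriv ((multiWord α).map stdVec) (zeroExt Ω f) x :=
    multiPow_pderiv_eqOn hf (fun z hz => rfl) α (hKΩ hx)
  rw [e, pow_zero, inv_one, mul_one]
  linarith [hC x hx, le_abs_self C]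

theorem regularDistribution_apply {f : Ω → 𝕜} (hf : f ∈ smoothFunctions Ω 𝕜) (ψ : 𝓓(Ω, 𝕜)) :
    regularDistribution f ψ = ∫ y, zeroExt Ω f y * ψ y := by
  have hloc : LocallyIntegrableOn (zeroExt Ω f) Ω volume :=
    ContinuousOn.locallyIntegrableOn (ContDiffOn.continuousOn hf) Ω.isOpen.measurableSet
  rw [regularDistribution, TestFunction.integralAgainstBilinCLM_eq_integral hloc]
  simp [mul_comm]

/-- The expression in the moment condition, in terms of the derivatives of the kernel. -/
theorem setIntegral_multiPow_pderivX {D : List (EuclideanSpace ℝ (Fin n)) →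
      EuclideanSpace ℝ (Fin n) → 𝓓(Ω, 𝕜)} (hD : IsDerivFamily D)
    {ψ : EuclideanSpace ℝ (Fin n) → 𝓓(Ω, 𝕜)} (h0 : EqOn (D []) ψ Ω)
    {f : Ω → 𝕜} (hf : f ∈ smoothFunctions Ω 𝕜) (α : Fin n → ℕ) {x : EuclideanSpace ℝ (Fin n)}
    (hx : x ∈ Ω) :
    (∫ y in (Ω : Set (EuclideanSpace ℝ (Fin n))),
      zeroExt Ω f y * multiPow pderivX α (fun x' y' => ψ x' y') x y) =
    regularDistribution f (D ((multiWord α).map stdVec) x) := by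
  have e : ∀ y, multiPow pderivX α (fun x' y' => ψ x' y') x y =
      D ((multiWord α).map stdVec) x y := fun y => by
    have h1 := multiPow_pderivX_eqOn (Φ := fun x y => ψ x y) (l := []) hD.contDiffOn
      (fun p hp => by rw [wordDeriv_nil, h0 hp.1]) α (x := (x, y)) ⟨hx, mem_univ y⟩
    have h2 := hD.wordDeriv_eq [] (multiWord α) hx y
    beta_reduce at h1
    rw [h1]
    simpa [Function.comp_def] using h2
  rw [regularDistribution_apply hf]
  simp_rw [e]
  refine setIntegral_eq_integral_of_forall_compl_eq_zero fun y hy => ?_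
  rw [image_eq_zero_of_notMem_tsupport fun h => hy (TestFunction.tsupport_subset _ h), mul_zero]

/-- This is the moment condition with `q = m`, followed by `ε ^ (m + 1) ≤ ε ^ m`. -/
theorem iota_sub_sigma_mem_negligible {f : Ω → 𝕜} (hf : f ∈ smoothFunctions Ω 𝕜) :
    iota (regularDistribution f) - sigma f ∈ negligible Ω 𝕜 := by
  refine ⟨sub_mem_basicSpace (iota_mem_basicSpace _) (sigma_mem_basicSpace hf),
    fun K hK hKΩ α m => ⟨m, fun φ hφ => ?_⟩⟩
  obtain ⟨ε₀, hε₀, C, hC, H⟩ := hφ.moment K hK hKΩ α f hf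
  refine ⟨ε₀, hε₀, C, hC, fun ε hε hle x hx => ?_⟩
  obtain ⟨D, hD, h0⟩ := SmoothMapOn.exists_isDerivFamily hφ.smooth hε
  have e : testDeriv (iota (regularDistribution f) - sigma f) φ α ε x =
      regularDistribution f (D ((multiWord α).map stdVec) x) -
        wordDeriv ((multiWord α).map stdVec) (zeroExt Ω f) x :=
    multiPow_pderiv_eqOn_sub hD _ hf (fun z hz => by
      beta_reduce; rw [zeroExt_apply _ hz, h0 hz, zeroExt_apply _ hz]; rfl) α (hKΩ hx)
  rw [e, ← setIntegral_multiPow_pderivX hD h0 hf α (hKΩ hx),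
    ← multiPow_pderiv_eqOn hf (fun _ _ => rfl) α (hKΩ hx)]
  exact (H ε hε hle x hx).trans (mul_le_mul_of_nonneg_left
    (pow_le_pow_of_le_one hε.1.le hε.2 (Nat.le_succ m)) hC.le)

theorem zero_mem_negligible : (0 : 𝓓(Ω, 𝕜) × Ω → 𝕜) ∈ negligible Ω 𝕜 := by
  have h : (iota (0 : 𝓓(Ω, 𝕜) →L[𝕜] 𝕜)) = 0 := rfl
  refine ⟨h ▸ iota_mem_basicSpace 0, fun K hK hKΩ α m => ⟨0, fun φ _ =>
    ⟨1, one_pos, 1, one_pos, fun ε hε _ x hx => ?_⟩⟩⟩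
  have e : testDeriv (0 : 𝓓(Ω, 𝕜) × Ω → 𝕜) φ α ε x =
      wordDeriv ((multiWord α).map stdVec) (0 : EuclideanSpace ℝ (Fin n) → 𝕜) x :=
    multiPow_pderiv_eqOn (show ContDiffOn ℝ ∞ (0 : EuclideanSpace ℝ (Fin n) → 𝕜) Ω from
      contDiffOn_const) (fun z hz => by rw [zeroExt_apply _ hz]; rfl) α (hKΩ hx)
  rw [e, wordDeriv_zero]
  have := hε.1
  simp only [Pi.zero_apply, norm_zero]
  positivity

end Embeddings

/-! ### Tools for the construction of smoothing kernels -/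

section Tools

variable {n : ℕ} {𝕜 : Type*} [RCLike 𝕜] {Ω : Opens (EuclideanSpace ℝ (Fin n))}

/-- The integral is the convolution of the constant `1` with `H p`, evaluated at `0`, so smooth
dependence of convolutions on parameters applies. -/
theorem contDiffOn_integral {V : Type*} [NormedAddCommGroup V] [NormedSpace ℝ V] {U : Set V}
    (hU : IsOpen U) {H : V → EuclideanSpace ℝ (Fin n) → 𝕜}
    (hH : ContDiffOn ℝ ∞ (fun p : V × EuclideanSpace ℝ (Fin n) => H p.1 p.2) (U ×ˢ univ))
    {k : Set (EuclideanSpace ℝ (Fin n))} (hk : IsCompact k) (h0 : ∀ p ∈ U, ∀ z ∉ k, H p z = 0) :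
    ContDiffOn ℝ ∞ (fun p => ∫ z, H p z) U := by
  have h := contDiffOn_convolution_right_with_param_comp (n := ⊤)
    (μ := (volume : Measure (EuclideanSpace ℝ (Fin n)))) (ContinuousLinearMap.lsmul ℝ ℝ)
    (v := fun _ : V => (0 : EuclideanSpace ℝ (Fin n))) contDiffOn_const
    (f := fun _ => (1 : ℝ)) (g := H) hU hk (fun p x hp hx => h0 p hp x hx)
    (locallyIntegrable_const _) hH
  refine h.congr fun p _ => ?_
  rw [convolution_def]
  simp only [ContinuousLinearMap.lsmul_apply, one_smul, zero_sub]
  exact (integral_neg_eq_self (H p) volume).symm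

/-- The admissible radii at a point form a convex set, and locally a constant is admissible; a
partition of unity glues these constants smoothly. -/
theorem exists_smooth_radius (Ω : Opens (EuclideanSpace ℝ (Fin n))) :
    ∃ r : EuclideanSpace ℝ (Fin n) → ℝ, ContDiffOn ℝ ∞ r Ω ∧
      ∀ x ∈ Ω, 0 < r x ∧ r x ≤ 1 ∧ Metric.closedBall x (2 * r x) ⊆ Ω := by
  have : LocallyCompactSpace Ω := Ω.isOpen.locallyCompactSpace
  have : SigmaCompactSpace Ω := sigmaCompactSpace_of_locallyCompact_secondCountable
  obtain ⟨g, hg⟩ := exists_contMDiffMap_forall_mem_convex_of_local_const (n := (⊤ : ℕ∞))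
    (modelWithCornersSelf ℝ (EuclideanSpace ℝ (Fin n))) (M := Ω) (F := ℝ)
    (t := fun x => {c | 0 < c ∧ c ≤ 1 ∧ Metric.closedBall (x : EuclideanSpace ℝ (Fin n)) (2 * c)
      ⊆ Ω}) (fun x => by
        refine OrdConnected.convex ⟨fun a ha b hb c hc => ?_⟩
        exact ⟨ha.1.trans_le hc.1, hc.2.trans hb.2.1,
          (Metric.closedBall_subset_closedBall (by linarith [hc.2])).trans hb.2.2⟩)
    (fun x => by
      obtain ⟨ρ, hρ, hball⟩ := Metric.isOpen_iff.1 Ω.isOpen x x.2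
      -- For `y` within `ρ / 2` of `x`, the ball around `y` of radius at most `2 (ρ / 4)` stays in
      -- `ball x ρ`.
      refine ⟨min 1 (ρ / 4), ?_⟩
      have : ∀ᶠ y : Ω in 𝓝 x, dist (y : EuclideanSpace ℝ (Fin n)) x < ρ / 2 :=
        (continuous_subtype_val.tendsto x).eventually (Metric.ball_mem_nhds _ (half_pos hρ))
      filter_upwards [this] with y hy
      refine ⟨by positivity, min_le_left _ _, fun z hz => hball ?_⟩
      rw [Metric.mem_closedBall] at hz
      rw [Metric.mem_ball]
      have := min_le_right 1 (ρ / 4)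
      linarith [dist_triangle z (y : EuclideanSpace ℝ (Fin n)) x])
  refine ⟨Function.extend Subtype.val g 0, fun x hx => ?_, fun x hx => ?_⟩
  · have h1 : ContMDiffAt (modelWithCornersSelf ℝ (EuclideanSpace ℝ (Fin n)))
        (modelWithCornersSelf ℝ ℝ) ∞
        (fun y : Ω => Function.extend Subtype.val g 0 (y : EuclideanSpace ℝ (Fin n)))
        ⟨x, hx⟩ := by
      simp only [Subtype.val_injective.extend_apply]
      exact g.contMDiff.contMDiffAt
    exact (contMDiffAt_subtype_iff.1 h1).contDiffAt.contDiffWithinAt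
  · have := hg ⟨x, hx⟩
    rwa [← Subtype.val_injective.extend_apply g 0 ⟨x, hx⟩] at this

theorem exists_extrapolation (q : ℕ) : ∃ c : Fin (q + 1) → ℝ, ∀ k ≤ q,
    ∑ j, c j * (1 / ((j : ℝ) + 1)) ^ k = if k = 0 then 1 else 0 := by
  set v : Fin (q + 1) → ℝ := fun j => 1 / ((j : ℝ) + 1) with hv
  have hinj : Function.Injective v := fun i j hij => by
    simp only [hv, one_div, inv_inj, add_left_inj, Nat.cast_inj] at hij
    exact Fin.ext hij
  have hdet : IsUnit (Matrix.vandermonde v).det :=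
    isUnit_iff_ne_zero.2 (Matrix.det_vandermonde_ne_zero_iff.2 hinj)
  -- The coefficients form the row of index `0` of the inverse Vandermonde matrix for the distinct
  -- nodes `1 / (j + 1)`.
  refine ⟨Matrix.vecMul (Pi.single 0 1) (Matrix.vandermonde v)⁻¹, fun k hk => ?_⟩
  have h := congrFun (show Matrix.vecMul (Matrix.vecMul (Pi.single 0 1) (Matrix.vandermonde v)⁻¹)
    (Matrix.vandermonde v) = Pi.single 0 1 by
      rw [Matrix.vecMul_vecMul, Matrix.nonsing_inv_mul _ hdet, Matrix.vecMul_one])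
    ⟨k, Nat.lt_succ_of_le hk⟩
  rw [Matrix.vecMul, dotProduct] at h
  simp only [Matrix.vandermonde_apply] at h
  rw [h, Pi.single_apply]
  simp [Fin.ext_iff]

theorem iteratedDerivWithin_slice {a : ℝ} {W : ℝ × EuclideanSpace ℝ (Fin n) → 𝕜} (ha : 1 < a)
    (hW : ContDiffOn ℝ ∞ W (Ioo (-a) a ×ˢ (Ω : Set (EuclideanSpace ℝ (Fin n))))) (k : ℕ)
    {x : EuclideanSpace ℝ (Fin n)} (hx : x ∈ Ω) {t : ℝ} (ht : t ∈ Icc (0 : ℝ) 1) :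
    iteratedDerivWithin k (fun t => W (t, x)) (Icc 0 1) t =
      wordDeriv (List.replicate k ((1 : ℝ), (0 : EuclideanSpace ℝ (Fin n)))) W (t, x) := by
  have hU : IsOpen (Ioo (-a) a ×ˢ (Ω : Set (EuclideanSpace ℝ (Fin n)))) :=
    isOpen_Ioo.prod Ω.isOpen
  have hta : t ∈ Ioo (-a) a := ⟨by linarith [ht.1], by linarith [ht.2]⟩
  have hsl : ContDiffOn ℝ ∞ (fun t => W (t, x)) (Ioo (-a) a) :=
    hW.comp (by fun_prop) fun s hs => ⟨hs, hx⟩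
  rw [iteratedDerivWithin_eq_iteratedDeriv (uniqueDiffOn_Icc one_pos)
    ((hsl.contDiffAt (isOpen_Ioo.mem_nhds hta)).of_le
      (by exact_mod_cast (WithTop.coe_lt_coe.2 (ENat.natCast_lt_top k)).le)) ht,
    iteratedDeriv_eq_iteratedFDeriv, iteratedFDeriv_apply_eq_wordDeriv hsl isOpen_Ioo _ hta,
    List.ofFn_const]
  have := wordDeriv_comp_affine hW hU
    (ContinuousLinearMap.inl ℝ ℝ (EuclideanSpace ℝ (Fin n))) (0, x) (List.replicate k 1) (p := t)
    (by simpa using ⟨hta, hx⟩)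
  simpa using this

/-- A linear combination of dilations which annihilates the monomials of degree `1, …, q`
approximates the value at `0` up to order `q + 1`. -/
theorem exists_extrapolation_bound {a : ℝ} {W : ℝ × EuclideanSpace ℝ (Fin n) → 𝕜} (ha : 1 < a)
    (hW : ContDiffOn ℝ ∞ W (Ioo (-a) a ×ˢ (Ω : Set (EuclideanSpace ℝ (Fin n)))))
    {K : Set (EuclideanSpace ℝ (Fin n))} (hK : IsCompact K) (hKΩ : K ⊆ Ω) {q : ℕ}
    {ι : Type*} [Fintype ι] {c s : ι → ℝ} (hs : ∀ j, s j ∈ Icc (0 : ℝ) 1)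
    (hc : ∀ k ≤ q, ∑ j, c j * s j ^ k = if k = 0 then 1 else 0) :
    ∃ C > 0, ∀ ε ∈ Ioc (0 : ℝ) 1, ∀ x ∈ K,
      ‖∑ j, c j • W (s j * ε, x) - W (0, x)‖ ≤ C * ε ^ (q + 1) := by
  have hU : IsOpen (Ioo (-a) a ×ˢ (Ω : Set (EuclideanSpace ℝ (Fin n)))) :=
    isOpen_Ioo.prod Ω.isOpen
  have hcomp : IsCompact (Icc (0 : ℝ) 1 ×ˢ K) := isCompact_Icc.prod hK
  obtain ⟨C, hC⟩ := hcomp.exists_bound_of_continuousOn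
    ((ContDiffOn.wordDeriv hW hU (List.replicate (q + 1) (1, 0))).continuousOn.mono
      (prod_mono (fun t ht => ⟨by linarith [ht.1], by linarith [ht.2]⟩) hKΩ))
  refine ⟨∑ j, |c j| * |C| + 1, by positivity, fun ε hε x hx => ?_⟩
  set h : ℝ → 𝕜 := fun t => W (t, x) with hh
  have hsm : ContDiffOn ℝ ∞ h (Icc 0 1) :=
    hW.comp (by fun_prop) fun t ht => ⟨⟨by linarith [ht.1], by linarith [ht.2]⟩, hKΩ hx⟩
  set T : ℝ → 𝕜 := taylorWithinEval h q (Icc 0 1) 0 with hT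
  have hrem : ∀ t ∈ Icc (0 : ℝ) 1, ‖h t - T t‖ ≤ |C| * t ^ (q + 1) := fun t ht => by
    have := taylor_mean_remainder_bound (n := q) (C := |C|) zero_le_one
      (hsm.of_le (by exact_mod_cast (WithTop.coe_lt_coe.2 (ENat.natCast_lt_top (q + 1))).le)) ht
      fun y hy => by
        rw [iteratedDerivWithin_slice ha hW (q + 1) (hKΩ hx) hy]
        exact (hC (y, x) ⟨hy, hx⟩).trans (le_abs_self C)
    rw [sub_zero] at this
    refine this.trans (div_le_self (mul_nonneg (abs_nonneg _) (pow_nonneg ht.1 _)) ?_)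
    exact_mod_cast Nat.one_le_iff_ne_zero.2 (Nat.factorial_ne_zero q)
  -- The hypothesis on `c` kills the Taylor terms of orders `1, …, q` and preserves the constant
  -- one, so only remainders are left.
  have hTsum : ∑ j, c j • T (s j * ε) = h 0 := by
    simp only [hT, taylor_within_apply, sub_zero, Finset.smul_sum]
    rw [Finset.sum_comm]
    have : ∀ k ∈ Finset.range (q + 1), ∑ j, c j • ((k.factorial : ℝ)⁻¹ * (s j * ε) ^ k) •
        iteratedDerivWithin k h (Icc 0 1) 0 = if k = 0 then h 0 else 0 := fun k hk => by
      have e : ∀ j, c j • ((k.factorial : ℝ)⁻¹ * (s j * ε) ^ k) •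
          iteratedDerivWithin k h (Icc 0 1) 0 = (c j * s j ^ k) •
            (((k.factorial : ℝ)⁻¹ * ε ^ k) • iteratedDerivWithin k h (Icc 0 1) 0) := fun j => by
        rw [smul_smul, smul_smul, mul_pow]
        congr 1
        ring
      simp_rw [e]
      rw [← Finset.sum_smul, hc k (Nat.lt_succ_iff.1 (Finset.mem_range.1 hk))]
      split_ifs with h0
      · subst h0; simp
      · simp
    rw [Finset.sum_congr rfl this]
    simp
  have e : ∑ j, c j • W (s j * ε, x) - W (0, x) =
      ∑ j, c j • (h (s j * ε) - T (s j * ε)) := by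
    simp only [smul_sub, Finset.sum_sub_distrib, hTsum, hh]
  rw [e, add_mul, Finset.sum_mul]
  refine (norm_sum_le_of_le _ fun j _ => ?_).trans
    (le_add_of_nonneg_right (by have := hε.1; positivity))
  have hsε : s j * ε ∈ Icc (0 : ℝ) 1 :=
    ⟨mul_nonneg (hs j).1 hε.1.le, mul_le_one₀ (hs j).2 hε.1.le hε.2⟩
  rw [norm_smul, mul_assoc, Real.norm_eq_abs]
  gcongr
  refine (hrem _ hsε).trans ?_
  exact mul_le_mul_of_nonneg_left
    (pow_le_pow_left₀ hsε.1 (mul_le_of_le_one_left hε.1.le (hs j).2) _) (abs_nonneg C)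

end Tools

/-! ### Kernels obtained by scaling a profile -/

section Profiles

variable {n : ℕ} {𝕜 : Type*} [RCLike 𝕜] {Ω : Opens (EuclideanSpace ℝ (Fin n))}

theorem wordDeriv_map_smul {V W : Type*} [NormedAddCommGroup V] [NormedSpace ℝ V]
    [NormedAddCommGroup W] [NormedSpace ℝ W] {U : Set V} {F : V → W}
    (hF : ContDiffOn ℝ ∞ F U) (hU : IsOpen U) (c : ℝ) (l : List V) :
    EqOn (wordDeriv (l.map fun v => c • v) F) (fun p => c ^ l.length • wordDeriv l F p) U := by
  induction l with
  | nil => intro p _; simp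
  | cons v l ih =>
    intro p hp
    rw [List.map_cons, wordDeriv_cons]
    have h1 := wordDeriv_congr hU ih [v] hp
    rw [wordDeriv_cons, wordDeriv_nil] at h1
    beta_reduce at h1 ⊢
    rw [map_smul, h1]
    have h2 := wordDeriv_const_smul (ContDiffOn.wordDeriv hF hU l) hU (c ^ l.length) [v] hp
    beta_reduce at h2
    rw [h2, smul_smul, List.length_cons, pow_succ']
    rfl

/-- A smooth radius function for which the closed balls of twice the radius lie in `Ω`. -/
structure IsRadius (Ω : Opens (EuclideanSpace ℝ (Fin n)))
    (r : EuclideanSpace ℝ (Fin n) → ℝ) : Prop where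
  smooth : ContDiffOn ℝ ∞ r Ω
  pos : ∀ x ∈ Ω, 0 < r x
  le_one : ∀ x ∈ Ω, r x ≤ 1
  subset : ∀ x ∈ Ω, Metric.closedBall x (2 * r x) ⊆ Ω

/-- A smooth family of functions `Φ(x, ·)` supported in the balls of radius `r x` around `0`. -/
structure IsProfile (Ω : Opens (EuclideanSpace ℝ (Fin n))) (r : EuclideanSpace ℝ (Fin n) → ℝ)
    (Φ : EuclideanSpace ℝ (Fin n) × EuclideanSpace ℝ (Fin n) → 𝕜) : Prop where
  smooth : ContDiffOn ℝ ∞ Φ ((Ω : Set (EuclideanSpace ℝ (Fin n))) ×ˢ univ)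
  eq_zero : ∀ x ∈ Ω, ∀ z, r x ≤ ‖z‖ → Φ (x, z) = 0

/-- The function `(ε, x, y) ↦ ε⁻ⁿ Φ(x, (y - x) / ε)`. -/
def scaled (Φ : EuclideanSpace ℝ (Fin n) × EuclideanSpace ℝ (Fin n) → 𝕜)
    (p : (ℝ × EuclideanSpace ℝ (Fin n)) × EuclideanSpace ℝ (Fin n)) : 𝕜 :=
  (p.1.1 ^ n)⁻¹ • Φ (p.1.2, p.1.1⁻¹ • (p.2 - p.1.2))

variable {r : EuclideanSpace ℝ (Fin n) → ℝ}
  {Φ : EuclideanSpace ℝ (Fin n) × EuclideanSpace ℝ (Fin n) → 𝕜}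

theorem IsProfile.scaled_eq_zero (hΦ : IsProfile Ω r Φ) {ε : ℝ} (hε : 0 < ε)
    {x y : EuclideanSpace ℝ (Fin n)} (hx : x ∈ Ω) (h : ε * r x ≤ dist y x) :
    scaled Φ ((ε, x), y) = 0 := by
  rw [scaled]
  beta_reduce
  rw [hΦ.eq_zero x hx, smul_zero]
  rwa [norm_smul, norm_inv, Real.norm_of_nonneg hε.le, ← dist_eq_norm, ← div_eq_inv_mul,
    le_div_iff₀ hε, mul_comm]

/-- The support lies in the closed ball of radius `ε r(x)`, with `ε < 2`. The strict inequality
leaves room to fix `closedBall x (2 r(x))` as common support for nearby parameters. The open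
interval `(0, 2)` makes `ε = 1` an interior parameter. -/
theorem IsProfile.isTestFamily (hΦ : IsProfile Ω r Φ) (hr : IsRadius Ω r) :
    IsTestFamily Ω (Ioo (0 : ℝ) 2 ×ˢ (Ω : Set (EuclideanSpace ℝ (Fin n)))) (scaled Φ) where
  isOpen := isOpen_Ioo.prod Ω.isOpen
  smooth := by
    have hne : ∀ p ∈ (Ioo (0 : ℝ) 2 ×ˢ (Ω : Set (EuclideanSpace ℝ (Fin n)))) ×ˢ
        (univ : Set (EuclideanSpace ℝ (Fin n))), p.1.1 ≠ 0 := fun p hp => hp.1.1.1.ne'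
    have h1 : ContDiffOn ℝ ∞ (fun p : (ℝ × EuclideanSpace ℝ (Fin n)) × EuclideanSpace ℝ (Fin n) =>
        (p.1.2, p.1.1⁻¹ • (p.2 - p.1.2)))
        ((Ioo (0 : ℝ) 2 ×ˢ (Ω : Set (EuclideanSpace ℝ (Fin n)))) ×ˢ univ) := by
      refine ContDiffOn.prodMk (by fun_prop) (ContDiffOn.smul (ContDiffOn.inv ?_ hne) ?_)
      · exact (contDiff_fst.comp contDiff_fst).contDiffOn
      · fun_prop
    refine ContDiffOn.smul (ContDiffOn.inv ?_ fun p hp => pow_ne_zero n (hne p hp))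
      (hΦ.smooth.comp h1 fun p hp => ⟨hp.1.2, mem_univ _⟩)
    exact ((contDiff_fst.comp contDiff_fst).pow n).contDiffOn
  supp := by
    rintro ⟨ε, x⟩ ⟨hε, hx⟩
    refine ⟨⟨Metric.closedBall x (2 * r x), isCompact_closedBall _ _⟩, hr.subset x hx, ?_⟩
    have hc : ContinuousAt (fun q : ℝ × EuclideanSpace ℝ (Fin n) => q.1 * r q.2 + dist q.2 x)
        (ε, x) := by
      refine (continuousAt_fst.mul (ContinuousAt.comp (f := Prod.snd) ?_ continuousAt_snd)).add
        (by fun_prop)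
      exact hr.smooth.continuousOn.continuousAt (Ω.isOpen.mem_nhds hx)
    have hlt : ε * r x + dist x x < 2 * r x := by
      rw [dist_self, add_zero]
      exact mul_lt_mul_of_pos_right hε.2 (hr.pos x hx)
    have h2 : ∀ᶠ q : ℝ × EuclideanSpace ℝ (Fin n) in 𝓝 (ε, x),
        q ∈ Ioo (0 : ℝ) 2 ×ˢ (Ω : Set (EuclideanSpace ℝ (Fin n))) :=
      (isOpen_Ioo.prod Ω.isOpen).mem_nhds ⟨hε, hx⟩
    filter_upwards [hc.eventually (gt_mem_nhds hlt), h2] with q hq hqm y hy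
    refine hΦ.scaled_eq_zero hqm.1.1 hqm.2 ?_
    have hy' : 2 * r x < dist y x := not_le.1 hy
    linarith [dist_triangle y q.2 x]

/-- The kernel `(ε, x) ↦ ε⁻ⁿ Φ(x, (· - x) / ε)`. -/
def profileKernel (Ω : Opens (EuclideanSpace ℝ (Fin n)))
    (Φ : EuclideanSpace ℝ (Fin n) × EuclideanSpace ℝ (Fin n) → 𝕜) (ε : ℝ)
    (x : EuclideanSpace ℝ (Fin n)) : 𝓓(Ω, 𝕜) :=
  toTest Ω fun y => scaled Φ ((ε, x), y)

theorem mem_of_Ioc {ε : ℝ} (hε : ε ∈ Ioc (0 : ℝ) 1) : ε ∈ Ioo (0 : ℝ) 2 :=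
  ⟨hε.1, by linarith [hε.2]⟩

theorem IsProfile.profileKernel_apply (hΦ : IsProfile Ω r Φ) (hr : IsRadius Ω r) {ε : ℝ}
    (hε : ε ∈ Ioc (0 : ℝ) 1) {x : EuclideanSpace ℝ (Fin n)} (hx : x ∈ Ω)
    (y : EuclideanSpace ℝ (Fin n)) : profileKernel Ω Φ ε x y = scaled Φ ((ε, x), y) :=
  congrFun ((hΦ.isTestFamily hr).coe_toTest (p := (ε, x)) ⟨mem_of_Ioc hε, hx⟩) y

theorem IsProfile.smoothMapOn (hΦ : IsProfile Ω r Φ) (hr : IsRadius Ω r) :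
    SmoothMapOn (fun p : ℝ × EuclideanSpace ℝ (Fin n) => profileKernel Ω Φ p.1 p.2)
      (Ioc (0 : ℝ) 1 ×ˢ (Ω : Set (EuclideanSpace ℝ (Fin n)))) :=
  (hΦ.isTestFamily hr).smoothMapOn (prod_mono (fun _ => mem_of_Ioc) subset_rfl)

theorem IsProfile.tsupport_subset (hΦ : IsProfile Ω r Φ) (hr : IsRadius Ω r) {ε : ℝ}
    (hε : ε ∈ Ioc (0 : ℝ) 1) {x : EuclideanSpace ℝ (Fin n)} (hx : x ∈ Ω) :
    tsupport (profileKernel Ω Φ ε x) ⊆ Metric.ball x (2 * ε) := by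
  have h : tsupport (profileKernel Ω Φ ε x) ⊆ Metric.closedBall x ε := by
    refine closure_minimal (fun y hy => ?_) Metric.isClosed_closedBall
    by_contra hy'
    refine hy ?_
    rw [hΦ.profileKernel_apply hr hε hx]
    refine hΦ.scaled_eq_zero hε.1 hx ?_
    have hy' : ε < dist y x := not_le.1 hy'
    have := mul_le_of_le_one_right hε.1.le (hr.le_one x hx)
    linarith
  exact h.trans (Metric.closedBall_subset_ball (by linarith [hε.1]))

theorem IsProfile.exists_bound_wordDeriv (hΦ : IsProfile Ω r Φ) (hr : IsRadius Ω r)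
    {K : Set (EuclideanSpace ℝ (Fin n))} (hK : IsCompact K) (hKΩ : K ⊆ Ω)
    (l : List (EuclideanSpace ℝ (Fin n) × EuclideanSpace ℝ (Fin n))) :
    ∃ C > 0, ∀ x ∈ K, ∀ z, ‖wordDeriv l Φ (x, z)‖ ≤ C := by
  have hU := IsDerivFamily.isOpen_prod_univ Ω
  obtain ⟨C, hC⟩ := (hK.prod (isCompact_closedBall
    (0 : EuclideanSpace ℝ (Fin n)) 1)).exists_bound_of_continuousOn
    ((ContDiffOn.wordDeriv hΦ.smooth hU l).continuousOn.mono (prod_mono hKΩ (subset_univ _)))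
  -- Since `r ≤ 1`, only `‖z‖ ≤ 1` matters, so a bound over a compact set is enough.
  refine ⟨|C| + 1, by positivity, fun x hx z => ?_⟩
  by_cases hz : z ∈ Metric.closedBall (0 : EuclideanSpace ℝ (Fin n)) 1
  · linarith [hC (x, z) ⟨hx, hz⟩, le_abs_self C]
  · have hO : IsOpen ((Ω : Set (EuclideanSpace ℝ (Fin n))) ×ˢ
        (Metric.closedBall (0 : EuclideanSpace ℝ (Fin n)) 1)ᶜ) :=
      Ω.isOpen.prod Metric.isClosed_closedBall.isOpen_compl
    have h0 : EqOn Φ 0 ((Ω : Set (EuclideanSpace ℝ (Fin n))) ×ˢ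
        (Metric.closedBall (0 : EuclideanSpace ℝ (Fin n)) 1)ᶜ) := fun p hp => by
      refine hΦ.eq_zero p.1 hp.1 p.2 ((hr.le_one _ hp.1).trans ?_)
      have := hp.2
      rw [mem_compl_iff, mem_closedBall_zero_iff, not_le] at this
      exact this.le
    rw [wordDeriv_congr hO h0 l (x := (x, z)) ⟨hKΩ hx, hz⟩, wordDeriv_zero]
    simp only [Pi.zero_apply, norm_zero]
    positivity

/-- `∂_x + ∂_y` annihilates `(y - x) / ε` and so acts only on the first argument of `Φ`, at no cost
in `ε`; each `∂_y` produces a factor `ε⁻¹`. -/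
theorem IsProfile.wordDeriv_scaled (hΦ : IsProfile Ω r Φ) (ε : ℝ) (a b : List (Fin n))
    {x : EuclideanSpace ℝ (Fin n)} (hx : x ∈ Ω) (y : EuclideanSpace ℝ (Fin n)) :
    wordDeriv (a.map (fun i => (stdVec i, stdVec i)) ++ b.map (fun i => (0, stdVec i)))
        (fun p => scaled Φ ((ε, p.1), p.2)) (x, y) =
      (ε ^ n)⁻¹ • ε⁻¹ ^ b.length • wordDeriv
        (a.map (fun i => (stdVec i, 0)) ++ b.map (fun i => (0, stdVec i))) Φ
        (x, ε⁻¹ • (y - x)) := by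
  have hU := IsDerivFamily.isOpen_prod_univ Ω
  set A : EuclideanSpace ℝ (Fin n) × EuclideanSpace ℝ (Fin n) →L[ℝ]
      EuclideanSpace ℝ (Fin n) × EuclideanSpace ℝ (Fin n) :=
    (ContinuousLinearMap.fst ℝ _ _).prod
      (ε⁻¹ • (ContinuousLinearMap.snd ℝ _ _ - ContinuousLinearMap.fst ℝ _ _)) with hA
  have hAp : ∀ p, A p = (p.1, ε⁻¹ • (p.2 - p.1)) := fun p => rfl
  have hS : ContDiffOn ℝ ∞ (fun p => Φ (A p + 0))
      ((Ω : Set (EuclideanSpace ℝ (Fin n))) ×ˢ univ) :=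
    hΦ.smooth.comp (by fun_prop) fun p hp => by
      rw [add_zero]; exact ⟨hp.1, mem_univ _⟩
  have e : (fun p : EuclideanSpace ℝ (Fin n) × EuclideanSpace ℝ (Fin n) =>
      scaled Φ ((ε, p.1), p.2)) = fun p => (ε ^ n)⁻¹ • Φ (A p + 0) := by
    funext p
    rw [add_zero, hAp]
    rfl
  rw [e, wordDeriv_const_smul hS hU _ _ (x := (x, y)) ⟨hx, mem_univ _⟩]
  beta_reduce
  rw [wordDeriv_comp_affine hΦ.smooth hU A 0 _ (by rw [add_zero]; exact ⟨hx, mem_univ _⟩),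
    add_zero, hAp]
  congr 1
  have hl : (a.map (fun i => (stdVec (n := n) i, stdVec i)) ++
      b.map (fun i => ((0 : EuclideanSpace ℝ (Fin n)), stdVec i))).map A =
      a.map (fun i => (stdVec i, 0)) ++
        (b.map (fun i => ((0 : EuclideanSpace ℝ (Fin n)), stdVec i))).map fun v => ε⁻¹ • v := by
    simp [hAp, Function.comp_def]
  rw [hl, wordDeriv_append, wordDeriv_append]
  have hq : (x, ε⁻¹ • (y - x)) ∈ (Ω : Set (EuclideanSpace ℝ (Fin n))) ×ˢ
      (univ : Set (EuclideanSpace ℝ (Fin n))) := ⟨hx, mem_univ _⟩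
  rw [wordDeriv_congr hU (wordDeriv_map_smul hΦ.smooth hU ε⁻¹ _) _ hq,
    wordDeriv_const_smul (ContDiffOn.wordDeriv hΦ.smooth hU _) hU _ _ hq, List.length_map]

theorem IsProfile.growth (hΦ : IsProfile Ω r Φ) (hr : IsRadius Ω r)
    {K : Set (EuclideanSpace ℝ (Fin n))} (hK : IsCompact K) (hKΩ : K ⊆ Ω) (α β : Fin n → ℕ) :
    ∃ ε₀ > 0, ∃ C > 0, ∀ ε ∈ Ioc (0 : ℝ) 1, ε ≤ ε₀ → ∀ x ∈ K, ∀ y ∈ Ω,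
      ‖multiPow pderivXY α (multiPow pderivY β fun x' y' => profileKernel Ω Φ ε x' y') x y‖
        ≤ C * (ε ^ (n + mdeg β))⁻¹ := by
  obtain ⟨C, hC, hb⟩ := hΦ.exists_bound_wordDeriv hr hK hKΩ
    ((multiWord α).map (fun i => (stdVec i, 0)) ++ (multiWord β).map (fun i => (0, stdVec i)))
  refine ⟨1, one_pos, C, hC, fun ε hε _ x hx y _ => ?_⟩
  have hF : ContDiffOn ℝ ∞ (fun p => scaled Φ ((ε, p.1), p.2))
      ((Ω : Set (EuclideanSpace ℝ (Fin n))) ×ˢ univ) :=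
    (hΦ.isTestFamily hr).smooth.comp (by fun_prop) fun p hp => ⟨⟨mem_of_Ioc hε, hp.1⟩, hp.2⟩
  have h1 := multiPow_pderivY_eqOn (Φ := fun x' y' => profileKernel Ω Φ ε x' y') (l := []) hF
    (fun p hp => hΦ.profileKernel_apply hr hε hp.1 p.2) β
  have h2 := multiPow_pderivXY_eqOn hF h1 α (x := (x, y)) ⟨hKΩ hx, mem_univ y⟩
  rw [List.append_nil, hΦ.wordDeriv_scaled ε _ _ (hKΩ hx)] at h2
  beta_reduce at h2
  have hpos : 0 < ε := hε.1
  rw [h2, norm_smul, norm_smul, length_multiWord, norm_pow, norm_inv, norm_inv, norm_pow,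
    Real.norm_of_nonneg hpos.le, pow_add, mul_inv, ← inv_pow ε (mdeg β), mul_comm C, mul_assoc]
  gcongr
  exact hb x hx _

end Profiles

/-! ### Existence of smoothing kernels of any order -/

section Existence

variable {n : ℕ} {𝕜 : Type*} [RCLike 𝕜] {Ω : Opens (EuclideanSpace ℝ (Fin n))}
  {r : EuclideanSpace ℝ (Fin n) → ℝ}
  {Φ : EuclideanSpace ℝ (Fin n) × EuclideanSpace ℝ (Fin n) → 𝕜} {f : Ω → 𝕜}

/-- The function `(ε, x) ↦ ∫ f(x + ε z) Φ(x, z) dz`. -/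
def pairing (f : Ω → 𝕜) (Φ : EuclideanSpace ℝ (Fin n) × EuclideanSpace ℝ (Fin n) → 𝕜)
    (p : ℝ × EuclideanSpace ℝ (Fin n)) : 𝕜 :=
  ∫ z, zeroExt Ω f (p.2 + p.1 • z) * Φ (p.2, z)

/-- The extension of `f` by zero need not be smooth outside `Ω`. But if `x + ε z ∉ Ω`, then `‖z‖ >
r(x)` because `|ε| < 2`, and `Φ` vanishes near such points. Values `ε ≤ 0` are included to allow
Taylor expansion at `0`. -/
theorem IsProfile.contDiffOn_integrand (hΦ : IsProfile Ω r Φ) (hr : IsRadius Ω r)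
    (hf : f ∈ smoothFunctions Ω 𝕜) :
    ContDiffOn ℝ ∞ (fun p : (ℝ × EuclideanSpace ℝ (Fin n)) × EuclideanSpace ℝ (Fin n) =>
      zeroExt Ω f (p.1.2 + p.1.1 • p.2) * Φ (p.1.2, p.2))
      ((Ioo (-2 : ℝ) 2 ×ˢ (Ω : Set (EuclideanSpace ℝ (Fin n)))) ×ˢ univ) := by
  rintro ⟨⟨ε, x⟩, z⟩ ⟨⟨hε, hx⟩, -⟩
  have hε : ε ∈ Ioo (-2 : ℝ) 2 := hε
  have hx : x ∈ Ω := hx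
  refine ContDiffAt.contDiffWithinAt ?_
  have hc : ContinuousAt (fun p : (ℝ × EuclideanSpace ℝ (Fin n)) × EuclideanSpace ℝ (Fin n) =>
      r p.1.2 - ‖p.2‖) ((ε, x), z) :=
    (ContinuousAt.comp (f := fun p : (ℝ × EuclideanSpace ℝ (Fin n)) × EuclideanSpace ℝ (Fin n) =>
      p.1.2) (hr.smooth.continuousOn.continuousAt (Ω.isOpen.mem_nhds hx)) (by fun_prop)).sub
      (by fun_prop)
  by_cases hm : x + ε • z ∈ Ω
  · have h1 : ContDiffAt ℝ ∞ (zeroExt Ω f) (x + ε • z) :=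
      ContDiffOn.contDiffAt hf (Ω.isOpen.mem_nhds hm)
    have h2 : ContDiffAt ℝ ∞ Φ (x, z) :=
      hΦ.smooth.contDiffAt ((IsDerivFamily.isOpen_prod_univ Ω).mem_nhds ⟨hx, mem_univ z⟩)
    refine ContDiffAt.mul (ContDiffAt.comp ((ε, x), z)
      (f := fun p : (ℝ × EuclideanSpace ℝ (Fin n)) × EuclideanSpace ℝ (Fin n) =>
        p.1.2 + p.1.1 • p.2) h1 ?_) (ContDiffAt.comp ((ε, x), z)
      (f := fun p : (ℝ × EuclideanSpace ℝ (Fin n)) × EuclideanSpace ℝ (Fin n) =>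
        (p.1.2, p.2)) h2 (by fun_prop))
    exact ContDiffAt.add (by fun_prop) (ContDiffAt.smul
      (contDiff_fst.comp contDiff_fst).contDiffAt contDiffAt_snd)
  · have hz : r x - ‖z‖ < 0 := by
      by_contra h
      refine hm (hr.subset x hx ?_)
      rw [mem_closedBall_iff_norm, add_sub_cancel_left, norm_smul]
      have : ‖ε‖ ≤ 2 := abs_le.2 ⟨hε.1.le, hε.2.le⟩
      exact mul_le_mul this (by linarith) (norm_nonneg _) zero_le_two
    refine (contDiffAt_const (c := (0 : 𝕜))).congr_of_eventuallyEq ?_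
    have hn : ∀ᶠ p : (ℝ × EuclideanSpace ℝ (Fin n)) × EuclideanSpace ℝ (Fin n) in
        𝓝 ((ε, x), z), p.1.2 ∈ Ω :=
      (show ContinuousAt (fun p : (ℝ × EuclideanSpace ℝ (Fin n)) × EuclideanSpace ℝ (Fin n) =>
        p.1.2) ((ε, x), z) by fun_prop).eventually (Ω.isOpen.mem_nhds hx)
    filter_upwards [hc.eventually (gt_mem_nhds hz), hn] with p hp hpΩ
    rw [hΦ.eq_zero _ hpΩ _ (by linarith), mul_zero]

theorem IsProfile.eq_zero_of_notMem (hΦ : IsProfile Ω r Φ) (hr : IsRadius Ω r)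
    {x z : EuclideanSpace ℝ (Fin n)} (hx : x ∈ Ω)
    (hz : z ∉ Metric.closedBall (0 : EuclideanSpace ℝ (Fin n)) 1) : Φ (x, z) = 0 := by
  refine hΦ.eq_zero x hx z ((hr.le_one x hx).trans ?_)
  rw [mem_closedBall_zero_iff, not_le] at hz
  exact hz.le

theorem IsProfile.contDiffOn_pairing (hΦ : IsProfile Ω r Φ) (hr : IsRadius Ω r)
    (hf : f ∈ smoothFunctions Ω 𝕜) :
    ContDiffOn ℝ ∞ (pairing f Φ) (Ioo (-2 : ℝ) 2 ×ˢ (Ω : Set (EuclideanSpace ℝ (Fin n)))) :=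
  contDiffOn_integral (isOpen_Ioo.prod Ω.isOpen) (hΦ.contDiffOn_integrand hr hf)
    (isCompact_closedBall 0 1) fun p hp z hz => by
      rw [hΦ.eq_zero_of_notMem hr hp.2 hz, mul_zero]

theorem IsProfile.integrable_integrand (hΦ : IsProfile Ω r Φ) (hr : IsRadius Ω r)
    (hf : f ∈ smoothFunctions Ω 𝕜) {ε : ℝ} (hε : ε ∈ Ioo (-2 : ℝ) 2)
    {x : EuclideanSpace ℝ (Fin n)} (hx : x ∈ Ω) :
    Integrable fun z => zeroExt Ω f (x + ε • z) * Φ (x, z) := by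
  refine Continuous.integrable_of_hasCompactSupport ?_
    (HasCompactSupport.intro (isCompact_closedBall (0 : EuclideanSpace ℝ (Fin n)) 1)
      fun z hz => by rw [hΦ.eq_zero_of_notMem hr hx hz, mul_zero])
  rw [← continuousOn_univ]
  exact (hΦ.contDiffOn_integrand hr hf).continuousOn.comp
    (f := fun z => ((ε, x), z)) (by fun_prop) fun z _ => ⟨⟨hε, hx⟩, mem_univ z⟩

theorem integral_inv_pow_smul_comp_inv_smul {s : ℝ} (hs : 0 < s)
    (G : EuclideanSpace ℝ (Fin n) → 𝕜) :
    ∫ z, (s ^ n)⁻¹ • G (s⁻¹ • z) = ∫ z, G z := by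
  rw [integral_smul, Measure.integral_comp_smul, finrank_euclideanSpace_fin, smul_smul, inv_pow,
    inv_inv, abs_of_pos (pow_pos hs n), inv_mul_cancel₀ (pow_pos hs n).ne', one_smul]

/-- Substitution `y = x + ε z`, which removes the singularity at `ε = 0`. -/
theorem IsProfile.regularDistribution_profileKernel (hΦ : IsProfile Ω r Φ) (hr : IsRadius Ω r)
    (hf : f ∈ smoothFunctions Ω 𝕜) {ε : ℝ} (hε : ε ∈ Ioc (0 : ℝ) 1)
    {x : EuclideanSpace ℝ (Fin n)} (hx : x ∈ Ω) :
    regularDistribution f (profileKernel Ω Φ ε x) = pairing f Φ (ε, x) := by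
  rw [regularDistribution_apply hf, pairing]
  beta_reduce
  rw [← integral_inv_pow_smul_comp_inv_smul hε.1 fun z => zeroExt Ω f (x + ε • z) * Φ (x, z),
    ← integral_sub_right_eq_self (fun z => (ε ^ n)⁻¹ • _) x]
  refine integral_congr_ae (Eventually.of_forall fun y => ?_)
  beta_reduce
  rw [hΦ.profileKernel_apply hr hε hx, smul_inv_smul₀ hε.1.ne', add_sub_cancel, scaled,
    mul_smul_comm]

theorem pairing_zero (x : EuclideanSpace ℝ (Fin n)) :
    pairing f Φ (0, x) = zeroExt Ω f x * ∫ z, Φ (x, z) := by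
  simp [pairing, integral_const_mul]

/-! ### Dilations and linear combinations of profiles -/

/-- The profile `(x, z) ↦ s⁻ⁿ Φ(x, z / s)`. -/
def dilate (s : ℝ) (Φ : EuclideanSpace ℝ (Fin n) × EuclideanSpace ℝ (Fin n) → 𝕜)
    (p : EuclideanSpace ℝ (Fin n) × EuclideanSpace ℝ (Fin n)) : 𝕜 :=
  (s ^ n)⁻¹ • Φ (p.1, s⁻¹ • p.2)

theorem IsProfile.dilate (hΦ : IsProfile Ω r Φ) (hr : IsRadius Ω r) {s : ℝ}
    (hs : s ∈ Ioc (0 : ℝ) 1) : IsProfile Ω r (dilate s Φ) where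
  smooth := (hΦ.smooth.comp
    (f := fun p : EuclideanSpace ℝ (Fin n) × EuclideanSpace ℝ (Fin n) => (p.1, s⁻¹ • p.2))
    (by fun_prop)
    fun p hp => ⟨hp.1, mem_univ _⟩).const_smul ((s ^ n)⁻¹)
  eq_zero x hx z hz := by
    rw [Colombeau.dilate]
    beta_reduce
    rw [hΦ.eq_zero x hx, smul_zero]
    rw [norm_smul, norm_inv, Real.norm_of_nonneg hs.1.le, ← div_eq_inv_mul, le_div_iff₀ hs.1]
    exact (mul_le_of_le_one_right (hr.pos x hx).le hs.2).trans hz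

/-- Dilating the profile amounts to rescaling `ε`, which turns a combination of profiles into an
extrapolation of `pairing` to `ε = 0`. -/
theorem pairing_dilate {s : ℝ} (hs : 0 < s) (ε : ℝ) (x : EuclideanSpace ℝ (Fin n)) :
    pairing f (dilate s Φ) (ε, x) = pairing f Φ (s * ε, x) := by
  rw [pairing, pairing]
  beta_reduce
  rw [← integral_inv_pow_smul_comp_inv_smul hs fun z => zeroExt Ω f (x + (s * ε) • z) * Φ (x, z)]
  refine integral_congr_ae (Eventually.of_forall fun z => ?_)
  beta_reduce
  rw [smul_smul, mul_right_comm, mul_inv_cancel₀ hs.ne', one_mul, Colombeau.dilate, mul_smul_comm]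

theorem IsProfile.sum_smul {ι : Type*} [Fintype ι]
    {Ψ : ι → EuclideanSpace ℝ (Fin n) × EuclideanSpace ℝ (Fin n) → 𝕜}
    (hΨ : ∀ j, IsProfile Ω r (Ψ j)) (c : ι → ℝ) : IsProfile Ω r fun p => ∑ j, c j • Ψ j p where
  smooth := ContDiffOn.sum fun j _ => (hΨ j).smooth.const_smul (c j)
  eq_zero x hx z hz := Finset.sum_eq_zero fun j _ => by rw [(hΨ j).eq_zero x hx z hz, smul_zero]

theorem pairing_sum_smul {ι : Type*} [Fintype ι]
    {Ψ : ι → EuclideanSpace ℝ (Fin n) × EuclideanSpace ℝ (Fin n) → 𝕜}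
    (hΨ : ∀ j, IsProfile Ω r (Ψ j)) (hr : IsRadius Ω r) (c : ι → ℝ)
    (hf : f ∈ smoothFunctions Ω 𝕜) {ε : ℝ} (hε : ε ∈ Ioo (-2 : ℝ) 2)
    {x : EuclideanSpace ℝ (Fin n)} (hx : x ∈ Ω) :
    pairing f (fun p => ∑ j, c j • Ψ j p) (ε, x) = ∑ j, c j • pairing f (Ψ j) (ε, x) := by
  simp only [pairing, Finset.mul_sum, mul_smul_comm]
  rw [integral_finsetSum _ fun j _ => by
    exact ((hΨ j).integrable_integrand hr hf hε hx).smul (c j)]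
  simp_rw [integral_smul]

/-- The profile obtained by scaling a normed bump function to the radius `r`. -/
theorem exists_isProfile (𝕜 : Type*) [RCLike 𝕜] (hr : IsRadius Ω r) :
    ∃ Φ : EuclideanSpace ℝ (Fin n) × EuclideanSpace ℝ (Fin n) → 𝕜, IsProfile Ω r Φ ∧
      ∀ x ∈ Ω, ∫ z, Φ (x, z) = 1 := by
  let b : ContDiffBump (0 : EuclideanSpace ℝ (Fin n)) := ⟨1 / 2, 1, by norm_num, by norm_num⟩
  have hne : ∀ p ∈ (Ω : Set (EuclideanSpace ℝ (Fin n))) ×ˢ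
    (univ : Set (EuclideanSpace ℝ (Fin n))), r p.1 ≠ 0 := fun p hp => (hr.pos _ hp.1).ne'
  have hr1 : ContDiffOn ℝ ∞ (fun p : EuclideanSpace ℝ (Fin n) × EuclideanSpace ℝ (Fin n) =>
      r p.1) ((Ω : Set (EuclideanSpace ℝ (Fin n))) ×ˢ univ) :=
    hr.smooth.comp contDiffOn_fst fun p hp => hp.1
  refine ⟨fun p => (r p.1 ^ n)⁻¹ • ((b.normed volume ((r p.1)⁻¹ • p.2) : ℝ) : 𝕜),
    ⟨?_, fun x hx z hz => ?_⟩, fun x hx => ?_⟩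
  · refine ContDiffOn.smul ((hr1.pow n).inv fun p hp => pow_ne_zero n (hne p hp)) ?_
    refine (RCLike.ofRealCLM (K := 𝕜)).contDiff.comp_contDiffOn ?_
    exact b.contDiff_normed.comp_contDiffOn ((hr1.inv hne).smul contDiffOn_snd)
  · have hz' : (r x)⁻¹ • z ∉ Function.support (b.normed volume) := by
      rw [b.support_normed_eq, mem_ball_zero_iff, not_lt, norm_smul, norm_inv,
        Real.norm_of_nonneg (hr.pos x hx).le, ← div_eq_inv_mul]
      exact (one_le_div (hr.pos x hx)).2 hz
    beta_reduce
    rw [Function.notMem_support.1 hz', RCLike.ofReal_zero, smul_zero]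
  · beta_reduce
    rw [integral_inv_pow_smul_comp_inv_smul (hr.pos x hx)
      fun z => ((b.normed volume z : ℝ) : 𝕜), integral_ofReal, b.integral_normed,
      RCLike.ofReal_one]

theorem exists_isRadius (Ω : Opens (EuclideanSpace ℝ (Fin n))) : ∃ r, IsRadius Ω r := by
  obtain ⟨r, hr, h⟩ := exists_smooth_radius Ω
  exact ⟨r, hr, fun x hx => (h x hx).1, fun x hx => (h x hx).2.1, fun x hx => (h x hx).2.2⟩

/-- The expression in the moment condition for a combination of dilations of a profile. -/
theorem setIntegral_profileKernel {ι : Type*} [Fintype ι] (hΦ : IsProfile Ω r Φ)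
    (hr : IsRadius Ω r) {s : ι → ℝ} (hs : ∀ j, s j ∈ Ioc (0 : ℝ) 1) (c : ι → ℝ)
    (hf : f ∈ smoothFunctions Ω 𝕜) (α : Fin n → ℕ) {ε : ℝ} (hε : ε ∈ Ioc (0 : ℝ) 1)
    {x : EuclideanSpace ℝ (Fin n)} (hx : x ∈ Ω) :
    (∫ y in (Ω : Set (EuclideanSpace ℝ (Fin n))), zeroExt Ω f y * multiPow pderivX α
      (fun x' y' => profileKernel Ω (fun p => ∑ j, c j • dilate (s j) Φ p) ε x' y') x y) =
    ∑ j, c j • wordDeriv ((multiWord α).map fun i => ((0 : ℝ), stdVec i)) (pairing f Φ)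
      (s j * ε, x) := by
  have hΨ := IsProfile.sum_smul (fun j => hΦ.dilate hr (hs j)) c
  obtain ⟨D, hD, h0⟩ := SmoothMapOn.exists_isDerivFamily (hΨ.smoothMapOn hr) hε
  rw [setIntegral_multiPow_pderivX hD h0 hf α hx]
  have hsε : ∀ j, s j * ε ∈ Ioo (-2 : ℝ) 2 := fun j =>
    ⟨by linarith [mul_pos (hs j).1 hε.1], (mul_le_one₀ (hs j).2 hε.1.le hε.2).trans_lt one_lt_two⟩
  have hU : IsOpen (Ioo (-2 : ℝ) 2 ×ˢ (Ω : Set (EuclideanSpace ℝ (Fin n)))) :=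
    isOpen_Ioo.prod Ω.isOpen
  have hsl : ∀ j, ContDiffOn ℝ ∞ (fun x => pairing f Φ (s j * ε, x)) Ω := fun j =>
    (hΦ.contDiffOn_pairing hr hf).comp (by fun_prop) fun x hx => ⟨hsε j, hx⟩
  have e1 := multiPow_pderiv_eqOn_apply hD (regularDistribution f)
    (g := fun x => ∑ j, c j • pairing f Φ (s j * ε, x)) (fun x hx => by
      beta_reduce
      rw [h0 hx, hΨ.regularDistribution_profileKernel hr hf hε hx,
        pairing_sum_smul (fun j => hΦ.dilate hr (hs j)) hr c hf
          ⟨by linarith [hε.1], by linarith [hε.2]⟩ hx]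
      exact Finset.sum_congr rfl fun j _ => by rw [pairing_dilate (hs j).1]) α hx
  beta_reduce at e1
  have hsl' : ∀ j, ContDiffOn ℝ ∞ (fun x => c j • pairing f Φ (s j * ε, x)) Ω :=
    fun j => (hsl j).const_smul (c j)
  rw [← e1, multiPow_pderiv_eqOn (ContDiffOn.sum fun j _ => hsl' j) (fun _ _ => rfl) α hx,
    wordDeriv_sum Finset.univ hsl' Ω.isOpen _ hx]
  refine Finset.sum_congr rfl fun j _ => ?_
  rw [wordDeriv_const_smul (hsl j) Ω.isOpen _ _ hx]
  beta_reduce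
  congr 1
  have := wordDeriv_comp_affine (hΦ.contDiffOn_pairing hr hf) hU
    (ContinuousLinearMap.inr ℝ ℝ (EuclideanSpace ℝ (Fin n))) (s j * ε, 0)
    ((multiWord α).map stdVec) (p := x) (by simpa using ⟨hsε j, hx⟩)
  simpa [Function.comp_def] using this

/-- There are smoothing kernels of any order, given by profiles of integral one. -/
theorem exists_isSmoothingKernel (Ω : Opens (EuclideanSpace ℝ (Fin n))) (𝕜 : Type*) [RCLike 𝕜]
    (q : ℕ) : ∃ (r : EuclideanSpace ℝ (Fin n) → ℝ)
      (Φ : EuclideanSpace ℝ (Fin n) × EuclideanSpace ℝ (Fin n) → 𝕜), IsRadius Ω r ∧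
      IsProfile Ω r Φ ∧ (∀ x ∈ Ω, ∫ z, Φ (x, z) = 1) ∧
      IsSmoothingKernel q (profileKernel Ω Φ) := by
  obtain ⟨r, hr⟩ := exists_isRadius Ω
  obtain ⟨Φ, hΦ, hint⟩ := exists_isProfile 𝕜 hr
  obtain ⟨c, hc⟩ := exists_extrapolation q
  have hs : ∀ j : Fin (q + 1), 1 / ((j : ℝ) + 1) ∈ Ioc (0 : ℝ) 1 := fun j =>
    ⟨by positivity, (div_le_one (by positivity)).2 (by simp)⟩
  have hΨ := IsProfile.sum_smul (fun j => hΦ.dilate hr (hs j)) c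
  refine ⟨r, _, hr, hΨ, fun x hx => ?_, hΨ.smoothMapOn hr, fun K hK hKΩ => ?_,
    fun K hK hKΩ α β => hΨ.growth hr hK hKΩ α β, fun K hK hKΩ α f hf => ?_⟩
  -- Total mass one: pair with the constant `1` at `ε = 0` and use the case `k = 0` of the
  -- extrapolation identities.
  · have h1 : (1 : Ω → 𝕜) ∈ smoothFunctions Ω 𝕜 := by
      refine (contDiffOn_const (c := (1 : 𝕜))).congr fun x hx => ?_
      rw [zeroExt_apply _ hx, Pi.one_apply]
    have h2 := pairing_sum_smul (fun j => hΦ.dilate hr (hs j)) hr c h1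
      (show (0 : ℝ) ∈ Ioo (-2 : ℝ) 2 by simp) hx
    have h3 := hc 0 (Nat.zero_le q)
    simp only [pow_zero, mul_one, if_true] at h3
    simp_rw [pairing_dilate (hs _).1, mul_zero, pairing_zero, hint x hx, zeroExt_apply _ hx,
      Pi.one_apply, one_mul, ← Finset.sum_smul, h3, one_smul] at h2
    exact h2
  · exact ⟨2, two_pos, 2, two_pos, fun x hx ε hε _ => hΨ.tsupport_subset hr hε (hKΩ hx)⟩
  · have hU : IsOpen (Ioo (-2 : ℝ) 2 ×ˢ (Ω : Set (EuclideanSpace ℝ (Fin n)))) :=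
      isOpen_Ioo.prod Ω.isOpen
    have hP := hΦ.contDiffOn_pairing hr hf
    -- The extrapolation is applied to the `x`-derivative of the pairing, whose value at `ε = 0` is
    -- `∂^α f` because the original profile has integral one.
    obtain ⟨C, hC, hb⟩ := exists_extrapolation_bound one_lt_two
      (ContDiffOn.wordDeriv hP hU ((multiWord α).map fun i => ((0 : ℝ), stdVec i))) hK hKΩ
      (fun j => Ioc_subset_Icc_self (hs j)) hc
    refine ⟨1, one_pos, C, hC, fun ε hε _ x hx => ?_⟩
    have h0 : wordDeriv ((multiWord α).map fun i => ((0 : ℝ), stdVec i)) (pairing f Φ) (0, x) =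
        multiPow pderiv α (zeroExt Ω f) x := by
      have h1 := wordDeriv_comp_affine hP hU
        (ContinuousLinearMap.inr ℝ ℝ (EuclideanSpace ℝ (Fin n))) (0, 0)
        ((multiWord α).map stdVec) (p := x) (by simpa using hKΩ hx)
      have h2 : EqOn (fun x => pairing f Φ (0, x)) (zeroExt Ω f) Ω := fun x hx => by
        beta_reduce
        rw [pairing_zero, hint x hx, mul_one]
      rw [multiPow_pderiv_eqOn hf (fun _ _ => rfl) α (hKΩ hx),
        ← wordDeriv_congr Ω.isOpen h2 _ (hKΩ hx)]
      simpa [Function.comp_def] using h1.symm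
    rw [setIntegral_profileKernel hΦ hr hs c hf α hε (hKΩ hx), ← h0]
    exact hb ε hε x hx

end Existence

/-! ### Integrals of families of test functions -/

section Fubini

variable {n : ℕ} {𝕜 : Type*} [RCLike 𝕜] {Ω : Opens (EuclideanSpace ℝ (Fin n))}
  {A : EuclideanSpace ℝ (Fin n) × EuclideanSpace ℝ (Fin n) → 𝕜}
  {k : Set (EuclideanSpace ℝ (Fin n))}

/-- Differentiation under the integral, dominated by a constant on `k` obtained from compactness of
`k × closedBall y 1`. -/
theorem fderiv_integral_apply (hA : ContDiff ℝ ∞ A) (hk : IsCompact k)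
    (h0 : ∀ x ∉ k, ∀ y, A (x, y) = 0) (y v : EuclideanSpace ℝ (Fin n)) :
    fderiv ℝ (fun y => ∫ x, A (x, y)) y v = ∫ x, fderiv ℝ A (x, y) (0, v) := by
  set F' : EuclideanSpace ℝ (Fin n) → EuclideanSpace ℝ (Fin n) →
      EuclideanSpace ℝ (Fin n) →L[ℝ] 𝕜 := fun y x =>
    (fderiv ℝ A (x, y)).comp (ContinuousLinearMap.inr ℝ _ _) with hF'
  have hfd : Continuous (fderiv ℝ A) := hA.continuous_fderiv (by simp)
  have hcF : Continuous fun p : EuclideanSpace ℝ (Fin n) × EuclideanSpace ℝ (Fin n) =>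
      F' p.2 p.1 := hfd.clm_comp continuous_const
  have hF0 : ∀ x ∉ k, ∀ y, F' y x = 0 := fun x hx y => by
    have hO : IsOpen (kᶜ ×ˢ (univ : Set (EuclideanSpace ℝ (Fin n)))) :=
      hk.isClosed.isOpen_compl.prod isOpen_univ
    have he : A =ᶠ[𝓝 (x, y)] fun _ => 0 := by
      filter_upwards [hO.mem_nhds (x := (x, y)) ⟨hx, mem_univ y⟩] with p hp using h0 p.1 hp.1 p.2
    simp [hF', he.fderiv_eq]
  have hint : ∀ y, Integrable fun x => A (x, y) := fun y =>
    Continuous.integrable_of_hasCompactSupport (hA.continuous.comp (by fun_prop))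
      (HasCompactSupport.intro hk fun x hx => h0 x hx y)
  have hint' : Integrable (F' y) :=
    Continuous.integrable_of_hasCompactSupport (hcF.comp (f := fun x => (x, y)) (by fun_prop))
      (HasCompactSupport.intro hk fun x hx => hF0 x hx y)
  obtain ⟨C, hC⟩ := (hk.prod (isCompact_closedBall y 1)).exists_bound_of_continuousOn
    hcF.continuousOn
  have hder := hasFDerivAt_integral_of_dominated_of_fderiv_le (μ := volume) (𝕜 := ℝ)
    (F := fun y x => A (x, y)) (F' := F') (x₀ := y) (bound := k.indicator fun _ => C)
    (Metric.closedBall_mem_nhds y one_pos)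
    (Eventually.of_forall fun y => (hint y).aestronglyMeasurable) (hint y)
    hint'.aestronglyMeasurable
    (Eventually.of_forall fun x y' hy' => by
      by_cases hx : x ∈ k
      · rw [indicator_of_mem hx]
        exact hC (x, y') ⟨hx, hy'⟩
      · rw [indicator_of_notMem hx, hF0 x hx, norm_zero])
    ((integrable_indicator_iff hk.measurableSet).2
      (integrableOn_const hk.measure_lt_top.ne))
    (Eventually.of_forall fun x y' _ => by
      have hd := (hA.differentiable (by simp) (x, y')).hasFDerivAt
      exact hd.comp y' (hasFDerivAt_prodMk_right x y'))
  rw [hder.fderiv, ContinuousLinearMap.integral_apply hint']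
  rfl

theorem wordDeriv_integral (hA : ContDiff ℝ ∞ A) (hk : IsCompact k)
    (h0 : ∀ x ∉ k, ∀ y, A (x, y) = 0) (l : List (EuclideanSpace ℝ (Fin n))) :
    wordDeriv l (fun y => ∫ x, A (x, y)) =
      fun y => ∫ x, wordDeriv (l.map fun v => (0, v)) A (x, y) := by
  induction l with
  | nil => rfl
  | cons v l ih =>
    funext y
    rw [wordDeriv_cons, ih]
    refine fderiv_integral_apply ?_ hk (fun x hx y => ?_) y v
    · exact contDiffOn_univ.1 (ContDiffOn.wordDeriv hA.contDiffOn isOpen_univ _)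
    · have hO : IsOpen (kᶜ ×ˢ (univ : Set (EuclideanSpace ℝ (Fin n)))) :=
        hk.isClosed.isOpen_compl.prod isOpen_univ
      rw [wordDeriv_congr hO (G := 0) (fun p hp => h0 p.1 hp.1 p.2) _ (x := (x, y))
        ⟨hx, mem_univ y⟩, wordDeriv_zero]
      rfl

/-- A functional which is bounded with respect to a linear map into a normed space factors through
this map. -/
theorem exists_dual_comp_eq {X B : Type*} [AddCommGroup X] [Module 𝕜 X] [NormedAddCommGroup B]
    [NormedSpace 𝕜 B] (J : X →ₗ[𝕜] B) (v : X →ₗ[𝕜] 𝕜) (C : ℝ) (h : ∀ ψ, ‖v ψ‖ ≤ C * ‖J ψ‖) :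
    ∃ ℓ : B →L[𝕜] 𝕜, ∀ ψ, ℓ (J ψ) = v ψ := by
  have hker : LinearMap.ker J ≤ LinearMap.ker v := fun ψ hψ => by
    have := h ψ
    rw [LinearMap.mem_ker.1 hψ, norm_zero, mul_zero] at this
    exact LinearMap.mem_ker.2 (norm_le_zero_iff.1 this)
  let f : LinearMap.range J →ₗ[𝕜] 𝕜 :=
    (LinearMap.ker J).liftQ v hker ∘ₗ J.quotKerEquivRange.symm.toLinearMap
  have hf : ∀ ψ, f ⟨J ψ, LinearMap.mem_range_self J ψ⟩ = v ψ := fun ψ => by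
    have : J.quotKerEquivRange.symm ⟨J ψ, LinearMap.mem_range_self J ψ⟩ =
        (LinearMap.ker J).mkQ ψ := by
      rw [LinearEquiv.symm_apply_eq]
      rfl
    change (LinearMap.ker J).liftQ v hker (J.quotKerEquivRange.symm _) = v ψ
    rw [this]
    rfl
  obtain ⟨ℓ, hℓ, -⟩ := exists_extension_norm_eq (LinearMap.range J) (f.mkContinuous C (by
    rintro ⟨_, ψ, rfl⟩
    rw [hf]
    exact h ψ))
  exact ⟨ℓ, fun ψ => (hℓ ⟨J ψ, LinearMap.mem_range_self J ψ⟩).trans (hf ψ)⟩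

/-- The space of the derivatives of orders `i ∈ s` of functions, with the sup norm. -/
def JetSpace (n : ℕ) (𝕜 : Type*) [RCLike 𝕜] (s : Finset ℕ) : Type _ :=
  ∀ i : s, BoundedContinuousFunction (EuclideanSpace ℝ (Fin n))
    (ContinuousMultilinearMap ℝ (fun _ : Fin (i : ℕ) => EuclideanSpace ℝ (Fin n)) 𝕜)

namespace JetSpace

variable {s : Finset ℕ}

instance : NormedAddCommGroup (JetSpace n 𝕜 s) := Pi.normedAddCommGroup

instance : NormedSpace 𝕜 (JetSpace n 𝕜 s) := Pi.normedSpace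

instance : NormedSpace ℝ (JetSpace n 𝕜 s) := Pi.normedSpace

instance : CompleteSpace (JetSpace n 𝕜 s) := Pi.complete _

/-- The value of an element of `JetSpace` at a point and at directions. -/
def eval (i : s) (y : EuclideanSpace ℝ (Fin n)) (w : Fin (i : ℕ) → EuclideanSpace ℝ (Fin n)) :
    JetSpace n 𝕜 s →L[ℝ] 𝕜 :=
  (ContinuousMultilinearMap.apply ℝ (fun _ : Fin (i : ℕ) => EuclideanSpace ℝ (Fin n)) 𝕜 w).comp
    ((BoundedContinuousFunction.evalCLM ℝ y).comp (ContinuousLinearMap.proj (R := ℝ)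
      (φ := fun i : s => BoundedContinuousFunction (EuclideanSpace ℝ (Fin n))
        (ContinuousMultilinearMap ℝ (fun _ : Fin (i : ℕ) => EuclideanSpace ℝ (Fin n)) 𝕜)) i))

theorem ext_eval {a b : JetSpace n 𝕜 s} (h : ∀ i y w, eval i y w a = eval i y w b) : a = b :=
  funext fun i => BoundedContinuousFunction.ext fun y => ContinuousMultilinearMap.ext fun w =>
    h i y w

/-- The derivatives of orders `i ∈ s` of a test function. -/
def jet (s : Finset ℕ) (K : Compacts (EuclideanSpace ℝ (Fin n))) :
    𝓓_{K}(EuclideanSpace ℝ (Fin n), 𝕜) →L[𝕜] JetSpace n 𝕜 s :=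
  ContinuousLinearMap.pi fun i : s => ContDiffMapSupportedIn.structureMapCLM 𝕜 ⊤ (i : ℕ)

theorem eval_jet {K : Compacts (EuclideanSpace ℝ (Fin n))}
    (ψ : 𝓓_{K}(EuclideanSpace ℝ (Fin n), 𝕜)) (i : s) (y : EuclideanSpace ℝ (Fin n))
    (w : Fin (i : ℕ) → EuclideanSpace ℝ (Fin n)) :
    eval i y w (jet s K ψ) = wordDeriv (List.ofFn w) ψ y := by
  rw [← iteratedFDeriv_apply_eq_wordDeriv ψ.contDiff.contDiffOn isOpen_univ w (mem_univ y)]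
  change ContDiffMapSupportedIn.structureMapCLM 𝕜 ⊤ (i : ℕ) ψ y w = _
  rw [ContDiffMapSupportedIn.structureMapCLM_top_apply]

end JetSpace

/-- A functional on `𝓓(Ω)` factors, on the test functions supported in `K`, through finitely many
derivatives. -/
theorem exists_dual_eq (u : 𝓓(Ω, 𝕜) →L[𝕜] 𝕜) {K : Compacts (EuclideanSpace ℝ (Fin n))}
    (hK : (K : Set (EuclideanSpace ℝ (Fin n))) ⊆ Ω) :
    ∃ (s : Finset ℕ) (ℓ : JetSpace n 𝕜 s →L[𝕜] 𝕜),
      ∀ ψ : 𝓓_{K}(EuclideanSpace ℝ (Fin n), 𝕜),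
        ℓ (JetSpace.jet s K ψ) = u (TestFunction.ofSupportedIn hK ψ) := by
  obtain ⟨s, C, -, h⟩ := Seminorm.bound_of_continuous
    (ContDiffMapSupportedIn.withSeminorms 𝕜 (EuclideanSpace ℝ (Fin n)) 𝕜 ⊤ K)
    ((normSeminorm 𝕜 𝕜).comp (u.comp (TestFunction.ofSupportedInCLM 𝕜 hK)).toLinearMap)
    (continuous_norm.comp (u.comp (TestFunction.ofSupportedInCLM 𝕜 hK)).continuous)
  obtain ⟨ℓ, hℓ⟩ := exists_dual_comp_eq (JetSpace.jet s K).toLinearMap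
    (u.comp (TestFunction.ofSupportedInCLM 𝕜 hK)).toLinearMap C fun ψ => by
      refine (h ψ).trans (mul_le_mul_of_nonneg_left
        (Seminorm.finset_sup_apply_le (norm_nonneg _) fun i hi => ?_) C.coe_nonneg)
      exact norm_le_pi_norm (fun i : s =>
        ContDiffMapSupportedIn.structureMapCLM 𝕜 ⊤ (i : ℕ) ψ) ⟨i, hi⟩
  exact ⟨s, ℓ, hℓ⟩

theorem isTestFamily_univ (hA : ContDiff ℝ ∞ A) {K : Compacts (EuclideanSpace ℝ (Fin n))}
    (hK : (K : Set (EuclideanSpace ℝ (Fin n))) ⊆ Ω) (h0 : ∀ x, ∀ y ∉ K, A (x, y) = 0) :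
    IsTestFamily Ω univ A :=
  ⟨isOpen_univ, hA.contDiffOn, fun _ _ => ⟨K, hK, Eventually.of_forall h0⟩⟩

/-- On `𝓓_K` the functional factors through a Banach space of finitely many derivatives. There the
family has a Bochner integral, which commutes with the functional `ℓ`. -/
theorem apply_toTest_integral (u : 𝓓(Ω, 𝕜) →L[𝕜] 𝕜) (hA : ContDiff ℝ ∞ A) (hk : IsCompact k)
    (h0 : ∀ x ∉ k, ∀ y, A (x, y) = 0) {K : Compacts (EuclideanSpace ℝ (Fin n))}
    (hK : (K : Set (EuclideanSpace ℝ (Fin n))) ⊆ Ω) (h1 : ∀ x, ∀ y ∉ K, A (x, y) = 0) :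
    u (toTest Ω fun y => ∫ x, A (x, y)) = ∫ x, u (toTest Ω fun y => A (x, y)) := by
  have hF := isTestFamily_univ hA hK h1
  obtain ⟨s, ℓ, hℓ⟩ := exists_dual_eq u hK
  have hsl : ∀ x, ContDiff ℝ ∞ fun y => A (x, y) := fun x => hF.contDiff_slice (mem_univ x)
  have hS : ContDiff ℝ ∞ fun y => ∫ x, A (x, y) := by
    rw [← contDiffOn_univ]
    refine contDiffOn_integral (H := fun y x => A (x, y)) isOpen_univ ?_ hk
      fun y _ x hx => h0 x hx y
    exact (hA.comp (by fun_prop : ContDiff ℝ ∞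
      fun p : EuclideanSpace ℝ (Fin n) × EuclideanSpace ℝ (Fin n) => (p.2, p.1))).contDiffOn
  have hS0 : EqOn (fun y => ∫ x, A (x, y)) 0 (K : Set (EuclideanSpace ℝ (Fin n)))ᶜ :=
    fun y hy => by simp [h1 _ y hy]
  set G : EuclideanSpace ℝ (Fin n) → JetSpace n 𝕜 s := fun x =>
    JetSpace.jet s K (toSupported K fun y => A (x, y)) with hG
  have hGc : Continuous G := (JetSpace.jet s K).continuous.comp
    (continuous_iff_continuousAt.2 fun x =>
      hF.tendsto_toSupported (mem_univ x) (Eventually.of_forall h1))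
  have hG0 : ∀ x ∉ k, G x = 0 := fun x hx => by
    have : toSupported K (fun y => A (x, y)) = 0 := by
      ext y
      rw [coe_toSupported (hsl x) fun y hy => h1 x y hy]
      exact h0 x hx y
    rw [hG]
    simp only [this, map_zero]
  have hGi : Integrable G :=
    hGc.integrable_of_hasCompactSupport (HasCompactSupport.intro hk hG0)
  -- Point evaluations separate the elements of `JetSpace`, so this is differentiation under the
  -- scalar integral.
  have hGS : ∫ x, G x = JetSpace.jet s K (toSupported K fun y => ∫ x, A (x, y)) := by
    refine JetSpace.ext_eval fun i y w => ?_
    have hev : ∀ x, JetSpace.eval i y w (G x) =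
        wordDeriv ((List.ofFn w).map fun v => (0, v)) A (x, y) := fun x => by
      rw [← hF.wordDeriv_slice (mem_univ x), hG, JetSpace.eval_jet,
        coe_toSupported (hsl x) fun y hy => h1 x y hy]
    rw [← (JetSpace.eval i y w).integral_comp_comm hGi, JetSpace.eval_jet, coe_toSupported hS hS0,
      wordDeriv_integral hA hk h0]
    simp_rw [hev]
  rw [toTest_eq_ofSupportedIn hK hS hS0, ← hℓ, ← hGS, ← ℓ.integral_comp_comm hGi]
  refine integral_congr_ae (Eventually.of_forall fun x => ?_)
  beta_reduce
  rw [hG, hℓ, toTest_eq_ofSupportedIn hK (hsl x) fun y hy => h1 x y hy]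

end Fubini

/-! ### Negligible distributions vanish -/

section Negligible

variable {n : ℕ} {𝕜 : Type*} [RCLike 𝕜] {Ω : Opens (EuclideanSpace ℝ (Fin n))}
  {r : EuclideanSpace ℝ (Fin n) → ℝ}
  {Φ : EuclideanSpace ℝ (Fin n) × EuclideanSpace ℝ (Fin n) → 𝕜}

theorem contDiff_mul_of_contDiffOn {V : Type*} [NormedAddCommGroup V] [NormedSpace ℝ V]
    {F : EuclideanSpace ℝ (Fin n) × V → 𝕜} (χ : 𝓓(Ω, 𝕜))
    (hF : ContDiffOn ℝ ∞ F ((Ω : Set (EuclideanSpace ℝ (Fin n))) ×ˢ univ)) :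
    ContDiff ℝ ∞ fun p => χ p.1 * F p := by
  rw [contDiff_iff_contDiffAt]
  rintro ⟨x, z⟩
  by_cases hx : x ∈ Ω
  · exact (χ.contDiff.comp contDiff_fst).contDiffAt.mul
      (hF.contDiffAt ((Ω.isOpen.prod isOpen_univ).mem_nhds ⟨hx, mem_univ z⟩))
  · have hO : IsOpen ((tsupport χ)ᶜ ×ˢ (univ : Set V)) :=
      (isClosed_tsupport χ).isOpen_compl.prod isOpen_univ
    refine (contDiffAt_const (c := (0 : 𝕜))).congr_of_eventuallyEq ?_
    filter_upwards [hO.mem_nhds (x := (x, z)) ⟨fun h => hx (χ.tsupport_subset h), mem_univ z⟩]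
      with p hp
    rw [image_eq_zero_of_notMem_tsupport hp.1, zero_mul]

/-- The function `(ε, y) ↦ ∫ χ(y - ε z) Φ(y - ε z, z) dz`, which for `ε ≠ 0` is the integral of
`χ(x) ε⁻ⁿ Φ(x, (y - x) / ε)` with respect to `x`. -/
def average (χ : 𝓓(Ω, 𝕜)) (Φ : EuclideanSpace ℝ (Fin n) × EuclideanSpace ℝ (Fin n) → 𝕜)
    (p : ℝ × EuclideanSpace ℝ (Fin n)) : 𝕜 :=
  ∫ z, χ (p.2 - p.1 • z) * Φ (p.2 - p.1 • z, z)

theorem average_eq_integral (χ : 𝓓(Ω, 𝕜)) {ε : ℝ} (hε : 0 < ε) (y : EuclideanSpace ℝ (Fin n)) :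
    average χ Φ (ε, y) = ∫ x, χ x * scaled Φ ((ε, x), y) := by
  rw [average]
  beta_reduce
  rw [← integral_inv_pow_smul_comp_inv_smul hε fun z => χ (y - ε • z) * Φ (y - ε • z, z),
    ← integral_sub_left_eq_self (fun z => (ε ^ n)⁻¹ • _) volume y]
  refine integral_congr_ae (Eventually.of_forall fun x => ?_)
  beta_reduce
  rw [smul_inv_smul₀ hε.ne', sub_sub_cancel, scaled, mul_smul_comm]

theorem average_zero (χ : 𝓓(Ω, 𝕜)) (h1 : ∀ x ∈ Ω, ∫ z, Φ (x, z) = 1) :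
    (fun y => average χ Φ (0, y)) = χ := by
  funext y
  simp only [average, zero_smul, sub_zero, integral_const_mul]
  by_cases hy : y ∈ Ω
  · rw [h1 y hy, mul_one]
  · rw [image_eq_zero_of_notMem_tsupport fun h => hy (χ.tsupport_subset h), zero_mul]

theorem IsProfile.mul_eq_zero (hΦ : IsProfile Ω r Φ) (hr : IsRadius Ω r) (χ : 𝓓(Ω, 𝕜))
    {x z : EuclideanSpace ℝ (Fin n)}
    (h : x ∉ tsupport χ ∨ z ∉ Metric.closedBall (0 : EuclideanSpace ℝ (Fin n)) 1) :
    χ x * Φ (x, z) = 0 := by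
  by_cases hx : x ∈ tsupport χ
  · rw [hΦ.eq_zero_of_notMem hr (χ.tsupport_subset hx) (h.resolve_left (not_not.2 hx)), mul_zero]
  · rw [image_eq_zero_of_notMem_tsupport hx, zero_mul]

/-- In the variable `z` the integrand is smooth for all real `ε`, including `0`; the cutoff `χ`
makes it smooth beyond `Ω` as well. -/
theorem IsProfile.contDiff_average (hΦ : IsProfile Ω r Φ) (hr : IsRadius Ω r) (χ : 𝓓(Ω, 𝕜)) :
    ContDiff ℝ ∞ (average χ Φ) := by
  have h := contDiff_mul_of_contDiffOn χ hΦ.smooth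
  rw [← contDiffOn_univ]
  refine contDiffOn_integral (H := fun (p : ℝ × EuclideanSpace ℝ (Fin n)) z =>
    χ (p.2 - p.1 • z) * Φ (p.2 - p.1 • z, z)) isOpen_univ (ContDiff.contDiffOn ?_)
    (isCompact_closedBall 0 1) fun p _ z hz => hΦ.mul_eq_zero hr χ (Or.inr hz)
  refine h.comp (f := fun p : (ℝ × EuclideanSpace ℝ (Fin n)) × EuclideanSpace ℝ (Fin n) =>
    (p.1.2 - p.1.1 • p.2, p.2)) (ContDiff.prodMk (ContDiff.sub (by fun_prop) ?_) contDiff_snd)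
  exact (contDiff_fst.comp contDiff_fst).smul contDiff_snd

/-- `x ↦ χ(x) ε⁻ⁿ Φ(x, (· - x) / ε)` and its integral are supported near the support of `χ`. -/
theorem IsProfile.mul_eq_zero_of_notMem_cthickening (hΦ : IsProfile Ω r Φ) (hr : IsRadius Ω r)
    (χ : 𝓓(Ω, 𝕜)) {ε δ : ℝ} (hε : |ε| ≤ δ) {y : EuclideanSpace ℝ (Fin n)}
    (hy : y ∉ Metric.cthickening δ (tsupport χ)) (z : EuclideanSpace ℝ (Fin n)) :
    χ (y - ε • z) * Φ (y - ε • z, z) = 0 := by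
  refine hΦ.mul_eq_zero hr χ ?_
  by_contra! h
  refine hy (Metric.mem_cthickening_of_dist_le y _ δ _ h.1 ?_)
  rw [dist_eq_norm, sub_sub_cancel, norm_smul, Real.norm_eq_abs]
  exact (mul_le_of_le_one_right (abs_nonneg ε) (mem_closedBall_zero_iff.1 h.2)).trans hε

theorem IsProfile.apply_average (hΦ : IsProfile Ω r Φ) (hr : IsRadius Ω r) (χ : 𝓓(Ω, 𝕜))
    {δ : ℝ} (hδ : Metric.cthickening δ (tsupport χ) ⊆ Ω) {ε : ℝ} (hε : ε ∈ Ioc (0 : ℝ) 1)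
    (hεδ : ε ≤ δ) (u : 𝓓(Ω, 𝕜) →L[𝕜] 𝕜) :
    u (toTest Ω fun y => average χ Φ (ε, y)) = ∫ x, χ x * u (profileKernel Ω Φ ε x) := by
  have hF : ContDiffOn ℝ ∞ (fun p => scaled Φ ((ε, p.1), p.2))
      ((Ω : Set (EuclideanSpace ℝ (Fin n))) ×ˢ univ) :=
    (hΦ.isTestFamily hr).smooth.comp (by fun_prop) fun p hp => ⟨⟨mem_of_Ioc hε, hp.1⟩, hp.2⟩
  simp_rw [average_eq_integral χ hε.1]
  have hsub : ∀ x y, y ∉ Metric.cthickening δ (tsupport χ) →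
      χ x * scaled Φ ((ε, x), y) = 0 := fun x y hy => by
    have := hΦ.mul_eq_zero_of_notMem_cthickening hr χ
      (show |ε| ≤ δ by rwa [abs_of_pos hε.1]) hy (ε⁻¹ • (y - x))
    rw [smul_inv_smul₀ hε.1.ne', sub_sub_cancel] at this
    rw [scaled, mul_smul_comm, this, smul_zero]
  rw [apply_toTest_integral u (A := fun p => χ p.1 * scaled Φ ((ε, p.1), p.2))
    (contDiff_mul_of_contDiffOn χ hF) χ.hasCompactSupport
    (fun x hx y => by rw [image_eq_zero_of_notMem_tsupport hx, zero_mul])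
    (K := ⟨_, χ.hasCompactSupport.isCompact.cthickening⟩) hδ hsub]
  refine integral_congr_ae (Eventually.of_forall fun x => ?_)
  beta_reduce
  rw [← smul_eq_mul, ← map_smul]
  congr 1
  by_cases hx : x ∈ Ω
  · have e : (fun y => χ x * scaled Φ ((ε, x), y)) = χ x • ⇑(profileKernel Ω Φ ε x) := by
      funext y
      rw [Pi.smul_apply, hΦ.profileKernel_apply hr hε hx, smul_eq_mul]
    rw [e, ← FunLike.coe_smul, toTest_coe]
  -- Outside `Ω` nothing is known about the kernel, but the weight `χ x` vanishes.
  · have h0 : χ x = 0 := image_eq_zero_of_notMem_tsupport fun h => hx (χ.tsupport_subset h)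
    simp_rw [h0, zero_mul, zero_smul]
    exact toTest_coe 0

/-- The averages form a test family over `(-δ, δ)`, with supports in the compact `δ`-thickening of
the support of `χ`; the claim is its continuity at the interior parameter `0`, where the value is
`χ`. -/
theorem IsProfile.tendsto_average (hΦ : IsProfile Ω r Φ) (hr : IsRadius Ω r)
    (h1 : ∀ x ∈ Ω, ∫ z, Φ (x, z) = 1) (χ : 𝓓(Ω, 𝕜)) {δ : ℝ} (hδ0 : 0 < δ)
    (hδ : Metric.cthickening δ (tsupport χ) ⊆ Ω) :
    Tendsto (fun ε : ℝ => toTest Ω fun y => average χ Φ (ε, y)) (𝓝 0) (𝓝 χ) := by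
  have hF : IsTestFamily Ω (Ioo (-δ) δ) (average χ Φ) :=
    ⟨isOpen_Ioo, (hΦ.contDiff_average hr χ).contDiffOn, fun ε hε =>
      ⟨⟨_, χ.hasCompactSupport.isCompact.cthickening⟩, hδ, by
        filter_upwards [isOpen_Ioo.mem_nhds hε] with t ht y hy
        refine (integral_congr_ae (Eventually.of_forall fun z => ?_)).trans
          (integral_zero (EuclideanSpace ℝ (Fin n)) 𝕜)
        exact hΦ.mul_eq_zero_of_notMem_cthickening hr χ (abs_le.2 ⟨ht.1.le, ht.2.le⟩) hy z⟩⟩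
  have := hF.continuousAt_toTest (p := 0) (by simpa using hδ0)
  rwa [ContinuousAt, average_zero χ h1, toTest_coe] at this

theorem eq_zero_of_iota_mem_negligible {u : 𝓓(Ω, 𝕜) →L[𝕜] 𝕜} (hu : iota u ∈ negligible Ω 𝕜) :
    u = 0 := by
  ext χ
  have hK : IsCompact (tsupport χ) := χ.hasCompactSupport
  -- No derivatives and a single power of `ε` are all that is needed of negligibility.
  obtain ⟨q, hq⟩ := hu.2 (tsupport χ) hK χ.tsupport_subset 0 1
  obtain ⟨r, Φ, hr, hΦ, h1, hker⟩ := exists_isSmoothingKernel Ω 𝕜 q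
  obtain ⟨ε₀, hε₀, C, hC, hb⟩ := hq _ hker
  obtain ⟨δ, hδ0, hδ⟩ := hK.exists_cthickening_subset_open Ω.isOpen χ.tsupport_subset
  have hu0 : ∀ ε ∈ Ioc (0 : ℝ) 1, ε ≤ ε₀ → ∀ x ∈ tsupport χ,
      ‖u (profileKernel Ω Φ ε x)‖ ≤ C * ε := fun ε hε hle x hx => by
    have h := hb ε hε hle x hx
    have e : testDeriv (iota u) (profileKernel Ω Φ) 0 ε x = u (profileKernel Ω Φ ε x) := by
      simp [testDeriv, multiPow, zeroExt_apply _ (χ.tsupport_subset hx), iota]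
    rwa [e, pow_one] at h
  have hlim : Tendsto (fun ε : ℝ => u (toTest Ω fun y => average χ Φ (ε, y))) (𝓝[>] 0)
      (𝓝 (u χ)) :=
    ((u.continuous.tendsto χ).comp (hΦ.tendsto_average hr h1 χ hδ0 hδ)).mono_left
      nhdsWithin_le_nhds
  have hint : Integrable χ := χ.contDiff.continuous.integrable_of_hasCompactSupport
    χ.hasCompactSupport
  -- The pairing with the average is the integral of `χ(x) ⟨u, φ_{ε,x}⟩`, and the second factor is
  -- at most `C ε` on the support of `χ`.
  have hle : ∀ᶠ ε : ℝ in 𝓝[>] 0, ‖u (toTest Ω fun y => average χ Φ (ε, y))‖ ≤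
      (∫ x, ‖χ x‖) * (C * ε) := by
    filter_upwards [Ioc_mem_nhdsGT (show (0 : ℝ) < min 1 (min ε₀ δ) by positivity)] with ε hε
    have hε1 : ε ∈ Ioc (0 : ℝ) 1 := ⟨hε.1, hε.2.trans (min_le_left _ _)⟩
    have hε2 := hε.2.trans (min_le_right _ _)
    rw [hΦ.apply_average hr χ hδ hε1 (hε2.trans (min_le_right _ _)), ← integral_mul_const]
    refine norm_integral_le_of_norm_le (hint.norm.mul_const _) (Eventually.of_forall fun x => ?_)
    rw [norm_mul]
    by_cases hx : x ∈ tsupport χ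
    · exact mul_le_mul_of_nonneg_left (hu0 ε hε1 (hε2.trans (min_le_left _ _)) x hx)
        (norm_nonneg _)
    · rw [image_eq_zero_of_notMem_tsupport hx, norm_zero, zero_mul, zero_mul]
  have h0 : Tendsto (fun ε : ℝ => (∫ x, ‖χ x‖) * (C * ε)) (𝓝[>] 0) (𝓝 0) := by
    have : Continuous fun ε : ℝ => (∫ x, ‖χ x‖) * (C * ε) := by fun_prop
    simpa using (this.tendsto 0).mono_left nhdsWithin_le_nhds
  exact tendsto_nhds_unique hlim (squeeze_zero_norm' hle h0)

end Negligible

end Colombeau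

end

theorem mainTheorem2 {𝕜 : Type*} [RCLike 𝕜] {n : ℕ}
    (Ω : TopologicalSpace.Opens (EuclideanSpace ℝ (Fin n))) :
    -- (i) distributions are moderate
    Set.range (fun u : 𝓓(Ω, 𝕜) →L[𝕜] 𝕜 => Colombeau.iota u) ⊆ Colombeau.moderate Ω 𝕜 ∧
    -- (ii) smooth functions are moderate
    (fun f : Ω → 𝕜 => Colombeau.sigma f) '' Colombeau.smoothFunctions Ω 𝕜
      ⊆ Colombeau.moderate Ω 𝕜 ∧
    -- (iii) on smooth functions the two embeddings differ by negligible elements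
    (fun f : Ω → 𝕜 => Colombeau.iota (Colombeau.regularDistribution f) - Colombeau.sigma f) ''
      Colombeau.smoothFunctions Ω 𝕜 ⊆ Colombeau.negligible Ω 𝕜 ∧
    -- (iv) only zero is both a distribution and negligible
    Set.range (fun u : 𝓓(Ω, 𝕜) →L[𝕜] 𝕜 => Colombeau.iota u) ∩ Colombeau.negligible Ω 𝕜 = {0} ∧
    -- in particular, `ι` is injective modulo negligible elements
    (∀ u v : 𝓓(Ω, 𝕜) →L[𝕜] 𝕜,
      Colombeau.iota u - Colombeau.iota v ∈ Colombeau.negligible Ω 𝕜 → u = v) := by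
  refine ⟨?_, ?_, ?_, ?_, fun u v h => ?_⟩
  · rintro _ ⟨u, rfl⟩
    exact Colombeau.iota_mem_moderate u
  · rintro _ ⟨f, hf, rfl⟩
    exact Colombeau.sigma_mem_moderate hf
  · rintro _ ⟨f, hf, rfl⟩
    exact Colombeau.iota_sub_sigma_mem_negligible hf
  · refine Set.Subset.antisymm ?_ (Set.singleton_subset_iff.2
      ⟨⟨0, rfl⟩, Colombeau.zero_mem_negligible⟩)
    rintro _ ⟨⟨u, rfl⟩, hu⟩
    rw [Colombeau.eq_zero_of_iota_mem_negligible hu]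
    rfl
  -- `ι` is linear: `ι u - ι v` is `ι (u - v)` by definition.
  · exact sub_eq_zero.1 (Colombeau.eq_zero_of_iota_mem_negligible (u := u - v) h)
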